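/- A two-rebit density matrix is a real symmetric $4\times4$ matrix $\rho$ with nonnegative eigenvalues and trace one. Its partial transpose $\rho^{PT}$ is obtained by transposing in place each of the four $2\times2$ blocks of $\rho$. Let $\langle\cdot\rangle$ be the expectation over the probability distribution obtained by normalizing the $9$-dimensional Hilbert--Schmidt (Euclidean, flat) volume on the set of two-rebit density matrices, and let $|\cdot|$ be the determinant. Write $(x)_m=x(x+1)\cdots(x+m-1)$ and $$B_n(k)=128^n\,(k+3)_n\,\bigl(2k+\tfrac{11}{2}\bigr)_{2n}.$$ All the moments $\langle|\rho|^k|\rho^{PT}|^n\rangle$ with integers $k,n\ge0$ exist, and for every integer $k\ge0$: $$\langle|\rho|^k|\rho^{PT}|\rangle=\frac{(k-1)\,(k(2k+11)+16)}{32(k+3)(4k+11)(4k+13)}\,\langle|\rho|^k\rangle,$$ $$\langle|\rho|^k|\rho^{PT}|^2\rangle=\frac{k(k(k(k(4k(k+12)+203)+368)+709)+2940)+4860}{1024(k+3)(k+4)(4k+11)(4k+13)(4k+15)(4k+17)}\,\langle|\rho|^k\rangle,$$ and, for $n=1,\dots,6$, $\langle|\rho|^k|\rho^{PT}|^n\rangle=\frac{A_n(k)}{B_n(k)}\langle|\rho|^k\rangle$,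 where $$A_1(k)=2k^{3} + 9k^{2} + 5k - 16,$$ $$A_2(k)=4k^{6} + 48k^{5} + 203k^{4} + 368k^{3} + 709k^{2} + 2940k + 4860,$$ $$A_3(k)=8k^{9} + 180k^{8} + 1674k^{7} + 8559k^{6} + 29493k^{5} + 84291k^{4} + 136801k^{3} - 401334k^{2} - 2516616k - 3612816,$$ $$A_4(k)=16k^{12} + 576k^{11} + 9112k^{10} + 84496k^{9} + 525681k^{8} + 2389416k^{7} + 7805462k^{6} + 13904508k^{5} + 6212189k^{4} + 166748972k^{3} + 1636873812k^{2} + 5496485760k + 6610161600,$$ $$A_5(k)=32k^{15} + 1680k^{14} + 40000k^{13} + 575800k^{12} + 5660714k^{11} + 40679505k^{10} + 219916945k^{9} + 883461210k^{8} + 2649513956k^{7} + 7876634465k^{6} + 29246867605k^{5} - 4378482660k^{4} - 1199508017652k^{3} - 7755993054000k^{2} - 21644930613600k - 23680812672000,$$ $$A_6(k)=64k^{18} + 4608k^{17} + 153360k^{16} + 3143808k^{15} + 44685468k^{14} + 469728096k^{13} + 3786901675k^{12} + 23817008856k^{11} + 118164517947k^{10} + 477741210624k^{9} + 1632448582425k^{8}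 + 3583820785224k^{7} - 6899036908859k^{6} - 30302414250528k^{5} + 1052189083196640k^{4} + 11977854861441312k^{3} + 58524043784903280k^{2} + 144374531813568000k + 147885533254368000.$$ (For $n=1,2$ these are the two displayed formulas, and $B_3(k)=32768(k+3)(k+4)(k+5)(4k+11)(4k+13)(4k+15)(4k+17)(4k+19)(4k+21)$.) Moreover, for all $n=1,\dots,13$ and every integer $k\ge0$, $\langle|\rho|^k|\rho^{PT}|^n\rangle=\frac{A_n(k)}{B_n(k)}\langle|\rho|^k\rangle$ with $$A_n(k)=2^n\sum_{j=0}^n\frac{4^j\,n!\,(\frac12)_j}{(n-j)!}\,\bigl(-2k-2n-\tfrac72\bigr)_j\,(k-j+1)_{n-j}\,\bigl(k+\tfrac32\bigr)_{n-j}\,(k+2)_{n-j}.$$ In particular (case $n=1$, $k=1$) $\langle|\rho|\,|\rho^{PT}|\rangle=0$. -/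

import Mathlib

open MeasureTheory ProbabilityTheory

noncomputable section

/-- The index set of the standard product basis of two rebits: `(a, b)` is the basis vector
`e_a ⊗ e_b`, so that `a` numbers the `2 × 2` blocks of a `4 × 4` matrix and `b` the position
inside a block. -/
abbrev RebitIndex : Type := Fin 2 × Fin 2

/-- Real `4 × 4` matrices, viewed as `2 × 2` block matrices with `2 × 2` blocks. -/
abbrev RebitMatrix : Type := Matrix RebitIndex RebitIndex ℝ

/-- Matrices carry the Borel structure of their sixteen real entries. -/
instance rebitMatrixMeasurableSpace : MeasurableSpace RebitMatrix :=
  inferInstanceAs (MeasurableSpace (RebitIndex → RebitIndex → ℝ))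

instance rebitMatrixBorelSpace : BorelSpace RebitMatrix :=
  inferInstanceAs (BorelSpace (RebitIndex → RebitIndex → ℝ))

/-- A two-rebit density matrix: symmetric, with nonnegative eigenvalues, and of unit trace. -/
def IsTwoRebitDensity (ρ : RebitMatrix) : Prop :=
  ρ.PosSemidef ∧ ρ.trace = 1

/-- The partial transpose: each of the four `2 × 2` blocks is transposed in place. -/
def partialTranspose (ρ : RebitMatrix) : RebitMatrix :=
  Matrix.of fun i j => ρ (i.1, j.2) (j.1, i.2)

/-- The nine-dimensional space of symmetric traceless real `4 × 4` matrices, with the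
Hilbert–Schmidt inner product `⟨x, y⟩ = ∑ x_ij y_ij = Tr (xᵀ y)`. It is the direction of the
affine space of symmetric matrices of unit trace. -/
def tracelessSymmetric : Submodule ℝ (EuclideanSpace ℝ (RebitIndex × RebitIndex)) where
  carrier := {x | (∀ i j, x (i, j) = x (j, i)) ∧ ∑ i, x (i, i) = 0}
  add_mem' := by
    rintro x y ⟨hx, hx'⟩ ⟨hy, hy'⟩
    refine ⟨fun i j => ?_, ?_⟩
    · simp only [PiLp.add_apply, hx i j, hy i j]
    · simp only [PiLp.add_apply, Finset.sum_add_distrib, hx', hy', add_zero]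
  zero_mem' := by
    refine ⟨fun i j => ?_, ?_⟩ <;> simp
  smul_mem' := by
    rintro c x ⟨hx, hx'⟩
    refine ⟨fun i j => ?_, ?_⟩
    · simp only [PiLp.smul_apply, hx i j]
    · simp only [PiLp.smul_apply, ← Finset.smul_sum, hx', smul_zero]

/-- The symmetric matrix of unit trace `I / 4 + x` with the direction `x`. -/
def unitTraceMatrix (x : tracelessSymmetric) : RebitMatrix :=
  Matrix.of fun i j => (if i = j then 1 / 4 else 0) + (x : EuclideanSpace ℝ _) (i, j)

/-- The nine-dimensional Hilbert–Schmidt (Euclidean, flat) volume on the affine space of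
symmetric `4 × 4` matrices of unit trace, as a measure on matrices: a cube whose edges are the
vectors of a Hilbert–Schmidt orthonormal basis has volume one. (A constant factor in the metric,
such as the `1/2` in `ds² = (1/2) Tr (dρ)²`, only rescales the volume and disappears in the
probability distribution below.) -/
def hilbertSchmidtVolume : Measure RebitMatrix :=
  Measure.map unitTraceMatrix (stdOrthonormalBasis ℝ tracelessSymmetric).toBasis.addHaar

/-- The probability distribution of a generic two-rebit density matrix: the Hilbert–Schmidt
volume restricted to the density matrices and normalized. -/
def twoRebitHS : Measure RebitMatrix :=
  ProbabilityTheory.cond hilbertSchmidtVolume {ρ | IsTwoRebitDensity ρ}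

/-- The expectation `⟨|ρ|^k |ρ^PT|^n⟩` over generic two-rebit density matrices. -/
def rebitMoment (k n : ℕ) : ℝ :=
  ∫ ρ : RebitMatrix, ρ.det ^ k * (partialTranspose ρ).det ^ n ∂twoRebitHS

/-- The Pochhammer symbol `(x)_m = x (x + 1) ⋯ (x + m - 1)`. -/
def pochhammer (x : ℝ) (m : ℕ) : ℝ :=
  (ascPochhammer ℝ m).eval x

/-- The denominators `B_n(k) = 128^n (k + 3)_n (2k + 11/2)_{2n}`. -/
def rebitDenominator (n : ℕ) (k : ℝ) : ℝ :=
  128 ^ n * pochhammer (k + 3) n * pochhammer (2 * k + 11 / 2) (2 * n)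

/-- The coefficient array for `n = 1, …, 6`, one column of `3 n + 1` entries for each `n`, in
ascending order of the powers of `k`. -/
def rebitCoefficients : ℕ → List ℤ
  | 1 =>
    [-16, 5, 9, 2]
  | 2 =>
    [4860, 2940, 709, 368, 203, 48, 4]
  | 3 =>
    [-3612816, -2516616, -401334, 136801, 84291, 29493, 8559, 1674, 180, 8]
  | 4 =>
    [6610161600, 5496485760, 1636873812, 166748972, 6212189, 13904508, 7805462, 2389416,
     525681, 84496, 9112, 576, 16]
  | 5 =>
    [-23680812672000, -21644930613600, -7755993054000, -1199508017652, -4378482660,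
     29246867605, 7876634465, 2649513956, 883461210, 219916945, 40679505, 5660714, 575800,
     40000, 1680, 32]
  | 6 =>
    [147885533254368000, 144374531813568000, 58524043784903280, 11977854861441312,
     1052189083196640, -30302414250528, -6899036908859, 3583820785224, 1632448582425,
     477741210624, 118164517947, 23817008856, 3786901675, 469728096, 44685468, 3143808, 153360,
     4608, 64]
  | _ => []

/-- The numerator polynomial whose coefficients are the column `n` of the array. -/
def rebitArrayNumerator (n : ℕ) (k : ℝ) : ℝ :=
  ∑ i ∈ Finset.range (3 * n + 1), ((rebitCoefficients n).getD i 0 : ℝ) * k ^ i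

/-- The numerators `A_n(k)` as terminating sums,
`A_n(k) = 2^n ∑_{j ≤ n} 4^j (n! / (n - j)!) (1/2)_j (-2k - 2n - 7/2)_j
(k - j + 1)_{n-j} (k + 3/2)_{n-j} (k + 2)_{n-j}`. -/
def rebitNumerator (n : ℕ) (k : ℝ) : ℝ :=
  2 ^ n * ∑ j ∈ Finset.range (n + 1),
    4 ^ j * ((n.factorial : ℝ) / ((n - j).factorial : ℝ)) * pochhammer (1 / 2) j
      * pochhammer (-2 * k - 2 * n - 7 / 2) j * pochhammer (k - j + 1) (n - j)
      * pochhammer (k + 3 / 2) (n - j) * pochhammer (k + 2) (n - j)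

end

/-! Both determinants are homogeneous of degree 4. Weighting by exp(-tr ρ) therefore trades the
unit-trace section for the whole cone of positive definite matrices: the radial integral contributes
only (4k+4n+9)! and a constant independent of k and n (`integrable_and_integral_cone`,
`integrable_and_integral_coneWeight`). The cone integral has a closed form.

Write ρ = [[V, B], [Bᵀ, W]]. Partial transposition keeps V and W and replaces B by Bᵀ. Diagonalize
simultaneously, V = CCᵀ and W = CECᵀ with E = D² = diag(a, b), and substitute B = CΘDCᵀ. Then ρ is
positive definite exactly when Θ is a strict contraction, |ρ| = |C|⁴ |E| det(1 - ΘᵀΘ), and |ρ^PT| =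
|C|⁴ det(E - ΘEΘᵀ). The last determinant equals ab det(1 - ΘᵀΘ) + (b - a)(a Θ₂₁² - b Θ₁₂²), so a
binomial expansion leaves only even moments of Θ₂₁ and Θ₁₂ against powers of det(1 - ΘᵀΘ), which are
products of beta values (`lintegral_contractionMoment`). The Pfaff–Saalschütz and Chu–Vandermonde
summations collapse the resulting double sum into a polynomial in ab and (a - b)²
(`setIntegral_defectDet_mul_twistedDet_eq`). These are, up to powers of |C|, invariants of the pair
(V, W): |V|, |W| and the discriminant of the pencil W - tV (`integral_offDiagonal`).

What remains is the integral of |V|^s |W|^s disc(V, W)^j exp(-tr V - tr W)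
(`lintegral_lintegral_symRpow_mul_symDisc`). Put W = √V U √V, integrate V out by Siegel's Gamma
integral, and use rotation invariance in U to replace disc^j by a power of one matrix entry; three
beta integrals finish. Each j yields one term of A_n(k). Dividing by the case n = 0 removes the
unknown constant, and the quotient of factorials produces B_n(k) (`two_pow_mul_factorial_eq`).

The closed forms are computed with nonnegative functions extended by zero, so that Tonelli applies
freely and the regions of integration are carried by the integrands. -/

/-! ### One-dimensional integrals -/

/-- The power `t ^ a` on the open half-line, extended by zero. -/
noncomputable def posRpow (a t : ℝ) : ENNReal :=
  if 0 < t then ENNReal.ofReal (t ^ a) else 0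

@[fun_prop]
lemma measurable_posRpow (a : ℝ) : Measurable (posRpow a) :=
  Measurable.ite measurableSet_Ioi (by fun_prop) measurable_const

lemma posRpow_of_pos (a : ℝ) {t : ℝ} (ht : 0 < t) : posRpow a t = ENNReal.ofReal (t ^ a) :=
  if_pos ht

lemma posRpow_of_nonpos (a : ℝ) {t : ℝ} (ht : t ≤ 0) : posRpow a t = 0 :=
  if_neg ht.not_gt

lemma posRpow_mul_posRpow (a b t : ℝ) : posRpow a t * posRpow b t = posRpow (a + b) t := by
  rcases lt_or_ge 0 t with ht | ht
  · rw [posRpow_of_pos _ ht, posRpow_of_pos _ ht, posRpow_of_pos _ ht,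
      ← ENNReal.ofReal_mul (by positivity), Real.rpow_add ht]
  · simp [posRpow_of_nonpos _ ht]

lemma posRpow_mul_pow (a : ℝ) (n : ℕ) (t : ℝ) :
    posRpow a t * ENNReal.ofReal (t ^ n) = posRpow (a + n) t := by
  rcases lt_or_ge 0 t with ht | ht
  · rw [posRpow_of_pos _ ht, posRpow_of_pos _ ht,
      ← ENNReal.ofReal_mul (by positivity), Real.rpow_add ht, Real.rpow_natCast]
  · simp [posRpow_of_nonpos _ ht]

lemma posRpow_mul_left (a : ℝ) {c : ℝ} (hc : 0 < c) (t : ℝ) :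
    posRpow a (c * t) = ENNReal.ofReal (c ^ a) * posRpow a t := by
  rcases lt_or_ge 0 t with ht | ht
  · rw [posRpow_of_pos _ ht, posRpow_of_pos _ (by positivity),
      ← ENNReal.ofReal_mul (by positivity), Real.mul_rpow hc.le ht.le]
  · rw [posRpow_of_nonpos _ ht, posRpow_of_nonpos _ (by nlinarith), mul_zero]

lemma lintegral_comp_mul_left_eq {c : ℝ} (hc : 0 < c) {f : ℝ → ENNReal} (hf : Measurable f) :
    ∫⁻ t, f t = ENNReal.ofReal c * ∫⁻ t, f (c * t) := by
  have h := Real.smul_map_volume_mul_left hc.ne'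
  conv_lhs => rw [← h]
  rw [lintegral_smul_measure, lintegral_map hf (by fun_prop), abs_of_pos hc, smul_eq_mul]

lemma lintegral_posRpow_mul_exp {a r : ℝ} (ha : 0 < a) (hr : 0 < r) :
    ∫⁻ x, posRpow (a - 1) x * ENNReal.ofReal (Real.exp (-(r * x))) =
      ENNReal.ofReal (Real.Gamma a * r ^ (-a)) := by
  have hG := Real.Gamma_pos_of_pos ha
  have h := lintegral_gammaPDF_eq_one ha hr
  have h2 : ∀ᵐ x : ℝ, posRpow (a - 1) x * ENNReal.ofReal (Real.exp (-(r * x))) =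
      ENNReal.ofReal (Real.Gamma a * r ^ (-a)) * gammaPDF a r x := by
    have h0 : ∀ᵐ x : ℝ, x ≠ 0 := by simp [ae_iff]
    filter_upwards [h0] with x hx
    rcases lt_or_gt_of_ne hx with hx | hx
    · rw [posRpow_of_nonpos _ hx.le, gammaPDF_of_neg hx]; simp
    · rw [posRpow_of_pos _ hx, gammaPDF_of_nonneg hx.le, ← ENNReal.ofReal_mul (by positivity),
        ← ENNReal.ofReal_mul (by positivity), Real.rpow_neg hr.le]
      congr 1
      have := (Real.rpow_pos_of_pos hr a).ne'
      field_simp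
  rw [lintegral_congr_ae h2, lintegral_const_mul' _ _ ENNReal.ofReal_ne_top, h, mul_one]

lemma lintegral_posRpow_mul_posRpow_one_sub {a b : ℝ} (ha : 0 < a) (hb : 0 < b) :
    ∫⁻ x, posRpow (a - 1) x * posRpow (b - 1) (1 - x) = ENNReal.ofReal (beta a b) := by
  have hB := beta_pos ha hb
  have h2 : ∀ x : ℝ, posRpow (a - 1) x * posRpow (b - 1) (1 - x) =
      ENNReal.ofReal (beta a b) * betaPDF a b x := by
    intro x
    rcases le_or_gt x 0 with hx | hx
    · rw [posRpow_of_nonpos _ hx, betaPDF_eq_zero_of_nonpos hx]; simp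
    rcases le_or_gt 1 x with hx1 | hx1
    · rw [posRpow_of_nonpos _ (sub_nonpos.2 hx1), betaPDF_eq_zero_of_one_le hx1]; simp
    · rw [posRpow_of_pos _ hx, posRpow_of_pos _ (sub_pos.2 hx1), betaPDF_of_pos_lt_one hx hx1,
        ← ENNReal.ofReal_mul (by positivity), ← ENNReal.ofReal_mul hB.le]
      congr 1
      field_simp
  simp_rw [h2]
  rw [lintegral_const_mul' _ _ ENNReal.ofReal_ne_top, lintegral_betaPDF_eq_one ha hb, mul_one]

/-- Γ(a+b) (1+x)^(-(a+b)) is itself a Gamma integral in a variable t. After exchanging the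
integrals, the x-integral gives Γ(a) t^(-a) and the t-integral gives Γ(b). -/
lemma lintegral_posRpow_mul_one_add_rpow {a b : ℝ} (ha : 0 < a) (hb : 0 < b) :
    ∫⁻ x, posRpow (a - 1) x * posRpow (-(a + b)) (1 + x) = ENNReal.ofReal (beta a b) := by
  have hab : 0 < a + b := by linarith
  have hGab := Real.Gamma_pos_of_pos hab
  have h1 : ∀ x : ℝ, ENNReal.ofReal (Real.Gamma (a + b)) *
      (posRpow (a - 1) x * posRpow (-(a + b)) (1 + x)) =
      ∫⁻ t, posRpow (a - 1) x * (posRpow (a + b - 1) t *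
        ENNReal.ofReal (Real.exp (-((1 + x) * t)))) := by
    intro x
    rcases le_or_gt x 0 with hx | hx
    · simp [posRpow_of_nonpos _ hx]
    · rw [lintegral_const_mul _ (by fun_prop), lintegral_posRpow_mul_exp hab (by linarith),
        posRpow_of_pos _ (by linarith : 0 < 1 + x), ENNReal.ofReal_mul hGab.le]
      ring
  have h2 : ∀ t : ℝ, ∫⁻ x, posRpow (a - 1) x * (posRpow (a + b - 1) t *
        ENNReal.ofReal (Real.exp (-((1 + x) * t)))) =
      ENNReal.ofReal (Real.Gamma a) *
        (posRpow (b - 1) t * ENNReal.ofReal (Real.exp (-(1 * t)))) := by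
    intro t
    rcases le_or_gt t 0 with ht | ht
    · simp [posRpow_of_nonpos _ ht]
    · have : ∀ x : ℝ, posRpow (a - 1) x * (posRpow (a + b - 1) t *
          ENNReal.ofReal (Real.exp (-((1 + x) * t)))) =
          (posRpow (a + b - 1) t * ENNReal.ofReal (Real.exp (-(1 * t)))) *
          (posRpow (a - 1) x * ENNReal.ofReal (Real.exp (-(t * x)))) := by
        intro x
        have : -((1 + x) * t) = -(1 * t) + -(t * x) := by ring
        rw [this, Real.exp_add, ENNReal.ofReal_mul (Real.exp_pos _).le]
        ring
      simp_rw [this]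
      rw [lintegral_const_mul _ (by fun_prop), lintegral_posRpow_mul_exp ha ht,
        ENNReal.ofReal_mul (Real.Gamma_pos_of_pos ha).le, ← posRpow_of_pos _ ht,
        show b - 1 = (a + b - 1) + -a by ring, ← posRpow_mul_posRpow]
      ring
  have h3 : ENNReal.ofReal (Real.Gamma (a + b)) *
      ∫⁻ x, posRpow (a - 1) x * posRpow (-(a + b)) (1 + x) =
      ENNReal.ofReal (Real.Gamma (a + b)) * ENNReal.ofReal (beta a b) := by
    rw [← lintegral_const_mul _ (by fun_prop)]
    simp_rw [h1]
    rw [lintegral_lintegral_swap (by fun_prop)]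
    simp_rw [h2]
    rw [lintegral_const_mul _ (by fun_prop), lintegral_posRpow_mul_exp hb one_pos,
      ← ENNReal.ofReal_mul (Real.Gamma_pos_of_pos ha).le, ← ENNReal.ofReal_mul hGab.le]
    congr 1
    rw [beta, Real.one_rpow]
    field_simp
  exact (ENNReal.mul_right_inj (ENNReal.ofReal_pos.2 hGab).ne' ENNReal.ofReal_ne_top).1 h3

/-- Substituting u = t² on the positive half-line gives a factor 1/2, which the equal contribution
of the negative half-line cancels. -/
lemma lintegral_comp_sq {f : ℝ → ENNReal} (hf : Measurable f) :
    ∫⁻ t : ℝ, f (t ^ 2) = ∫⁻ u, posRpow (-(1 / 2)) u * f u := by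
  have himg : (fun t : ℝ => t ^ 2) '' Set.Ioi 0 = Set.Ioi 0 := by
    ext u
    constructor
    · rintro ⟨t, ht, rfl⟩
      exact pow_pos (Set.mem_Ioi.1 ht) 2
    · intro hu
      exact ⟨√u, Real.sqrt_pos.2 hu, Real.sq_sqrt (le_of_lt hu)⟩
  have h1 : ∫⁻ u, posRpow (-(1 / 2)) u * f u =
      ∫⁻ u in Set.Ioi 0, posRpow (-(1 / 2)) u * f u := by
    rw [← lintegral_indicator measurableSet_Ioi]
    refine lintegral_congr fun u => ?_
    by_cases hu : 0 < u
    · rw [Set.indicator_of_mem (Set.mem_Ioi.2 hu)]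
    · rw [Set.indicator_of_notMem (by simpa using hu), posRpow_of_nonpos _ (not_lt.1 hu), zero_mul]
  have h2 : ∫⁻ u in Set.Ioi (0 : ℝ), posRpow (-(1 / 2)) u * f u =
      ∫⁻ t in Set.Ioi (0 : ℝ), 2 * f (t ^ 2) := by
    conv_lhs => rw [← himg]
    rw [lintegral_image_eq_lintegral_abs_deriv_mul (f' := fun t => 2 * t) measurableSet_Ioi
      (fun x _ => by simpa using (hasDerivAt_pow 2 x).hasDerivWithinAt)
      (fun x hx y hy h => by
        exact (pow_left_inj₀ (le_of_lt hx) (le_of_lt hy) two_ne_zero).1 h)]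
    refine setLIntegral_congr_fun measurableSet_Ioi fun t ht => ?_
    have ht : 0 < t := ht
    have e : 2 * t * (t ^ 2) ^ (-(1 / 2) : ℝ) = 2 := by
      rw [← Real.rpow_natCast, ← Real.rpow_mul ht.le]
      norm_num
      rw [Real.rpow_neg_one]
      field_simp
    rw [posRpow_of_pos _ (by positivity), abs_of_pos (by positivity), ← mul_assoc,
      ← ENNReal.ofReal_mul (by positivity), e]
    simp
  have h3 : ∫⁻ t in Set.Iio (0 : ℝ), f (t ^ 2) = ∫⁻ t in Set.Ioi (0 : ℝ), f (t ^ 2) := by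
    rw [← lintegral_indicator measurableSet_Iio, ← lintegral_indicator measurableSet_Ioi,
      ← lintegral_neg_eq_self]
    refine lintegral_congr fun t => ?_
    by_cases h : 0 < t
    · rw [Set.indicator_of_mem (by simpa using h), Set.indicator_of_mem (by simpa using h),
        neg_sq]
    · rw [Set.indicator_of_notMem (by simpa using h), Set.indicator_of_notMem (by simpa using h)]
  rw [h1, h2, lintegral_const_mul _ (by fun_prop), two_mul]
  nth_rewrite 1 [← h3]
  rw [← lintegral_add_compl _ (measurableSet_Iio (a := (0 : ℝ))), Set.compl_Iio,
    setLIntegral_congr (Ioi_ae_eq_Ici (a := (0 : ℝ))).symm]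

/-- Scaling u = t² by a/b reduces this to a beta integral; for a ≤ 0 both sides vanish by the
extension by zero. All four coordinates of the contraction moments are integrated out by this
formula. -/
lemma lintegral_posRpow_sub_mul_sq {b α : ℝ} (hb : 0 < b) (hα : -1 < α) (a : ℝ) (s : ℕ) :
    ∫⁻ t, posRpow α (a - b * t ^ 2) * ENNReal.ofReal (t ^ (2 * s)) =
      posRpow (α + s + 1 / 2) a *
        (posRpow (-(s + 1 / 2)) b * ENNReal.ofReal (beta (s + 1 / 2) (α + 1))) := by
  rcases le_or_gt a 0 with ha | ha
  · rw [posRpow_of_nonpos _ ha, zero_mul]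
    refine (lintegral_congr fun t => ?_).trans lintegral_zero
    rw [posRpow_of_nonpos _ (by nlinarith [sq_nonneg t]), zero_mul]
  have hab : 0 < a / b := by positivity
  simp_rw [pow_mul]
  rw [lintegral_comp_sq (f := fun u => posRpow α (a - b * u) * ENNReal.ofReal (u ^ s))
    (by fun_prop), lintegral_comp_mul_left_eq hab (by fun_prop)]
  have h : ∀ u, posRpow (-(1 / 2)) (a / b * u) * (posRpow α (a - b * (a / b * u)) *
      ENNReal.ofReal ((a / b * u) ^ s)) =
      (ENNReal.ofReal ((a / b) ^ (-(1 / 2) + s : ℝ)) * ENNReal.ofReal (a ^ α)) *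
      (posRpow ((s + 1 / 2 : ℝ) - 1) u * posRpow ((α + 1) - 1) (1 - u)) := by
    intro u
    have e1 : a - b * (a / b * u) = a * (1 - u) := by field_simp
    have e2 : (s + 1 / 2 : ℝ) - 1 = -(1 / 2) + s := by ring
    rw [e1, e2, posRpow_mul_left _ ha, mul_left_comm, posRpow_mul_pow, posRpow_mul_left _ hab,
      add_sub_cancel_right]
    ring
  simp_rw [h]
  rw [lintegral_const_mul _ (by fun_prop),
    lintegral_posRpow_mul_posRpow_one_sub (by positivity) (by linarith),
    posRpow_of_pos _ ha, posRpow_of_pos _ hb, ← ENNReal.ofReal_mul (by positivity),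
    ← ENNReal.ofReal_mul (by positivity), ← ENNReal.ofReal_mul (by positivity),
    ← ENNReal.ofReal_mul (by positivity), ← ENNReal.ofReal_mul (by positivity)]
  congr 1
  have e3 : a / b * (a / b) ^ (-(1 / 2) + s : ℝ) = (a / b) ^ (s + 1 / 2 : ℝ) := by
    nth_rewrite 1 [← Real.rpow_one (a / b)]
    rw [← Real.rpow_add hab]
    congr 1
    ring
  rw [← mul_assoc, ← mul_assoc, e3, Real.div_rpow ha.le hb.le, Real.rpow_neg hb.le,
    show α + s + 1 / 2 = (s + 1 / 2 : ℝ) + α by ring, Real.rpow_add ha (s + 1 / 2) α]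
  ring

lemma lintegral_exp_neg_mul_sq {b : ℝ} (hb : 0 < b) :
    ∫⁻ t : ℝ, ENNReal.ofReal (Real.exp (-(b * t ^ 2))) =
      ENNReal.ofReal (√Real.pi) * posRpow (-(1 / 2)) b := by
  rw [lintegral_comp_sq (f := fun u => ENNReal.ofReal (Real.exp (-(b * u)))) (by fun_prop),
    show (-(1 / 2) : ℝ) = 1 / 2 - 1 by norm_num, lintegral_posRpow_mul_exp (by norm_num) hb,
    posRpow_of_pos _ hb, ENNReal.ofReal_mul (by positivity), Real.Gamma_one_half_eq]
  norm_num

lemma lintegral_pow_mul_one_add_sq_rpow (j : ℕ) {c : ℝ} (hc : 0 < c) :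
    ∫⁻ t : ℝ, ENNReal.ofReal (t ^ (2 * j)) * posRpow (-(j + 1 / 2 + c)) (1 + t ^ 2) =
      ENNReal.ofReal (beta (j + 1 / 2) c) := by
  simp_rw [pow_mul]
  rw [lintegral_comp_sq
    (f := fun u => ENNReal.ofReal (u ^ j) * posRpow (-(j + 1 / 2 + c)) (1 + u)) (by fun_prop),
    ← lintegral_posRpow_mul_one_add_rpow (by positivity) hc]
  refine lintegral_congr fun u => ?_
  rw [← mul_assoc, posRpow_mul_pow]
  congr 2
  ring

/-! ### Iterated integrals and linear substitutions in coordinates -/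

lemma lintegral_fin_succ {n : ℕ} {f : (Fin (n + 1) → ℝ) → ENNReal} (hf : Measurable f) :
    ∫⁻ v, f v = ∫⁻ x : ℝ, ∫⁻ w : Fin n → ℝ, f (Matrix.vecCons x w) := by
  have h := (volume_preserving_piFinSuccAbove (fun _ : Fin (n + 1) => ℝ) 0).symm
  rw [← h.lintegral_comp hf, Measure.volume_eq_prod, lintegral_prod]
  · refine lintegral_congr fun x => lintegral_congr fun w => ?_
    congr 1
    ext i
    refine Fin.cases ?_ (fun i => ?_) i <;> simp [MeasurableEquiv.piFinSuccAbove]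
  · exact (hf.comp (MeasurableEquiv.measurable _)).aemeasurable

lemma lintegral_fin_zero (f : (Fin 0 → ℝ) → ENNReal) : ∫⁻ v, f v = f ![] := by
  have h : ∀ v, f v = f ![] := fun v => congrArg f (Subsingleton.elim _ _)
  simp_rw [h]
  simp [volume_pi]

lemma measurable_vecCons {n : ℕ} (x : ℝ) :
    Measurable fun w : Fin n → ℝ => (Matrix.vecCons x w : Fin (n + 1) → ℝ) := by
  refine measurable_pi_lambda _ fun i => ?_
  refine Fin.cases ?_ (fun i => ?_) i
  · simp
  · simpa using measurable_pi_apply i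

lemma lintegral_fin_three {f : (Fin 3 → ℝ) → ENNReal} (hf : Measurable f) :
    ∫⁻ v, f v = ∫⁻ x : ℝ, ∫⁻ y : ℝ, ∫⁻ z : ℝ, f ![x, y, z] := by
  rw [lintegral_fin_succ hf]
  refine lintegral_congr fun x => ?_
  rw [lintegral_fin_succ (f := fun w => f (Matrix.vecCons x w)) (hf.comp (measurable_vecCons x))]
  refine lintegral_congr fun y => ?_
  rw [lintegral_fin_succ (f := fun w => f (Matrix.vecCons x (Matrix.vecCons y w)))
    (hf.comp ((measurable_vecCons x).comp (measurable_vecCons y)))]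
  simp only [lintegral_fin_zero]

lemma lintegral_fin_four {f : (Fin 4 → ℝ) → ENNReal} (hf : Measurable f) :
    ∫⁻ v, f v = ∫⁻ x : ℝ, ∫⁻ y : ℝ, ∫⁻ z : ℝ, ∫⁻ w : ℝ, f ![x, y, z, w] := by
  rw [lintegral_fin_succ hf]
  refine lintegral_congr fun x => ?_
  rw [lintegral_fin_three (f := fun w => f (Matrix.vecCons x w)) (hf.comp (measurable_vecCons x))]

lemma lintegral_comp_mulVec {ι : Type*} [Fintype ι] [DecidableEq ι] {M : Matrix ι ι ℝ}
    (hM : M.det ≠ 0) {f : (ι → ℝ) → ENNReal} (hf : Measurable f) :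
    ∫⁻ v, f v = ENNReal.ofReal |M.det| * ∫⁻ v, f (M.mulVec v) := by
  have h := Real.map_matrix_volume_pi_eq_smul_volume_pi hM
  have hm : Measurable (Matrix.toLin' M) := (LinearMap.continuous_on_pi _).measurable
  have h2 : ∫⁻ v, f (M.mulVec v) = ENNReal.ofReal |(M.det)⁻¹| * ∫⁻ v, f v := by
    rw [← smul_eq_mul, ← lintegral_smul_measure, ← h, lintegral_map hf hm]
    rfl
  rw [h2, ← mul_assoc, ← ENNReal.ofReal_mul (abs_nonneg _), ← abs_mul, mul_inv_cancel₀ hM]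
  simp

/-! ### Symmetric `2 × 2` matrices -/

/-- The determinant of the symmetric matrix `[[v 0, v 1], [v 1, v 2]]`. -/
def symDet (v : Fin 3 → ℝ) : ℝ := v 0 * v 2 - v 1 ^ 2

/-- Positive definiteness of the symmetric matrix `[[v 0, v 1], [v 1, v 2]]`. -/
def SymPos (v : Fin 3 → ℝ) : Prop := 0 < v 0 ∧ 0 < symDet v

@[fun_prop]
lemma measurable_symDet : Measurable symDet := by
  unfold symDet
  fun_prop

lemma SymPos.pos_two {v : Fin 3 → ℝ} (h : SymPos v) : 0 < v 2 := by
  obtain ⟨h0, h1⟩ := h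
  unfold symDet at h1
  by_contra hc
  nlinarith [sq_nonneg (v 1)]

/-- The density `|v| ^ a` on the cone of positive definite matrices. -/
noncomputable def symRpow (a : ℝ) (v : Fin 3 → ℝ) : ENNReal := posRpow 0 (v 0) * posRpow a (symDet v)

@[fun_prop]
lemma measurable_symRpow (a : ℝ) : Measurable (symRpow a) := by
  unfold symRpow
  fun_prop

/-- `posRpow 0` is the indicator of the open half-line; it carries sign conditions inside the
integrands. -/
lemma posRpow_zero_of_pos {t : ℝ} (ht : 0 < t) : posRpow 0 t = 1 := by
  simp [posRpow_of_pos _ ht]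

lemma symRpow_of_symPos (a : ℝ) {v : Fin 3 → ℝ} (hv : SymPos v) :
    symRpow a v = posRpow a (symDet v) := by
  rw [symRpow, posRpow_zero_of_pos hv.1, one_mul]

lemma symRpow_of_not_symPos (a : ℝ) {v : Fin 3 → ℝ} (hv : ¬ SymPos v) : symRpow a v = 0 := by
  rw [symRpow]
  by_cases h : 0 < v 0
  · rw [posRpow_of_nonpos a (not_lt.1 fun h2 => hv ⟨h, h2⟩), mul_zero]
  · rw [posRpow_of_nonpos 0 (not_lt.1 h), zero_mul]

/-- The trace of the product of two symmetric matrices. -/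
def symPair (v w : Fin 3 → ℝ) : ℝ := v 0 * w 0 + 2 * (v 1 * w 1) + v 2 * w 2

/-- Siegel's Gamma integral for 2 × 2 matrices. In the order of integration the lower diagonal entry
gives Γ(ν+1), the off-diagonal entry a Gaussian, and the upper diagonal entry Γ(ν+3/2), the extra
1/2 coming from the width of the Gaussian. -/
lemma lintegral_symRpow_mul_exp {ν : ℝ} (hν : -1 < ν) {c : Fin 3 → ℝ} (hc : SymPos c) :
    ∫⁻ v, symRpow ν v * ENNReal.ofReal (Real.exp (-symPair v c)) =
      ENNReal.ofReal (√Real.pi * Real.Gamma (ν + 1) * Real.Gamma (ν + 3 / 2)) *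
        posRpow (-(ν + 3 / 2)) (symDet c) := by
  have hc2 := hc.pos_two
  have hcd := hc.2
  have hG1 := Real.Gamma_pos_of_pos (by linarith : 0 < ν + 1)
  have hG2 := Real.Gamma_pos_of_pos (by linarith : 0 < ν + 3 / 2)
  rw [lintegral_fin_three (by unfold symPair; fun_prop)]
  have hy : ∀ x z : ℝ, ∫⁻ y, symRpow ν ![x, z, y] *
      ENNReal.ofReal (Real.exp (-symPair ![x, z, y] c)) =
      (ENNReal.ofReal (Real.Gamma (ν + 1) * c 2 ^ (-(ν + 1))) * posRpow ν x) *
        ENNReal.ofReal (Real.exp (-(x * c 0 + 2 * (z * c 1) + z ^ 2 / x * c 2))) := by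
    intro x z
    rcases le_or_gt x 0 with hx | hx
    · simp [symRpow, posRpow_of_nonpos _ hx]
    -- The shifted variable is the Schur complement, in which the determinant becomes x * y.
    rw [← lintegral_add_right_eq_self _ (z ^ 2 / x)]
    have : ∀ y, symRpow ν ![x, z, y + z ^ 2 / x] *
        ENNReal.ofReal (Real.exp (-symPair ![x, z, y + z ^ 2 / x] c)) =
        (ENNReal.ofReal (x ^ ν) *
          ENNReal.ofReal (Real.exp (-(x * c 0 + 2 * (z * c 1) + z ^ 2 / x * c 2)))) *
        (posRpow ((ν + 1) - 1) y * ENNReal.ofReal (Real.exp (-(c 2 * y)))) := by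
      intro y
      have e1 : symDet ![x, z, y + z ^ 2 / x] = x * y := by
        simp [symDet]
        field_simp
        ring
      have e2 : -symPair ![x, z, y + z ^ 2 / x] c =
          -(x * c 0 + 2 * (z * c 1) + z ^ 2 / x * c 2) + -(c 2 * y) := by
        simp [symPair]
        ring
      rw [symRpow, e1, e2, Real.exp_add, ENNReal.ofReal_mul (Real.exp_pos _).le,
        posRpow_mul_left _ hx, add_sub_cancel_right]
      simp only [Matrix.cons_val_zero, posRpow_zero_of_pos hx]
      ring
    simp_rw [this]
    rw [lintegral_const_mul _ (by fun_prop), lintegral_posRpow_mul_exp (by linarith) hc2,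
      posRpow_of_pos _ hx]
    ring
  have hz : ∀ x : ℝ, ∫⁻ z : ℝ, (ENNReal.ofReal (Real.Gamma (ν + 1) * c 2 ^ (-(ν + 1))) *
        posRpow ν x) *
        ENNReal.ofReal (Real.exp (-(x * c 0 + 2 * (z * c 1) + z ^ 2 / x * c 2))) =
      (ENNReal.ofReal (Real.Gamma (ν + 1) * c 2 ^ (-(ν + 1))) *
        (ENNReal.ofReal (√Real.pi) * ENNReal.ofReal (c 2 ^ (-(1 / 2) : ℝ)))) *
        (posRpow ((ν + 3 / 2) - 1) x *
          ENNReal.ofReal (Real.exp (-(symDet c / c 2 * x)))) := by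
    intro x
    rcases le_or_gt x 0 with hx | hx
    · simp [posRpow_of_nonpos _ hx]
    -- Completing the square in z; the remaining rate in x is the Schur complement `symDet c / c 2`.
    rw [← lintegral_sub_right_eq_self _ (x * c 1 / c 2)]
    have : ∀ z : ℝ, (ENNReal.ofReal (Real.Gamma (ν + 1) * c 2 ^ (-(ν + 1))) * posRpow ν x) *
        ENNReal.ofReal (Real.exp (-(x * c 0 + 2 * ((z - x * c 1 / c 2) * c 1) +
          (z - x * c 1 / c 2) ^ 2 / x * c 2))) =
        (ENNReal.ofReal (Real.Gamma (ν + 1) * c 2 ^ (-(ν + 1))) * posRpow ν x *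
          ENNReal.ofReal (Real.exp (-(symDet c / c 2 * x)))) *
        ENNReal.ofReal (Real.exp (-(c 2 / x * z ^ 2))) := by
      intro z
      have e : -(x * c 0 + 2 * ((z - x * c 1 / c 2) * c 1) +
          (z - x * c 1 / c 2) ^ 2 / x * c 2) = -(symDet c / c 2 * x) + -(c 2 / x * z ^ 2) := by
        rw [symDet]
        field_simp
        ring
      rw [e, Real.exp_add, ENNReal.ofReal_mul (Real.exp_pos _).le]
      ring
    simp_rw [this]
    rw [lintegral_const_mul _ (by fun_prop), lintegral_exp_neg_mul_sq (by positivity)]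
    have e : posRpow (-(1 / 2)) (c 2 / x) =
        ENNReal.ofReal (c 2 ^ (-(1 / 2) : ℝ)) * posRpow (1 / 2) x := by
      rw [posRpow_of_pos _ (by positivity), posRpow_of_pos _ hx,
        ← ENNReal.ofReal_mul (by positivity), Real.div_rpow hc2.le hx.le, Real.rpow_neg hx.le]
      simp
    rw [e, show ν + 3 / 2 - 1 = ν + 1 / 2 by ring, ← posRpow_mul_posRpow]
    ring
  simp_rw [hy, hz]
  rw [lintegral_const_mul _ (by fun_prop),
    lintegral_posRpow_mul_exp (by linarith) (div_pos hcd hc2), posRpow_of_pos _ hcd,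
    ← ENNReal.ofReal_mul (by positivity), ← ENNReal.ofReal_mul (by positivity),
    ← ENNReal.ofReal_mul (by positivity), ← ENNReal.ofReal_mul (by positivity)]
  congr 1
  have e : c 2 ^ (-(ν + 1)) * c 2 ^ (-(1 / 2) : ℝ) * c 2 ^ (ν + 3 / 2) = 1 := by
    rw [← Real.rpow_add hc2, ← Real.rpow_add hc2, show -(ν + 1) + -(1 / 2) + (ν + 3 / 2) = 0 by ring,
      Real.rpow_zero]
  have e2 : (symDet c / c 2) ^ (-(ν + 3 / 2)) = symDet c ^ (-(ν + 3 / 2)) * c 2 ^ (ν + 3 / 2) := by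
    rw [Real.div_rpow hcd.le hc2.le, Real.rpow_neg hc2.le, div_inv_eq_mul]
  rw [e2]
  linear_combination (√Real.pi * Real.Gamma (ν + 1) * Real.Gamma (ν + 3 / 2) *
    symDet c ^ (-(ν + 3 / 2))) * e

/-! ### Moments of the discriminant of a pencil of symmetric matrices -/

/-- The discriminant of `t ↦ det (w - t v)`. -/
def symDisc (v w : Fin 3 → ℝ) : ℝ :=
  (v 2 * w 0 - 2 * (v 1 * w 1) + v 0 * w 2) ^ 2 - 4 * symDet v * symDet w

lemma lintegral_sin_pow (j : ℕ) :
    ∫⁻ θ in Set.Ioo (-Real.pi) Real.pi, ENNReal.ofReal (Real.sin θ ^ (2 * j)) =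
      ENNReal.ofReal (2 * Real.pi) *
        ENNReal.ofReal ((∏ i ∈ Finset.range j, (2 * (i : ℝ) + 1) / (2 * i + 2))) := by
  have hpi := Real.pi_pos
  have hint : ∀ a b : ℝ, IntervalIntegrable (fun θ => Real.sin θ ^ (2 * j)) volume a b :=
    fun a b => (by fun_prop : Continuous fun θ => Real.sin θ ^ (2 * j)).intervalIntegrable a b
  have h0 : ∫ θ in (-Real.pi)..0, Real.sin θ ^ (2 * j) = ∫ θ in 0..Real.pi, Real.sin θ ^ (2 * j) := by
    have := intervalIntegral.integral_comp_neg (a := 0) (b := Real.pi)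
      (fun θ => Real.sin θ ^ (2 * j))
    rw [neg_zero] at this
    rw [← this]
    refine intervalIntegral.integral_congr fun θ _ => ?_
    simp [Real.sin_neg, pow_mul]
  have h1 : ∫ θ in (-Real.pi)..Real.pi, Real.sin θ ^ (2 * j) =
      2 * Real.pi * ∏ i ∈ Finset.range j, (2 * (i : ℝ) + 1) / (2 * i + 2) := by
    rw [← intervalIntegral.integral_add_adjacent_intervals (hint _ 0) (hint _ _), h0,
      integral_sin_pow_even]
    ring
  rw [← ENNReal.ofReal_mul (by positivity), ← h1, intervalIntegral.integral_of_le (by linarith),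
    integral_Ioc_eq_integral_Ioo, ofReal_integral_eq_lintegral_ofReal]
  · exact ((hint _ _).1).mono_set Set.Ioo_subset_Ioc_self
  · exact Filter.Eventually.of_forall fun θ => by
      simp only [pow_mul, Pi.zero_apply]
      positivity

/-- In polar coordinates the two sides differ only in the angular factor: sin^(2j) on the left, 1 on
the right. Their ratio is Wallis's product. -/
lemma lintegral_radial_mul_pow {F : ℝ → ENNReal} (hF : Measurable F) (j : ℕ) :
    ∫⁻ x : ℝ, ∫⁻ y : ℝ, F (x ^ 2 + y ^ 2) * ENNReal.ofReal (y ^ (2 * j)) =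
      ENNReal.ofReal ((∏ i ∈ Finset.range j, (2 * (i : ℝ) + 1) / (2 * i + 2))) *
      ∫⁻ x : ℝ, ∫⁻ y : ℝ, F (x ^ 2 + y ^ 2) * ENNReal.ofReal ((x ^ 2 + y ^ 2) ^ j) := by
  have hpolar : ∀ f : ℝ × ℝ → ENNReal, Measurable f → ∀ (g h : ℝ → ENNReal),
      Measurable g → Measurable h →
      (∀ r > 0, ∀ θ, f (r * Real.cos θ, r * Real.sin θ) = g r * h θ) →
      ∫⁻ x : ℝ, ∫⁻ y : ℝ, f (x, y) = (∫⁻ r in Set.Ioi (0 : ℝ), ENNReal.ofReal r * g r) *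
        ∫⁻ θ in Set.Ioo (-Real.pi) Real.pi, h θ := by
    intro f hf g h hg hh hfg
    rw [← lintegral_prod (f := f) hf.aemeasurable, ← Measure.volume_eq_prod,
      ← lintegral_comp_polarCoord_symm, ← lintegral_prod_mul (by fun_prop) (by fun_prop),
      Measure.prod_restrict, ← Measure.volume_eq_prod]
    refine setLIntegral_congr_fun polarCoord.open_target.measurableSet fun p hp => ?_
    have hp1 : 0 < p.1 := hp.1
    simp only [polarCoord_symm_apply, smul_eq_mul]
    rw [hfg _ hp1, mul_assoc]
  have hr : ∀ r θ : ℝ, (r * Real.cos θ) ^ 2 + (r * Real.sin θ) ^ 2 = r ^ 2 := fun r θ => by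
    linear_combination r ^ 2 * Real.sin_sq_add_cos_sq θ
  have h1 := hpolar (fun p => F (p.1 ^ 2 + p.2 ^ 2) * ENNReal.ofReal (p.2 ^ (2 * j))) (by fun_prop)
    (fun r => F (r ^ 2) * ENNReal.ofReal ((r ^ 2) ^ j))
    (fun θ => ENNReal.ofReal (Real.sin θ ^ (2 * j))) (by fun_prop) (by fun_prop) (by
      intro r hr0 θ
      simp only [hr]
      rw [mul_assoc, ← ENNReal.ofReal_mul (by positivity), mul_pow, pow_mul r])
  have h2 := hpolar (fun p => F (p.1 ^ 2 + p.2 ^ 2) * ENNReal.ofReal ((p.1 ^ 2 + p.2 ^ 2) ^ j))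
    (by fun_prop)
    (fun r => F (r ^ 2) * ENNReal.ofReal ((r ^ 2) ^ j))
    (fun _ => 1) (by fun_prop) (by fun_prop) (by
      intro r hr0 θ
      simp only [hr, mul_one])
  simp only at h1 h2
  rw [h1, h2, lintegral_sin_pow, setLIntegral_one, Real.volume_Ioo, sub_neg_eq_add, ← two_mul]
  ring

/-- Conjugation by rotations fixes the trace v₀ + v₂ and rotates the plane (v₀ - v₂, 2v₁). A power
of the discriminant of the characteristic polynomial may thus be exchanged for a power of the
off-diagonal entry, which can be integrated coordinate by coordinate. -/
lemma lintegral_sym_radial {F : ℝ → ℝ → ENNReal} (hF : Measurable (Function.uncurry F)) (j : ℕ) :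
    ∫⁻ v : Fin 3 → ℝ, F (v 0 + v 2) ((v 0 - v 2) ^ 2 + (2 * v 1) ^ 2) *
        ENNReal.ofReal ((2 * v 1) ^ (2 * j)) =
      ENNReal.ofReal ((∏ i ∈ Finset.range j, (2 * (i : ℝ) + 1) / (2 * i + 2))) *
      ∫⁻ v : Fin 3 → ℝ, F (v 0 + v 2) ((v 0 - v 2) ^ 2 + (2 * v 1) ^ 2) *
        ENNReal.ofReal (((v 0 - v 2) ^ 2 + (2 * v 1) ^ 2) ^ j) := by
  have hF2 : ∀ p, Measurable (F p) := fun p => hF.comp measurable_prodMk_left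
  have key : ∀ H : ℝ → ℝ → ℝ → ENNReal, Measurable (fun q : ℝ × ℝ × ℝ => H q.1 q.2.1 q.2.2) →
      ∫⁻ v : Fin 3 → ℝ, H (v 0 + v 2) (v 0 - v 2) (2 * v 1) =
        ENNReal.ofReal (1 / 4) * ∫⁻ p : ℝ, ∫⁻ x : ℝ, ∫⁻ y : ℝ, H p x y := by
    intro H hH
    have hHc : ∀ {α : Type} [MeasurableSpace α] {a b c : α → ℝ}, Measurable a → Measurable b →
        Measurable c → Measurable fun t => H (a t) (b t) (c t) := fun ha hb hc =>
      hH.comp (ha.prodMk (hb.prodMk hc))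
    -- The inverse of v ↦ (v₀ + v₂, v₀ - v₂, 2v₁).
    let M : Matrix (Fin 3) (Fin 3) ℝ := !![1 / 2, 1 / 2, 0; 0, 0, 1 / 2; 1 / 2, -1 / 2, 0]
    have hM : M.det = 1 / 4 := by
      simp [M, Matrix.det_fin_three]
      norm_num
    rw [lintegral_comp_mulVec (M := M) (by rw [hM]; norm_num) (hHc (by fun_prop) (by fun_prop)
      (by fun_prop)), hM, lintegral_fin_three (hHc (by fun_prop) (by fun_prop) (by fun_prop))]
    congr 2
    · norm_num
    · funext p
      congr 1
      funext x
      congr 1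
      funext y
      congr 1 <;> simp [M, Matrix.mulVec, dotProduct, Fin.sum_univ_three] <;> ring
  have k1 := key (fun p x y => F p (x ^ 2 + y ^ 2) * ENNReal.ofReal (y ^ (2 * j)))
    (by
      refine Measurable.mul (hF.comp (f := fun q : ℝ × ℝ × ℝ => (q.1, q.2.1 ^ 2 + q.2.2 ^ 2))
        (by fun_prop)) (by fun_prop))
  have k2 := key (fun p x y => F p (x ^ 2 + y ^ 2) * ENNReal.ofReal ((x ^ 2 + y ^ 2) ^ j))
    (by
      refine Measurable.mul (hF.comp (f := fun q : ℝ × ℝ × ℝ => (q.1, q.2.1 ^ 2 + q.2.2 ^ 2))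
        (by fun_prop)) (by fun_prop))
  rw [k1, k2]
  simp_rw [lintegral_radial_mul_pow (hF2 _)]
  rw [lintegral_const_mul' _ _ ENNReal.ofReal_ne_top]
  ring

/-- The last factor is a power of det(1 + v). With h the Schur complement of x in v = [[x, z], [z,
y]], this determinant is (1+x)(1+h) + z²/x, and rescaling z separates the three variables into beta
integrals. -/
lemma lintegral_symRpow_mul_pow_mul_symDet_one_add {s : ℝ} (hs : -1 < s) (j : ℕ) :
    ∫⁻ v : Fin 3 → ℝ, symRpow s v * ENNReal.ofReal ((2 * v 1) ^ (2 * j)) *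
        posRpow (-(2 * s + 2 * j + 3)) (1 + (v 0 + v 2) + symDet v) =
      ENNReal.ofReal (4 ^ j * beta (j + 1 / 2) (2 * s + j + 5 / 2) *
        beta (s + 1) (s + j + 3 / 2) * beta (s + j + 3 / 2) (s + 1)) := by
  have hj : (0 : ℝ) ≤ j := j.cast_nonneg
  rw [lintegral_fin_three (by fun_prop)]
  have hB1 := beta_pos (show (0 : ℝ) < j + 1 / 2 by linarith)
    (show (0 : ℝ) < 2 * s + j + 5 / 2 by linarith)
  have hB2 := beta_pos (show (0 : ℝ) < s + 1 by linarith)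
    (show (0 : ℝ) < s + j + 3 / 2 by linarith)
  have key : ∀ x : ℝ, ∫⁻ z : ℝ, ∫⁻ y : ℝ, symRpow s ![x, z, y] *
        ENNReal.ofReal ((2 * ![x, z, y] 1) ^ (2 * j)) *
        posRpow (-(2 * s + 2 * j + 3)) (1 + (![x, z, y] 0 + ![x, z, y] 2) + symDet ![x, z, y]) =
      ENNReal.ofReal (4 ^ j * beta (j + 1 / 2) (2 * s + j + 5 / 2) *
        beta (s + 1) (s + j + 3 / 2)) *
        (posRpow ((s + j + 3 / 2) - 1) x * posRpow (-((s + j + 3 / 2) + (s + 1))) (1 + x)) := by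
    intro x
    rcases le_or_gt x 0 with hx | hx
    · simp [symRpow, posRpow_of_nonpos _ hx]
    have hy : ∀ z : ℝ, ∫⁻ y : ℝ, symRpow s ![x, z, y] *
        ENNReal.ofReal ((2 * ![x, z, y] 1) ^ (2 * j)) *
        posRpow (-(2 * s + 2 * j + 3)) (1 + (![x, z, y] 0 + ![x, z, y] 2) + symDet ![x, z, y]) =
        ∫⁻ h : ℝ, posRpow s x * posRpow s h * ENNReal.ofReal (4 ^ j) *
          (ENNReal.ofReal (z ^ (2 * j)) *
          posRpow (-(2 * s + 2 * j + 3)) ((1 + x) * (1 + h) + z ^ 2 / x)) := by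
      intro z
      rw [← lintegral_add_right_eq_self _ (z ^ 2 / x)]
      refine lintegral_congr fun h => ?_
      have e1 : symDet ![x, z, h + z ^ 2 / x] = x * h := by
        simp [symDet]
        field_simp
        ring
      have e2 : (1 + (![x, z, h + z ^ 2 / x] 0 + ![x, z, h + z ^ 2 / x] 2) +
          symDet ![x, z, h + z ^ 2 / x]) = (1 + x) * (1 + h) + z ^ 2 / x := by
        rw [e1]
        simp
        ring
      rw [symRpow, e2, e1, posRpow_mul_left _ hx, posRpow_of_pos _ hx]
      simp only [Matrix.cons_val_zero, Matrix.cons_val_one, posRpow_zero_of_pos hx, mul_pow,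
        pow_mul]
      rw [ENNReal.ofReal_mul (by positivity)]
      norm_num
      ring
    have hz : ∀ h : ℝ, ∫⁻ z : ℝ, posRpow s x * posRpow s h * ENNReal.ofReal (4 ^ j) *
          (ENNReal.ofReal (z ^ (2 * j)) *
          posRpow (-(2 * s + 2 * j + 3)) ((1 + x) * (1 + h) + z ^ 2 / x)) =
        (ENNReal.ofReal (4 ^ j * beta (j + 1 / 2) (2 * s + j + 5 / 2)) *
          (posRpow (s + j + 1 / 2) x *
          posRpow (-(2 * s + j + 5 / 2)) (1 + x))) *
          (posRpow ((s + 1) - 1) h * posRpow (-((s + 1) + (s + j + 3 / 2))) (1 + h)) := by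
      intro h
      rcases le_or_gt h 0 with hh | hh
      · simp [posRpow_of_nonpos _ hh]
      have hc2 : 0 < x * ((1 + x) * (1 + h)) := by positivity
      -- The scale of z for which (1+x)(1+h) + z²/x becomes (1+x)(1+h)(1+t²).
      set c := √(x * ((1 + x) * (1 + h))) with hc
      have hc0 : 0 < c := Real.sqrt_pos.2 hc2
      have hcs : c ^ 2 = x * ((1 + x) * (1 + h)) := Real.sq_sqrt hc2.le
      rw [lintegral_const_mul _ (by fun_prop), lintegral_comp_mul_left_eq hc0 (by fun_prop)]
      have e : ∀ t : ℝ, ENNReal.ofReal ((c * t) ^ (2 * j)) *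
          posRpow (-(2 * s + 2 * j + 3)) ((1 + x) * (1 + h) + (c * t) ^ 2 / x) =
          ENNReal.ofReal (c ^ (2 * j) * ((1 + x) * (1 + h)) ^ (-(2 * s + 2 * j + 3))) *
          (ENNReal.ofReal (t ^ (2 * j)) *
          posRpow (-(j + 1 / 2 + (2 * s + j + 5 / 2))) (1 + t ^ 2)) := by
        intro t
        have e1 : (1 + x) * (1 + h) + (c * t) ^ 2 / x = ((1 + x) * (1 + h)) * (1 + t ^ 2) := by
          rw [mul_pow, hcs]
          field_simp
        rw [e1, posRpow_mul_left _ (by positivity), mul_pow, ENNReal.ofReal_mul (by positivity),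
          ENNReal.ofReal_mul (by positivity),
          show (-(j + 1 / 2 + (2 * s + j + 5 / 2)) : ℝ) = -(2 * s + 2 * j + 3) by ring]
        ring
      simp_rw [e]
      rw [lintegral_const_mul _ (by fun_prop), lintegral_pow_mul_one_add_sq_rpow j (by linarith),
        posRpow_of_pos _ hx, posRpow_of_pos _ hh, posRpow_of_pos _ hx, posRpow_of_pos _ hh,
        posRpow_of_pos _ (by linarith : 0 < 1 + x), posRpow_of_pos _ (by linarith : 0 < 1 + h)]
      repeat rw [← ENNReal.ofReal_mul (by positivity)]
      congr 1
      have ec : c * c ^ (2 * j) = x ^ (j + 1 / 2 : ℝ) * (1 + x) ^ (j + 1 / 2 : ℝ) *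
          (1 + h) ^ (j + 1 / 2 : ℝ) := by
        rw [← Real.mul_rpow hx.le (by positivity), ← Real.mul_rpow (by positivity) (by positivity),
          pow_mul, hcs, hc, Real.sqrt_eq_rpow, ← Real.rpow_natCast, ← Real.rpow_add hc2]
        congr 1 <;> ring
      rw [Real.mul_rpow (by positivity) (by positivity),
        show (s + j + 1 / 2 : ℝ) = s + (j + 1 / 2) by ring, Real.rpow_add hx,
        show (-(2 * s + j + 5 / 2) : ℝ) = (j + 1 / 2) + -(2 * s + 2 * j + 3) by ring,
        Real.rpow_add (by positivity : 0 < 1 + x),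
        show (-(s + 1 + (s + j + 3 / 2)) : ℝ) = (j + 1 / 2) + -(2 * s + 2 * j + 3) by ring,
        Real.rpow_add (by positivity : 0 < 1 + h), add_sub_cancel_right]
      linear_combination (x ^ s * h ^ s * 4 ^ j * (1 + x) ^ (-(2 * s + 2 * j + 3)) *
        (1 + h) ^ (-(2 * s + 2 * j + 3)) * beta (j + 1 / 2) (2 * s + j + 5 / 2)) * ec
    simp_rw [hy]
    rw [lintegral_lintegral_swap (by fun_prop)]
    simp_rw [hz]
    rw [lintegral_const_mul _ (by fun_prop),
      lintegral_posRpow_mul_one_add_rpow (by linarith) (by linarith),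
      ENNReal.ofReal_mul (by positivity : 0 ≤ 4 ^ j * beta (j + 1 / 2) (2 * s + j + 5 / 2)),
      show s + j + 3 / 2 - 1 = s + j + 1 / 2 by ring,
      show -(s + j + 3 / 2 + (s + 1)) = -(2 * s + j + 5 / 2) by ring]
    ring
  simp_rw [key]
  rw [lintegral_const_mul _ (by fun_prop),
    lintegral_posRpow_mul_one_add_rpow (by linarith) (by linarith),
    ← ENNReal.ofReal_mul (by positivity)]

/-! ### Congruence by the symmetric square root -/

lemma exists_symm_sqrt {v : Fin 3 → ℝ} (hv : SymPos v) :
    ∃ a b c : ℝ, v = ![a ^ 2 + b ^ 2, a * b + b * c, b ^ 2 + c ^ 2] ∧ 0 < a * c - b ^ 2 := by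
  obtain ⟨h0, hd⟩ := id hv
  have h2 := hv.pos_two
  set σ := √(symDet v) with hσ
  have hσ0 : 0 < σ := Real.sqrt_pos.2 hd
  have hσ2 : σ ^ 2 = symDet v := Real.sq_sqrt hd.le
  set τ := √(v 0 + v 2 + 2 * σ) with hτ
  have hτ2 : τ ^ 2 = v 0 + v 2 + 2 * σ := Real.sq_sqrt (by positivity)
  have hτ0 : 0 < τ := Real.sqrt_pos.2 (by positivity)
  unfold symDet at hσ2
  -- Cayley–Hamilton: a root T with determinant σ and trace τ satisfies T² + σ = τT, hence T = (v +
  -- σ)/τ, and taking traces gives τ² = tr v + 2σ.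
  refine ⟨(v 0 + σ) / τ, v 1 / τ, (v 2 + σ) / τ, ?_, ?_⟩
  · ext i
    fin_cases i
    · simp
      field_simp
      rw [hτ2]
      linear_combination -hσ2
    · simp
      field_simp
      rw [hτ2]
      ring
    · simp
      field_simp
      rw [hτ2]
      linear_combination -hσ2
  · have : (v 0 + σ) / τ * ((v 2 + σ) / τ) - (v 1 / τ) ^ 2 = σ := by
      field_simp
      rw [hτ2]
      linear_combination -hσ2
    rw [this]
    exact hσ0

/-- The matrix of the map `w ↦ T w T` on symmetric matrices, for `T = [[a, b], [b, c]]`. -/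
def symConj (a b c : ℝ) : Matrix (Fin 3) (Fin 3) ℝ :=
  !![a ^ 2, 2 * a * b, b ^ 2; a * b, a * c + b ^ 2, b * c; b ^ 2, 2 * b * c, c ^ 2]

lemma det_symConj (a b c : ℝ) : (symConj a b c).det = (a * c - b ^ 2) ^ 3 := by
  simp [symConj, Matrix.det_fin_three]
  ring

lemma symConj_mulVec (a b c : ℝ) (w : Fin 3 → ℝ) : (symConj a b c).mulVec w =
    ![a ^ 2 * w 0 + 2 * a * b * w 1 + b ^ 2 * w 2,
      a * b * w 0 + (a * c + b ^ 2) * w 1 + b * c * w 2,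
      b ^ 2 * w 0 + 2 * b * c * w 1 + c ^ 2 * w 2] := by
  ext i
  fin_cases i <;> simp [symConj, Matrix.mulVec, dotProduct, Fin.sum_univ_three]

lemma symDet_symConj_mulVec (a b c : ℝ) (w : Fin 3 → ℝ) :
    symDet ((symConj a b c).mulVec w) = (a * c - b ^ 2) ^ 2 * symDet w := by
  rw [symConj_mulVec]
  simp [symDet]
  ring

lemma symPos_symConj_mulVec {a b c : ℝ} (h : 0 < a * c - b ^ 2) (w : Fin 3 → ℝ) :
    SymPos ((symConj a b c).mulVec w) ↔ SymPos w := by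
  rw [SymPos, SymPos, symDet_symConj_mulVec, mul_pos_iff_of_pos_left (by positivity)]
  refine and_congr_left fun hd => ?_
  rw [symConj_mulVec]
  simp only [Matrix.cons_val_zero]
  -- The determinants already have the same sign; this identity shows that the upper left entries do
  -- too.
  have e : (a ^ 2 * w 0 + 2 * a * b * w 1 + b ^ 2 * w 2) * w 0 =
      (a * w 0 + b * w 1) ^ 2 + b ^ 2 * symDet w := by
    unfold symDet
    ring
  have hw0 : w 0 ≠ 0 := by
    rintro h0
    unfold symDet at hd
    rw [h0] at hd
    nlinarith [sq_nonneg (w 1)]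
  have hpos : 0 < (a ^ 2 * w 0 + 2 * a * b * w 1 + b ^ 2 * w 2) * w 0 := by
    rw [e]
    by_cases hb : b = 0
    · have ha : a ≠ 0 := by
        rintro rfl
        simp [hb] at h
      subst hb
      have : a * w 0 + 0 * w 1 ≠ 0 := by simpa using ⟨ha, hw0⟩
      positivity
    · positivity
  constructor
  · intro h1
    exact (mul_pos_iff_of_pos_left h1).1 hpos
  · intro h1
    exact (mul_pos_iff_of_pos_right h1).1 hpos

lemma symRpow_symConj_mulVec (s : ℝ) {a b c : ℝ} (h : 0 < a * c - b ^ 2) (w : Fin 3 → ℝ) :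
    symRpow s ((symConj a b c).mulVec w) =
      ENNReal.ofReal (((a * c - b ^ 2) ^ 2) ^ s) * symRpow s w := by
  by_cases hw : SymPos w
  · rw [symRpow_of_symPos _ hw, symRpow_of_symPos _ ((symPos_symConj_mulVec h w).2 hw),
      symDet_symConj_mulVec, posRpow_mul_left _ (by positivity)]
  · rw [symRpow_of_not_symPos _ hw,
      symRpow_of_not_symPos _ fun h2 => hw ((symPos_symConj_mulVec h w).1 h2), mul_zero]

@[fun_prop]
lemma measurable_symDisc : Measurable fun p : (Fin 3 → ℝ) × (Fin 3 → ℝ) => symDisc p.1 p.2 := by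
  unfold symDisc symDet
  fun_prop

/-- The substitution w ↦ TwT with T² = v. Since disc(v, TwT) = |v|² disc(1, w) and tr v + tr TwT =
tr v(1 + w), the dependence on v becomes that of a Siegel integral. The exponent collects s + s + 2j
from the integrand and 3/2 from the Jacobian |T|³. -/
lemma lintegral_symRpow_mul_symDisc (s : ℝ) (j : ℕ) (v : Fin 3 → ℝ) :
    ∫⁻ w : Fin 3 → ℝ, symRpow s v * symRpow s w * ENNReal.ofReal (symDisc v w ^ j) *
        ENNReal.ofReal (Real.exp (-(v 0 + v 2 + (w 0 + w 2)))) =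
      ∫⁻ w : Fin 3 → ℝ, symRpow s w *
        ENNReal.ofReal (((w 0 - w 2) ^ 2 + (2 * w 1) ^ 2) ^ j) *
        (symRpow (2 * s + 2 * j + 3 / 2) v *
          ENNReal.ofReal (Real.exp (-symPair v ![1 + w 0, w 1, 1 + w 2]))) := by
  by_cases hv : SymPos v
  swap
  · simp [symRpow_of_not_symPos _ hv]
  obtain ⟨a, b, c, rfl, hτ⟩ := exists_symm_sqrt hv
  set τ := a * c - b ^ 2 with hτdef
  have hdet : symDet ![a ^ 2 + b ^ 2, a * b + b * c, b ^ 2 + c ^ 2] = τ ^ 2 := by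
    simp [symDet, hτdef]
    ring
  rw [lintegral_comp_mulVec (M := symConj a b c) (by rw [det_symConj]; positivity)
    (by unfold symDisc; fun_prop), det_symConj, abs_of_pos (by positivity),
    ← lintegral_const_mul' _ _ ENNReal.ofReal_ne_top]
  refine lintegral_congr fun w => ?_
  rw [symRpow_symConj_mulVec _ hτ, symRpow_of_symPos _ hv, symRpow_of_symPos _ hv, hdet,
    posRpow_of_pos _ (by positivity), posRpow_of_pos _ (by positivity)]
  have e1 : symDisc ![a ^ 2 + b ^ 2, a * b + b * c, b ^ 2 + c ^ 2] ((symConj a b c).mulVec w) =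
      (τ ^ 2) ^ 2 * ((w 0 - w 2) ^ 2 + (2 * w 1) ^ 2) := by
    rw [symConj_mulVec]
    simp [symDisc, symDet, hτdef]
    ring
  have e2 : (![a ^ 2 + b ^ 2, a * b + b * c, b ^ 2 + c ^ 2] 0 +
      ![a ^ 2 + b ^ 2, a * b + b * c, b ^ 2 + c ^ 2] 2 +
      ((symConj a b c).mulVec w 0 + (symConj a b c).mulVec w 2)) =
      symPair ![a ^ 2 + b ^ 2, a * b + b * c, b ^ 2 + c ^ 2] ![1 + w 0, w 1, 1 + w 2] := by
    rw [symConj_mulVec]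
    simp [symPair]
    ring
  have e3 : τ ^ 3 * (τ ^ 2) ^ s * (τ ^ 2) ^ s * ((τ ^ 2) ^ 2) ^ j =
      (τ ^ 2) ^ (2 * s + 2 * j + 3 / 2) := by
    have hτ2 : 0 < τ ^ 2 := by positivity
    have : τ ^ 3 = (τ ^ 2) ^ (3 / 2 : ℝ) := by
      rw [← Real.rpow_natCast, ← Real.rpow_natCast, ← Real.rpow_mul hτ.le]
      norm_num
    rw [this, ← pow_mul, ← Real.rpow_natCast (τ ^ 2), ← Real.rpow_add hτ2, ← Real.rpow_add hτ2,
      ← Real.rpow_add hτ2]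
    congr 1
    push_cast
    ring
  rw [e1, e2, ← e3, mul_pow, ENNReal.ofReal_mul (by positivity), ENNReal.ofReal_mul (by positivity),
    ENNReal.ofReal_mul (by positivity), ENNReal.ofReal_mul (by positivity)]
  ring

/-- The value of `∫∫ |v| ^ s |w| ^ s disc (v, w) ^ j exp (- tr v - tr w)` over pairs of positive
definite matrices. -/
noncomputable def discMoment (s : ℝ) (j : ℕ) : ℝ :=
  (∏ i ∈ Finset.range j, (2 * (i : ℝ) + 1) / (2 * i + 2))⁻¹ *
    (√Real.pi * Real.Gamma (2 * s + 2 * j + 5 / 2) * Real.Gamma (2 * s + 2 * j + 3) *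
      (4 ^ j * beta (j + 1 / 2) (2 * s + j + 5 / 2) *
        beta (s + 1) (s + j + 3 / 2) * beta (s + j + 3 / 2) (s + 1)))

/-- Unlike the sign of the upper left entry, that of the trace is visibly invariant under rotations,
as the radial argument requires. -/
lemma symPos_iff_add_pos (v : Fin 3 → ℝ) : SymPos v ↔ 0 < v 0 + v 2 ∧ 0 < symDet v := by
  refine ⟨fun h => ⟨add_pos h.1 h.pos_two, h.2⟩, fun h => ⟨?_, h.2⟩⟩
  obtain ⟨h1, h2⟩ := h
  unfold symDet at h2
  by_contra hc
  have : 0 < v 2 := by linarith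
  nlinarith [sq_nonneg (v 1)]

lemma symRpow_eq_add (s : ℝ) (v : Fin 3 → ℝ) :
    symRpow s v = posRpow 0 (v 0 + v 2) * posRpow s (symDet v) := by
  by_cases hv : SymPos v
  · rw [symRpow_of_symPos _ hv, posRpow_zero_of_pos ((symPos_iff_add_pos v).1 hv).1, one_mul]
  · rw [symRpow_of_not_symPos _ hv]
    by_cases h : 0 < v 0 + v 2
    · rw [posRpow_of_nonpos s (not_lt.1 fun h2 => hv ((symPos_iff_add_pos v).2 ⟨h, h2⟩)), mul_zero]
    · rw [posRpow_of_nonpos 0 (not_lt.1 h), zero_mul]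

/-- After the substitution by √v, Siegel's integral with parameter 1 + w removes v and leaves a
power of det(1 + w). The rest is invariant under rotations of w, so disc(1, w)^j is exchanged for
(2w₁)^(2j) at the price of Wallis's product. -/
lemma lintegral_lintegral_symRpow_mul_symDisc {s : ℝ} (hs : -1 < s) (j : ℕ) :
    ∫⁻ v : Fin 3 → ℝ, ∫⁻ w : Fin 3 → ℝ,
        symRpow s v * symRpow s w * ENNReal.ofReal (symDisc v w ^ j) *
          ENNReal.ofReal (Real.exp (-(v 0 + v 2 + (w 0 + w 2)))) =
      ENNReal.ofReal (discMoment s j) := by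
  have hj : (0 : ℝ) ≤ j := j.cast_nonneg
  simp_rw [lintegral_symRpow_mul_symDisc]
  rw [lintegral_lintegral_swap (by
    refine Measurable.aemeasurable ?_
    unfold symPair
    simp only [Matrix.cons_val_zero, Matrix.cons_val_one, Matrix.cons_val]
    fun_prop)]
  have h1 : ∀ w : Fin 3 → ℝ, ∫⁻ v : Fin 3 → ℝ, symRpow s w *
        ENNReal.ofReal (((w 0 - w 2) ^ 2 + (2 * w 1) ^ 2) ^ j) *
        (symRpow (2 * s + 2 * j + 3 / 2) v *
          ENNReal.ofReal (Real.exp (-symPair v ![1 + w 0, w 1, 1 + w 2]))) =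
      ENNReal.ofReal (√Real.pi * Real.Gamma (2 * s + 2 * j + 5 / 2) *
        Real.Gamma (2 * s + 2 * j + 3)) *
      (symRpow s w * posRpow (-(2 * s + 2 * j + 3)) (1 + (w 0 + w 2) + symDet w) *
        ENNReal.ofReal (((w 0 - w 2) ^ 2 + (2 * w 1) ^ 2) ^ j)) := by
    intro w
    by_cases hw : SymPos w
    swap
    · simp [symRpow_of_not_symPos _ hw]
    have hw2 := hw.pos_two
    have hw0 := hw.1
    have hdet : symDet ![1 + w 0, w 1, 1 + w 2] = 1 + (w 0 + w 2) + symDet w := by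
      simp [symDet]
      ring
    have hpos : SymPos ![1 + w 0, w 1, 1 + w 2] := by
      refine ⟨by simp; linarith, ?_⟩
      rw [hdet]
      linarith [hw.2]
    rw [lintegral_const_mul _ (by unfold symPair; fun_prop),
      lintegral_symRpow_mul_exp (by linarith) hpos, hdet,
      show 2 * s + 2 * j + 3 / 2 + 1 = 2 * s + 2 * (j : ℝ) + 5 / 2 by ring,
      show 2 * s + 2 * j + 3 / 2 + 3 / 2 = 2 * s + 2 * (j : ℝ) + 3 by ring]
    ring
  simp_rw [h1]
  rw [lintegral_const_mul _ (by fun_prop)]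
  set κ := ∏ i ∈ Finset.range j, (2 * (i : ℝ) + 1) / (2 * i + 2) with hκ
  have hκ0 : 0 < κ := Finset.prod_pos fun i _ => by positivity
  -- In terms of the trace p and the discriminant d, the determinant is (p² - d)/4.
  let F : ℝ → ℝ → ENNReal := fun p d =>
    posRpow 0 p * posRpow s ((p ^ 2 - d) / 4) *
      posRpow (-(2 * s + 2 * j + 3)) (1 + p + (p ^ 2 - d) / 4)
  have hF : ∀ w : Fin 3 → ℝ, F (w 0 + w 2) ((w 0 - w 2) ^ 2 + (2 * w 1) ^ 2) =
      symRpow s w * posRpow (-(2 * s + 2 * j + 3)) (1 + (w 0 + w 2) + symDet w) := by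
    intro w
    have : ((w 0 + w 2) ^ 2 - ((w 0 - w 2) ^ 2 + (2 * w 1) ^ 2)) / 4 = symDet w := by
      unfold symDet
      ring
    simp only [F]
    rw [symRpow_eq_add, this]
  have h2 := lintegral_sym_radial (F := F) (by simp only [F, Function.uncurry_def]; fun_prop) j
  simp_rw [hF] at h2
  have h3 := lintegral_symRpow_mul_pow_mul_symDet_one_add hs j
  simp_rw [mul_right_comm (symRpow s _) (ENNReal.ofReal _)] at h3
  rw [h3] at h2
  have h4 : ∀ x : ENNReal, x = ENNReal.ofReal κ⁻¹ * (ENNReal.ofReal κ * x) := by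
    intro x
    rw [← mul_assoc, ← ENNReal.ofReal_mul (by positivity), inv_mul_cancel₀ hκ0.ne',
      ENNReal.ofReal_one, one_mul]
  have hG1 := Real.Gamma_pos_of_pos (show (0 : ℝ) < 2 * s + 2 * j + 5 / 2 by linarith)
  have hG2 := Real.Gamma_pos_of_pos (show (0 : ℝ) < 2 * s + 2 * j + 3 by linarith)
  rw [h4 (∫⁻ _, _), ← h2, discMoment, ← hκ, ENNReal.ofReal_mul (p := κ⁻¹) (by positivity),
    ENNReal.ofReal_mul (p := √Real.pi * _ * _) (by positivity)]
  ring

/-! ### Moments of the off-diagonal entries of a contraction -/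

lemma integrable_and_integral_eq_of_lintegral {α : Type*} [MeasurableSpace α] {μ : Measure α}
    {f : α → ℝ} (hf : AEStronglyMeasurable f μ) (h0 : 0 ≤ᵐ[μ] f) {c : ℝ} (hc : 0 ≤ c)
    (h : ∫⁻ x, ENNReal.ofReal (f x) ∂μ = ENNReal.ofReal c) :
    Integrable f μ ∧ ∫ x, f x ∂μ = c := by
  constructor
  · refine ⟨hf, ?_⟩
    rw [hasFiniteIntegral_iff_ofReal h0, h]
    exact ENNReal.ofReal_lt_top
  · rw [integral_eq_lintegral_of_nonneg_ae h0 hf, h, ENNReal.toReal_ofReal hc]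

/-- The determinant of `1 - Θᵀ Θ` for `Θ = [[t 0, t 2], [t 1, t 3]]`. -/
def defectDet (t : Fin 4 → ℝ) : ℝ :=
  (1 - t 0 ^ 2 - t 1 ^ 2) * (1 - t 2 ^ 2 - t 3 ^ 2) - (t 0 * t 2 + t 1 * t 3) ^ 2

@[fun_prop]
lemma continuous_defectDet : Continuous defectDet := by
  unfold defectDet
  fun_prop

@[fun_prop]
lemma measurable_defectDet : Measurable defectDet := continuous_defectDet.measurable

/-- The open unit ball of contractions `[[t 0, t 2], [t 1, t 3]]`. -/
def contractions : Set (Fin 4 → ℝ) := {t | 0 < 1 - t 0 ^ 2 - t 1 ^ 2 ∧ 0 < defectDet t}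

lemma measurableSet_contractions : MeasurableSet contractions :=
  (measurableSet_lt (f := fun _ => (0 : ℝ)) (g := fun t : Fin 4 → ℝ => 1 - t 0 ^ 2 - t 1 ^ 2)
    measurable_const (by fun_prop)).inter (measurableSet_lt measurable_const measurable_defectDet)

/-- The moment of `t 1 ^ (2 * r) * t 2 ^ (2 * s)` for the density `defectDet t ^ K`. -/
noncomputable def contractionMoment (K : ℝ) (r s : ℕ) : ℝ :=
  beta (1 / 2) (K + 1) * beta (s + 1 / 2) (K + 3 / 2) * beta (r + 1 / 2) (K + 3 / 2) *
    beta (1 / 2) (K + r + s + 2)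

lemma contractionMoment_nonneg {K : ℝ} (hK : -1 < K) (r s : ℕ) : 0 ≤ contractionMoment K r s := by
  have hr : (0 : ℝ) ≤ r := r.cast_nonneg
  have hs : (0 : ℝ) ≤ s := s.cast_nonneg
  unfold contractionMoment
  have h1 := beta_pos (show (0 : ℝ) < 1 / 2 by norm_num) (show (0 : ℝ) < K + 1 by linarith)
  have h2 := beta_pos (show (0 : ℝ) < s + 1 / 2 by linarith) (show (0 : ℝ) < K + 3 / 2 by linarith)
  have h3 := beta_pos (show (0 : ℝ) < r + 1 / 2 by linarith) (show (0 : ℝ) < K + 3 / 2 by linarith)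
  have h4 := beta_pos (show (0 : ℝ) < 1 / 2 by norm_num)
    (show (0 : ℝ) < K + r + s + 2 by linarith)
  positivity

/-- The entries are integrated out in the order z, y, x, w, for Θ = [[w, y], [x, z]]. Completing the
square in z makes the defect determinant a quadratic of the form a - bz², and the same shape recurs
for each following entry. -/
lemma lintegral_contractionMoment {K : ℝ} (hK : -1 < K) (r s : ℕ) :
    ∫⁻ t : Fin 4 → ℝ, posRpow 0 (1 - t 0 ^ 2 - t 1 ^ 2) * posRpow K (defectDet t) *
        ENNReal.ofReal (t 1 ^ (2 * r)) * ENNReal.ofReal (t 2 ^ (2 * s)) =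
      ENNReal.ofReal (contractionMoment K r s) := by
  have hr : (0 : ℝ) ≤ r := r.cast_nonneg
  have hs : (0 : ℝ) ≤ s := s.cast_nonneg
  rw [lintegral_fin_four (by fun_prop)]
  have hx : ∀ w x : ℝ, ∫⁻ y : ℝ, ∫⁻ z : ℝ, posRpow 0 (1 - w ^ 2 - x ^ 2) *
        posRpow K (defectDet ![w, x, y, z]) *
        ENNReal.ofReal (x ^ (2 * r)) * ENNReal.ofReal (y ^ (2 * s)) =
      (ENNReal.ofReal (beta (1 / 2) (K + 1)) * ENNReal.ofReal (beta (s + 1 / 2) (K + 3 / 2)) *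
        posRpow s (1 - w ^ 2)) *
      (posRpow (K + 1 / 2) (1 - w ^ 2 - 1 * x ^ 2) * ENNReal.ofReal (x ^ (2 * r))) := by
    intro w x
    rw [one_mul]
    rcases le_or_gt (1 - w ^ 2 - x ^ 2) 0 with hg | hg
    · simp [posRpow_of_nonpos _ hg]
    have hq : 0 < 1 - w ^ 2 := by nlinarith [sq_nonneg x]
    set g := 1 - w ^ 2 - x ^ 2 with hgdef
    set q := 1 - w ^ 2 with hqdef
    have hz : ∀ y : ℝ, ∫⁻ z : ℝ, posRpow 0 g *
        posRpow K (defectDet ![w, x, y, z]) *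
        ENNReal.ofReal (x ^ (2 * r)) * ENNReal.ofReal (y ^ (2 * s)) =
        (ENNReal.ofReal (beta (1 / 2) (K + 1)) * ENNReal.ofReal (x ^ (2 * r)) *
          ENNReal.ofReal ((g / q) ^ (K + 1 / 2)) * ENNReal.ofReal (q ^ (-(1 / 2) : ℝ))) *
        (posRpow (K + 1 / 2) (q - 1 * y ^ 2) * ENNReal.ofReal (y ^ (2 * s))) := by
      intro y
      -- The centre of the quadratic `defectDet` in z, whose leading coefficient is -q.
      rw [← lintegral_sub_right_eq_self _ (w * x * y / q)]
      have e : ∀ z : ℝ, posRpow 0 g * posRpow K (defectDet ![w, x, y, z - w * x * y / q]) *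
          ENNReal.ofReal (x ^ (2 * r)) * ENNReal.ofReal (y ^ (2 * s)) =
          (ENNReal.ofReal (x ^ (2 * r)) * ENNReal.ofReal (y ^ (2 * s))) *
          (posRpow K (g / q * (q - 1 * y ^ 2) - q * z ^ 2) * ENNReal.ofReal (z ^ (2 * 0))) := by
        intro z
        have e1 : defectDet ![w, x, y, z - w * x * y / q] =
            g / q * (q - 1 * y ^ 2) - q * z ^ 2 := by
          simp [defectDet, hgdef]
          field_simp
          rw [hqdef]
          ring
        rw [e1, posRpow_zero_of_pos hg]
        simp only [mul_zero, pow_zero, ENNReal.ofReal_one]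
        ring
      simp_rw [e]
      rw [lintegral_const_mul _ (by fun_prop), lintegral_posRpow_sub_mul_sq hq hK,
        Nat.cast_zero, add_zero, posRpow_mul_left _ (div_pos hg hq), zero_add,
        posRpow_of_pos _ hq]
      ring
    simp_rw [hz]
    rw [lintegral_const_mul _ (by fun_prop),
      lintegral_posRpow_sub_mul_sq one_pos (by linarith), posRpow_of_pos _ hq, posRpow_of_pos _ hq,
      posRpow_of_pos _ hg, posRpow_of_pos _ one_pos, Real.one_rpow, ENNReal.ofReal_one, one_mul,
      show K + 1 / 2 + 1 = K + 3 / 2 by ring]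
    have e : ENNReal.ofReal ((g / q) ^ (K + 1 / 2)) * ENNReal.ofReal (q ^ (-(1 / 2) : ℝ)) *
        ENNReal.ofReal (q ^ (K + 1 / 2 + s + 1 / 2)) =
        ENNReal.ofReal (q ^ (s : ℝ)) * ENNReal.ofReal (g ^ (K + 1 / 2)) := by
      repeat rw [← ENNReal.ofReal_mul (by positivity)]
      congr 1
      have : q ^ (K + 1 / 2 + s + 1 / 2) = q ^ (K + 1 / 2) * q ^ (s : ℝ) * q ^ (1 / 2 : ℝ) := by
        rw [← Real.rpow_add hq, ← Real.rpow_add hq]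
      rw [Real.div_rpow hg.le hq.le, this, Real.rpow_neg hq.le]
      have h1 := (Real.rpow_pos_of_pos hq (K + 1 / 2)).ne'
      have h2 := (Real.rpow_pos_of_pos hq (1 / 2)).ne'
      field_simp
    calc _ = (ENNReal.ofReal (beta (1 / 2) (K + 1)) *
          ENNReal.ofReal (beta (s + 1 / 2) (K + 3 / 2)) * ENNReal.ofReal (x ^ (2 * r))) *
          (ENNReal.ofReal ((g / q) ^ (K + 1 / 2)) * ENNReal.ofReal (q ^ (-(1 / 2) : ℝ)) *
          ENNReal.ofReal (q ^ (K + 1 / 2 + s + 1 / 2))) := by ring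
      _ = _ := by rw [e]; ring
  simp only [Matrix.cons_val_zero, Matrix.cons_val_one, Matrix.cons_val]
  simp_rw [hx]
  have hw : ∀ w : ℝ, ∫⁻ x : ℝ, (ENNReal.ofReal (beta (1 / 2) (K + 1)) *
        ENNReal.ofReal (beta (s + 1 / 2) (K + 3 / 2)) * posRpow s (1 - w ^ 2)) *
      (posRpow (K + 1 / 2) (1 - w ^ 2 - 1 * x ^ 2) * ENNReal.ofReal (x ^ (2 * r))) =
      (ENNReal.ofReal (beta (1 / 2) (K + 1)) * ENNReal.ofReal (beta (s + 1 / 2) (K + 3 / 2)) *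
        ENNReal.ofReal (beta (r + 1 / 2) (K + 3 / 2))) *
      (posRpow (K + r + s + 1) (1 - 1 * w ^ 2) * ENNReal.ofReal (w ^ (2 * 0))) := by
    intro w
    rw [lintegral_const_mul _ (by fun_prop), lintegral_posRpow_sub_mul_sq one_pos (by linarith),
      posRpow_of_pos _ one_pos, Real.one_rpow, ENNReal.ofReal_one, one_mul,
      show K + 1 / 2 + 1 = K + 3 / 2 by ring,
      show K + r + s + 1 = s + (K + 1 / 2 + r + 1 / 2) by ring,
      ← posRpow_mul_posRpow s (K + 1 / 2 + r + 1 / 2)]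
    simp only [mul_zero, pow_zero, ENNReal.ofReal_one, one_mul]
    ring
  simp_rw [hw]
  rw [lintegral_const_mul _ (by fun_prop), lintegral_posRpow_sub_mul_sq one_pos (by linarith),
    posRpow_of_pos _ one_pos, posRpow_of_pos _ one_pos, Real.one_rpow, Real.one_rpow,
    ENNReal.ofReal_one, one_mul, one_mul, Nat.cast_zero, zero_add,
    show K + r + s + 1 + 1 = K + r + s + 2 by ring]
  have h1 := beta_pos (show (0 : ℝ) < 1 / 2 by norm_num) (show (0 : ℝ) < K + 1 by linarith)
  have h2 := beta_pos (show (0 : ℝ) < s + 1 / 2 by linarith) (show (0 : ℝ) < K + 3 / 2 by linarith)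
  have h3 := beta_pos (show (0 : ℝ) < r + 1 / 2 by linarith) (show (0 : ℝ) < K + 3 / 2 by linarith)
  rw [← ENNReal.ofReal_mul (by positivity), ← ENNReal.ofReal_mul (by positivity),
    ← ENNReal.ofReal_mul (by positivity), contractionMoment]

lemma setIntegral_contractionMoment (K r s : ℕ) :
    IntegrableOn (fun t : Fin 4 → ℝ => defectDet t ^ K * (t 1 ^ (2 * r) * t 2 ^ (2 * s)))
      contractions ∧
    ∫ t in contractions, defectDet t ^ K * (t 1 ^ (2 * r) * t 2 ^ (2 * s)) =
      contractionMoment K r s := by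
  have hK : (-1 : ℝ) < K := by linarith [(K.cast_nonneg : (0 : ℝ) ≤ K)]
  refine integrable_and_integral_eq_of_lintegral (by fun_prop) ?_
    (contractionMoment_nonneg hK r s) ?_
  · filter_upwards [ae_restrict_mem measurableSet_contractions] with t ht
    have := ht.2.le
    simp only [pow_mul, Pi.zero_apply]
    positivity
  · rw [← lintegral_contractionMoment hK, ← lintegral_indicator measurableSet_contractions]
    refine lintegral_congr fun t => ?_
    by_cases ht : t ∈ contractions
    · rw [Set.indicator_of_mem ht, posRpow_zero_of_pos ht.1, posRpow_of_pos _ ht.2,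
        Real.rpow_natCast, ENNReal.ofReal_mul (pow_nonneg ht.2.le _), ENNReal.ofReal_mul
        (by simp only [pow_mul]; positivity)]
      ring
    · rw [Set.indicator_of_notMem ht]
      by_cases h : 0 < 1 - t 0 ^ 2 - t 1 ^ 2
      · rw [posRpow_of_nonpos (K : ℝ) (not_lt.1 fun h2 => ht ⟨h, h2⟩)]
        simp
      · rw [posRpow_of_nonpos 0 (not_lt.1 h)]
        simp

/-- The determinant of `E - Θ E Θᵀ` for `E = diag (a, b)` and `Θ = [[t 0, t 2], [t 1, t 3]]`. -/
def twistedDet (a b : ℝ) (t : Fin 4 → ℝ) : ℝ :=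
  a * b * defectDet t + (b - a) * (a * t 1 ^ 2 - b * t 2 ^ 2)

/-- Expanding both sums in `twistedDet` produces only even powers of the two off-diagonal entries of
Θ. -/
lemma setIntegral_defectDet_mul_twistedDet (k n : ℕ) (a b : ℝ) :
    ∫ t in contractions, defectDet t ^ k * twistedDet a b t ^ n =
      ∑ m ∈ Finset.range (n + 1), n.choose m * (a * b) ^ (n - m) * (b - a) ^ m *
        ∑ l ∈ Finset.range (m + 1), m.choose l * a ^ l * (-b) ^ (m - l) *
          contractionMoment ((k + (n - m) : ℕ) : ℝ) l (m - l) := by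
  have h : ∀ t : Fin 4 → ℝ, defectDet t ^ k * twistedDet a b t ^ n =
      ∑ m ∈ Finset.range (n + 1), ∑ l ∈ Finset.range (m + 1),
        (n.choose m * (a * b) ^ (n - m) * (b - a) ^ m * (m.choose l * a ^ l * (-b) ^ (m - l))) *
        (defectDet t ^ (k + (n - m)) * (t 1 ^ (2 * l) * t 2 ^ (2 * (m - l)))) := by
    intro t
    rw [twistedDet, add_comm, add_pow, Finset.mul_sum]
    refine Finset.sum_congr rfl fun m _ => ?_
    rw [mul_pow (b - a), sub_eq_add_neg (a * t 1 ^ 2), ← neg_mul, add_pow, Finset.mul_sum,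
      Finset.sum_mul, Finset.sum_mul, Finset.mul_sum]
    refine Finset.sum_congr rfl fun l _ => ?_
    rw [mul_pow, mul_pow, mul_pow (a * b), pow_add, ← pow_mul, ← pow_mul]
    ring
  simp_rw [h]
  rw [integral_finsetSum _ fun m _ => integrable_finsetSum _ fun l _ =>
    (setIntegral_contractionMoment _ _ _).1.const_mul _]
  refine Finset.sum_congr rfl fun m _ => ?_
  rw [integral_finsetSum _ fun l _ => (setIntegral_contractionMoment _ _ _).1.const_mul _,
    Finset.mul_sum]
  refine Finset.sum_congr rfl fun l _ => ?_
  rw [integral_const_mul, (setIntegral_contractionMoment _ _ _).2]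
  ring

/-! ### Hypergeometric summations -/

lemma pochhammer_zero (x : ℝ) : pochhammer x 0 = 1 := by simp [pochhammer]

lemma pochhammer_succ (x : ℝ) (m : ℕ) : pochhammer x (m + 1) = pochhammer x m * (x + m) := by
  simp [pochhammer, ascPochhammer_succ_eval]

lemma pochhammer_succ_left (x : ℝ) (m : ℕ) :
    pochhammer x (m + 1) = x * pochhammer (x + 1) m := by
  simp [pochhammer, ascPochhammer_succ_left, Polynomial.eval_comp]

lemma pochhammer_pos {x : ℝ} (hx : 0 < x) (m : ℕ) : 0 < pochhammer x m :=
  ascPochhammer_pos m x hx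

lemma Gamma_add_natCast {x : ℝ} (hx : 0 < x) (m : ℕ) :
    Real.Gamma (x + m) = Real.Gamma x * pochhammer x m := by
  induction m with
  | zero => simp [pochhammer_zero]
  | succ m ih =>
    have : (0 : ℝ) < x + m := by positivity
    rw [Nat.cast_succ, ← add_assoc, Real.Gamma_add_one this.ne', ih, pochhammer_succ]
    ring

/-- The Pfaff–Saalschütz summation in division-free form. -/
lemma sum_saalschutz {c : ℝ} (hc : 0 < c) (e : ℝ) (p q : ℕ) :
    ∑ i ∈ Finset.range (p + 1), (-1) ^ i * (p.choose i * q.choose i * i.factorial) *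
        pochhammer e (p + q - i) * (pochhammer (c - e) i / pochhammer c i) =
      pochhammer e p * pochhammer e q * (pochhammer c (p + q) / (pochhammer c p * pochhammer c q)) := by
  induction q with
  | zero =>
    rw [Finset.sum_range_succ', Finset.sum_eq_zero]
    · have := (pochhammer_pos hc p).ne'
      simp [pochhammer_zero, this]
    · intro i _
      simp
  | succ q ih =>
    -- Zeilberger's certificate: (c+q) times the summand for q+1, minus (e+q)(c+p+q) times the
    -- summand for q, is the difference G(i+1) - G(i). The boundary terms vanish through the factor
    -- i at 0 and through the binomial coefficient of p at p + 1.
    let G : ℕ → ℝ := fun i => -((c + i - 1) * p.choose i * (i * (q + 1).choose i / (q + 1)) *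
      (-1) ^ i * i.factorial * pochhammer e (p + q + 1 - i) *
        (pochhammer (c - e) i / pochhammer c i))
    have hq : (0 : ℝ) < q + 1 := by positivity
    have key : ∀ i ∈ Finset.range (p + 1),
        (c + q) * ((-1) ^ i * (p.choose i * (q + 1).choose i * i.factorial) *
          pochhammer e (p + (q + 1) - i) * (pochhammer (c - e) i / pochhammer c i)) -
        (e + q) * (c + p + q) * ((-1) ^ i * (p.choose i * q.choose i * i.factorial) *
          pochhammer e (p + q - i) * (pochhammer (c - e) i / pochhammer c i)) =
        G (i + 1) - G i := by
      intro i hi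
      have hip : i ≤ p := Nat.lt_succ_iff.1 (Finset.mem_range.1 hi)
      have h1 : p + q + 1 - i = (p + q - i) + 1 := by omega
      have h2 : p + q + 1 - (i + 1) = p + q - i := by omega
      have hci := (pochhammer_pos hc i).ne'
      have hci2 : c + i ≠ 0 := by positivity
      have c1 : ((i : ℝ) + 1) * (q + 1).choose (i + 1) = (q + 1) * q.choose i := by
        have := Nat.add_one_mul_choose_eq q i
        rw [mul_comm ((q + 1).choose (i + 1))] at this
        exact_mod_cast this.symm
      have c2 : ((i : ℝ) + 1) * p.choose (i + 1) = (p - i) * p.choose i := by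
        have := Nat.choose_succ_right_eq p i
        rw [mul_comm, mul_comm (p.choose i)] at this
        rw [← Nat.cast_sub hip]
        exact_mod_cast this
      have c3 : ((q : ℝ) + 1) * q.choose i = (q + 1 - i) * (q + 1).choose i := by
        rcases le_or_gt i (q + 1) with h | h
        · have := Nat.add_one_mul_choose_eq q i
          have e1 := Nat.choose_succ_right_eq (q + 1) i
          have e2 : ((q + 1).choose (i + 1) * (i + 1) : ℝ) =
              (q + 1).choose i * ((q + 1 : ℕ) - i : ℝ) := by
            rw [← Nat.cast_sub h]
            exact_mod_cast e1
          push_cast at e2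
          linarith
        · rw [Nat.choose_eq_zero_of_lt h, Nat.choose_eq_zero_of_lt (by omega : q < i)]
          simp
      have c4 : (q.choose i : ℝ) = (q + 1 - i) * (q + 1).choose i / (q + 1) := by
        rw [← c3]
        field_simp
      simp only [G]
      rw [← add_assoc p q 1, h2, h1, pochhammer_succ e, pochhammer_succ (c - e), pochhammer_succ c,
        Nat.cast_sub (by omega : i ≤ p + q), Nat.factorial_succ, pow_succ]
      push_cast
      rw [show (c + (i + 1) - 1 : ℝ) = c + i by ring, c1]
      have e5 : -((c + i) * (p.choose (i + 1) : ℝ) * ((q + 1) * q.choose i / (q + 1)) *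
          ((-1) ^ i * -1) * ((i + 1) * i.factorial) * pochhammer e (p + q - i) *
          (pochhammer (c - e) i * (c - e + i) / (pochhammer c i * (c + i)))) =
          ((i + 1) * p.choose (i + 1) : ℝ) * q.choose i * (-1) ^ i * i.factorial *
          pochhammer e (p + q - i) * (pochhammer (c - e) i / pochhammer c i) * (c - e + i) := by
        field_simp
      rw [e5, c2, c4]
      field_simp
      ring
    have hsum := Finset.sum_congr rfl key
    rw [Finset.sum_sub_distrib, ← Finset.mul_sum, ← Finset.mul_sum, ih, Finset.sum_range_sub] at hsum
    have hG0 : G 0 = 0 := by simp [G]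
    have hGp : G (p + 1) = 0 := by simp [G]
    rw [hG0, hGp, sub_zero, sub_eq_zero] at hsum
    have hcq : (0 : ℝ) < c + q := by positivity
    have h1 := (pochhammer_pos hc p).ne'
    have h2 := (pochhammer_pos hc q).ne'
    refine mul_left_cancel₀ hcq.ne' (hsum.trans ?_)
    rw [← add_assoc, pochhammer_succ c, pochhammer_succ c, pochhammer_succ e]
    push_cast
    field_simp
    ring

/-- Chu–Vandermonde: the coefficient of z^N in (1-z)^j (1-z)^(-x) = (1-z)^(-(x-j)). The induction on
j is Pascal's rule, that is, multiplication by one factor 1 - z. -/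
lemma sum_neg_one_pow_mul_pochhammer (x : ℝ) (j N : ℕ) :
    ∑ i ∈ Finset.range (N + 1), (-1) ^ i * (j.choose i : ℝ) *
        (pochhammer x (N - i) / (N - i).factorial) = pochhammer (x - j) N / N.factorial := by
  induction j generalizing N with
  | zero =>
    rw [Finset.sum_range_succ', Finset.sum_eq_zero]
    · simp
    · intro i _
      simp
  | succ j ih =>
    cases N with
    | zero => simp [pochhammer_zero]
    | succ N =>
      have h1 := ih (N + 1)
      have h2 := ih N
      rw [Finset.sum_range_succ'] at h1 ⊢
      simp only [Nat.add_sub_add_right, Nat.choose_succ_succ, Nat.cast_add, pow_succ] at h1 ⊢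
      have h3 : ∑ i ∈ Finset.range (N + 1), (-1 : ℝ) ^ i * -1 *
            ((j.choose i : ℝ) + j.choose (i + 1)) * (pochhammer x (N - i) / (N - i).factorial) =
          -(∑ i ∈ Finset.range (N + 1), (-1 : ℝ) ^ i * (j.choose i : ℝ) *
            (pochhammer x (N - i) / (N - i).factorial)) +
          ∑ i ∈ Finset.range (N + 1), (-1 : ℝ) ^ i * -1 * (j.choose (i + 1) : ℝ) *
            (pochhammer x (N - i) / (N - i).factorial) := by
        rw [← Finset.sum_neg_distrib, ← Finset.sum_add_distrib]
        exact Finset.sum_congr rfl fun i _ => by ring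
      rw [h3, h2]
      have h4 : pochhammer (x - ((j : ℝ) + (1 : ℕ))) (N + 1) / (N + 1).factorial =
          pochhammer (x - j) (N + 1) / (N + 1).factorial - pochhammer (x - j) N / N.factorial := by
        rw [pochhammer_succ_left, pochhammer_succ, Nat.factorial_succ]
        push_cast
        have := (Nat.cast_pos (α := ℝ)).2 N.factorial_pos
        rw [show x - (j + 1) + 1 = x - j by ring]
        field_simp
        ring
      rw [h4, ← h1]
      simp only [Nat.choose_zero_right]
      ring

/-- Reindexing by l = i + r and m - l = i + s, so that r + s = m - 2i. -/
lemma sum_range_pair_flip (m : ℕ) (T : ℕ → ℕ → ℕ → ℝ) :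
    ∑ l ∈ Finset.range (m + 1), ∑ i ∈ Finset.range (l + 1),
        (if i ≤ m - l then T i (l - i) (m - l - i) else 0) =
      ∑ i ∈ Finset.range (m + 1), if 2 * i ≤ m then
        ∑ r ∈ Finset.range (m - 2 * i + 1), T i r (m - 2 * i - r) else 0 := by
  rw [Finset.sum_comm' (t' := Finset.range (m + 1)) (s' := fun i => Finset.Ico i (m + 1))
    (by intro x y; simp only [Finset.mem_range, Finset.mem_Ico]; omega)]
  refine Finset.sum_congr rfl fun i hi => ?_
  have hi' : i ≤ m := Nat.lt_succ_iff.1 (Finset.mem_range.1 hi)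
  rw [Finset.sum_Ico_eq_sum_range]
  split_ifs with h
  · symm
    refine (Finset.sum_congr rfl fun r hr => ?_).trans
      (Finset.sum_subset (s₁ := Finset.range (m - 2 * i + 1)) (fun r => ?_) fun r hr hr2 => ?_)
    · have : r < m - 2 * i + 1 := Finset.mem_range.1 hr
      rw [if_pos (by omega)]
      congr 1 <;> omega
    · simp only [Finset.mem_range]
      omega
    · simp only [Finset.mem_range] at hr hr2
      rw [if_neg (by omega)]
  · refine Finset.sum_eq_zero fun r hr => ?_
    rw [if_neg (by omega)]

/-- Saalschütz with (p, q) = (l, m-l) expands each Pochhammer quotient. For a fixed Saalschütz index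
i the sum over l is then the binomial expansion of (a-b)^(m-2i), and the sign (-1)^i turns a^i
(-b)^i into (ab)^i. -/
lemma sum_choose_mul_pochhammer {c : ℝ} (hc : 0 < c) (e a b : ℝ) (m : ℕ) :
    ∑ l ∈ Finset.range (m + 1), m.choose l * a ^ l * (-b) ^ (m - l) *
        (pochhammer e l * pochhammer e (m - l) / (pochhammer c l * pochhammer c (m - l))) =
      (∑ i ∈ Finset.range (m + 1), if 2 * i ≤ m then
        (m.factorial / (i.factorial * (m - 2 * i).factorial) * pochhammer e (m - i) *
          (pochhammer (c - e) i / pochhammer c i)) * (a * b) ^ i * (a - b) ^ (m - 2 * i) else 0) /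
        pochhammer c m := by
  have hcm := (pochhammer_pos hc m).ne'
  rw [eq_div_iff hcm, Finset.sum_mul]
  let T : ℕ → ℕ → ℕ → ℝ := fun i r s =>
    m.factorial / (i.factorial * r.factorial * s.factorial) * pochhammer e (m - i) *
      (pochhammer (c - e) i / pochhammer c i) * (a * b) ^ i * a ^ r * (-b) ^ s
  trans ∑ l ∈ Finset.range (m + 1), ∑ i ∈ Finset.range (l + 1),
        (if i ≤ m - l then T i (l - i) (m - l - i) else 0)
  · refine Finset.sum_congr rfl fun l hl => ?_
    have hl' : l ≤ m := Nat.lt_succ_iff.1 (Finset.mem_range.1 hl)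
    have hs := sum_saalschutz hc e l (m - l)
    rw [Nat.add_sub_cancel' hl'] at hs
    have h1 : pochhammer e l * pochhammer e (m - l) / (pochhammer c l * pochhammer c (m - l)) *
        pochhammer c m = pochhammer e l * pochhammer e (m - l) *
        (pochhammer c m / (pochhammer c l * pochhammer c (m - l))) := by ring
    rw [mul_assoc, h1, ← hs, Finset.mul_sum]
    refine Finset.sum_congr rfl fun i hi => ?_
    have hi' : i ≤ l := Nat.lt_succ_iff.1 (Finset.mem_range.1 hi)
    split_ifs with h
    · have e1 : a ^ l = a ^ i * a ^ (l - i) := by rw [← pow_add, Nat.add_sub_cancel' hi']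
      have e2 : (-b) ^ (m - l) = (-b) ^ i * (-b) ^ (m - l - i) := by
        rw [← pow_add, Nat.add_sub_cancel' h]
      have e3 : (-1 : ℝ) ^ i * (-b) ^ i = b ^ i := by
        rw [← mul_pow]
        simp
      simp only [T]
      rw [Nat.cast_choose ℝ hl', Nat.cast_choose ℝ hi', Nat.cast_choose ℝ h, e1, e2, mul_pow, ← e3]
      have f1 := (Nat.cast_pos (α := ℝ)).2 l.factorial_pos
      have f2 := (Nat.cast_pos (α := ℝ)).2 (m - l).factorial_pos
      have f3 := (Nat.cast_pos (α := ℝ)).2 i.factorial_pos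
      field_simp
    · rw [Nat.choose_eq_zero_of_lt (not_le.1 h)]
      simp
  · rw [sum_range_pair_flip]
    refine Finset.sum_congr rfl fun i _ => ?_
    split_ifs with h
    · rw [sub_eq_add_neg a b, add_pow, Finset.mul_sum]
      refine Finset.sum_congr rfl fun r hr => ?_
      have hr' : r ≤ m - 2 * i := Nat.lt_succ_iff.1 (Finset.mem_range.1 hr)
      simp only [T]
      rw [Nat.cast_choose ℝ hr']
      have f1 := (Nat.cast_pos (α := ℝ)).2 (m - 2 * i).factorial_pos
      field_simp
    · rfl

/-- The Gamma prefactor depends on r and s only through r + s, hence is constant along each sum with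
r + s = m. The rest has the shape of the preceding summation with e = 1/2 and c = K + 2. -/
lemma contractionMoment_eq {K : ℝ} (hK : -1 < K) (r s : ℕ) :
    contractionMoment K r s =
      Real.pi ^ 2 * Real.Gamma (K + 1) * Real.Gamma (K + 3 / 2) * Real.Gamma (K + r + s + 2) /
        (Real.Gamma (K + r + s + 5 / 2) * Real.Gamma (K + 2) ^ 2) *
      (pochhammer (1 / 2) r * pochhammer (1 / 2) s /
        (pochhammer (K + 2) r * pochhammer (K + 2) s)) := by
  have hr : (0 : ℝ) ≤ r := r.cast_nonneg
  have hs : (0 : ℝ) ≤ s := s.cast_nonneg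
  have g1 := Real.Gamma_pos_of_pos (show (0 : ℝ) < K + 3 / 2 by linarith)
  have g2 := Real.Gamma_pos_of_pos (show (0 : ℝ) < K + 2 by linarith)
  have g3 := Real.Gamma_pos_of_pos (show (0 : ℝ) < K + r + s + 5 / 2 by linarith)
  have p1 := pochhammer_pos (show (0 : ℝ) < K + 2 by linarith) r
  have p2 := pochhammer_pos (show (0 : ℝ) < K + 2 by linarith) s
  have hpi : √Real.pi ^ 4 = Real.pi ^ 2 := by
    rw [show 4 = 2 * 2 by rfl, pow_mul, Real.sq_sqrt Real.pi_pos.le]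
  simp only [contractionMoment, beta]
  rw [show (s : ℝ) + 1 / 2 + (K + 3 / 2) = K + 2 + s by ring,
    show (r : ℝ) + 1 / 2 + (K + 3 / 2) = K + 2 + r by ring,
    show 1 / 2 + (K + 1) = K + 3 / 2 by ring,
    show 1 / 2 + (K + r + s + 2) = K + r + s + 5 / 2 by ring,
    add_comm (s : ℝ) (1 / 2), add_comm (r : ℝ) (1 / 2),
    Gamma_add_natCast (show (0 : ℝ) < 1 / 2 by norm_num) s,
    Gamma_add_natCast (show (0 : ℝ) < 1 / 2 by norm_num) r,
    Gamma_add_natCast (show (0 : ℝ) < K + 2 by linarith) s,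
    Gamma_add_natCast (show (0 : ℝ) < K + 2 by linarith) r, Real.Gamma_one_half_eq, ← hpi]
  field_simp

/-- Chu–Vandermonde at x = k + 1; this is the sum over the Saalschütz index that remains once the
exponent of (a-b)² is fixed. -/
lemma sum_factorial_mul_pochhammer (k n j : ℕ) (hj : j ≤ n) :
    ∑ i ∈ Finset.range (n - j + 1), (if i ≤ j then
      (-1 : ℝ) ^ i * (n.factorial / ((n - j - i).factorial * i.factorial * (j - i).factorial)) *
        (k + (n - j - i)).factorial else 0) =
      n.choose j * k.factorial * pochhammer (k - j + 1) (n - j) := by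
  have h := sum_neg_one_pow_mul_pochhammer (k + 1) j (n - j)
  rw [show (k : ℝ) + 1 - j = k - j + 1 by ring] at h
  have hN := (Nat.cast_pos (α := ℝ)).2 (n - j).factorial_pos
  have hJ := (Nat.cast_pos (α := ℝ)).2 j.factorial_pos
  have h2 : pochhammer (k - j + 1 : ℝ) (n - j) = (n - j).factorial *
      (pochhammer (k - j + 1 : ℝ) (n - j) / (n - j).factorial) := by
    field_simp
  rw [h2, ← h, Finset.mul_sum, Finset.mul_sum]
  refine Finset.sum_congr rfl fun i hi => ?_
  split_ifs with hij
  · have hk : ((k + (n - j - i)).factorial : ℝ) =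
        k.factorial * pochhammer (k + 1 : ℝ) (n - j - i) := by
      have := Gamma_add_natCast (show (0 : ℝ) < k + 1 by positivity) (n - j - i)
      rw [Real.Gamma_nat_eq_factorial, show (k : ℝ) + 1 + (n - j - i : ℕ) =
        ((k + (n - j - i) : ℕ) : ℝ) + 1 by push_cast; ring, Real.Gamma_nat_eq_factorial] at this
      exact this
    rw [hk, Nat.cast_choose ℝ hj, Nat.cast_choose ℝ hij]
    field_simp
  · rw [Nat.choose_eq_zero_of_lt (not_le.1 hij)]
    simp

lemma sum_contractionMoment (k m n : ℕ) (hm : m ≤ n) (a b : ℝ) :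
    ∑ l ∈ Finset.range (m + 1), m.choose l * a ^ l * (-b) ^ (m - l) *
        contractionMoment ((k + (n - m) : ℕ) : ℝ) l (m - l) =
      Real.pi ^ 2 / Real.Gamma (k + n + 5 / 2) *
      ∑ i ∈ Finset.range (m + 1), if 2 * i ≤ m then
        (k + (n - m)).factorial * m.factorial / (i.factorial * (m - 2 * i).factorial) *
          pochhammer (1 / 2) (m - i) *
          (Real.Gamma (k + (n - m + i : ℕ) + 3 / 2) / Real.Gamma (k + (n - m + i : ℕ) + 2)) *
          (a * b) ^ i * (a - b) ^ (m - 2 * i) else 0 := by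
  set K : ℝ := ((k + (n - m) : ℕ) : ℝ) with hK
  have hK0 : (0 : ℝ) ≤ K := Nat.cast_nonneg _
  have hKm : K + m = k + n := by
    rw [hK, Nat.cast_add, Nat.cast_sub hm]
    ring
  have h2 : 0 < K + 2 := by linarith
  have g2 := Real.Gamma_pos_of_pos h2
  have g3 := Real.Gamma_pos_of_pos (show (0 : ℝ) < k + n + 5 / 2 by positivity)
  have g4 := Gamma_add_natCast h2 m
  have pm := pochhammer_pos h2 m
  have h1 : ∀ l ∈ Finset.range (m + 1), m.choose l * a ^ l * (-b) ^ (m - l) *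
        contractionMoment K l (m - l) =
      Real.pi ^ 2 * Real.Gamma (K + 1) * Real.Gamma (K + 3 / 2) * pochhammer (K + 2) m /
        (Real.Gamma (k + n + 5 / 2) * Real.Gamma (K + 2)) *
      (m.choose l * a ^ l * (-b) ^ (m - l) * (pochhammer (1 / 2) l * pochhammer (1 / 2) (m - l) /
        (pochhammer (K + 2) l * pochhammer (K + 2) (m - l)))) := by
    intro l hl
    have hl' : l ≤ m := Nat.lt_succ_iff.1 (Finset.mem_range.1 hl)
    have e : K + l + (m - l : ℕ) = k + n := by
      rw [Nat.cast_sub hl', ← hKm]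
      ring
    rw [contractionMoment_eq (by linarith), e, ← hKm, show K + m + 2 = K + 2 + m by ring, g4, hKm]
    field_simp
  rw [Finset.sum_congr rfl h1, ← Finset.mul_sum, sum_choose_mul_pochhammer h2, ← mul_div_assoc,
    Finset.mul_sum, Finset.sum_div, Finset.mul_sum]
  refine Finset.sum_congr rfl fun i _ => ?_
  split_ifs with h
  · have hi : ((n - m + i : ℕ) : ℝ) + k = K + i := by
      rw [hK]
      push_cast
      ring
    have e1 := Gamma_add_natCast (show (0 : ℝ) < K + 3 / 2 by linarith) i
    have e2 := Gamma_add_natCast h2 i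
    have pi2 := pochhammer_pos h2 i
    rw [add_comm (k : ℝ) (n - m + i : ℕ), hi, show K + i + 3 / 2 = K + 3 / 2 + i by ring, e1,
      show K + i + 2 = K + 2 + i by ring, e2, show K + 2 - 1 / 2 = K + 3 / 2 by ring,
      show Real.Gamma (K + 1) = (k + (n - m)).factorial from Real.Gamma_nat_eq_factorial _]
    field_simp
  · simp

/-- The decisive index is j = m - i: the outer factor (b-a)^m joins (a-b)^(m-2i) to give (a-b)^(2j),
the power of ab is n - j, and the Gamma quotient depends only on j. The sum over i is then evaluated
separately. -/
lemma setIntegral_defectDet_mul_twistedDet_eq (k n : ℕ) (a b : ℝ) :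
    ∫ t in contractions, defectDet t ^ k * twistedDet a b t ^ n =
      Real.pi ^ 2 * k.factorial / Real.Gamma (k + n + 5 / 2) *
      ∑ j ∈ Finset.range (n + 1), n.choose j * pochhammer (1 / 2) j * (-1) ^ j *
        pochhammer (k - j + 1) (n - j) *
        (Real.Gamma (k + (n - j : ℕ) + 3 / 2) / Real.Gamma (k + (n - j : ℕ) + 2)) *
        (a * b) ^ (n - j) * (a - b) ^ (2 * j) := by
  rw [setIntegral_defectDet_mul_twistedDet]
  let U : ℕ → ℕ → ℝ := fun i j => (if i ≤ j then
      (-1 : ℝ) ^ i * (n.factorial / ((n - j - i).factorial * i.factorial * (j - i).factorial)) *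
        (k + (n - j - i)).factorial else 0) *
      (pochhammer (1 / 2) j * (-1) ^ j *
        (Real.Gamma (k + (n - j : ℕ) + 3 / 2) / Real.Gamma (k + (n - j : ℕ) + 2)) *
        (a * b) ^ (n - j) * (a - b) ^ (2 * j))
  have h1 : ∀ m ∈ Finset.range (n + 1), n.choose m * (a * b) ^ (n - m) * (b - a) ^ m *
        ∑ l ∈ Finset.range (m + 1), m.choose l * a ^ l * (-b) ^ (m - l) *
          contractionMoment ((k + (n - m) : ℕ) : ℝ) l (m - l) =
      Real.pi ^ 2 / Real.Gamma (k + n + 5 / 2) * ∑ i ∈ Finset.range (m + 1), U i (m - i) := by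
    intro m hm
    have hm' : m ≤ n := Nat.lt_succ_iff.1 (Finset.mem_range.1 hm)
    rw [sum_contractionMoment k m n hm', mul_left_comm, Finset.mul_sum]
    congr 1
    refine Finset.sum_congr rfl fun i hi => ?_
    have hi' : i ≤ m := Nat.lt_succ_iff.1 (Finset.mem_range.1 hi)
    simp only [U]
    by_cases h : 2 * i ≤ m
    · rw [if_pos h, if_pos (by omega : i ≤ m - i), Nat.cast_choose ℝ hm',
        show n - (m - i) - i = n - m by omega, show n - (m - i) = n - m + i by omega,
        show m - i - i = m - 2 * i by omega, pow_add,
        show 2 * (m - i) = m + (m - 2 * i) by omega, pow_add (a - b),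
        show (b - a) = -1 * (a - b) by ring, mul_pow (-1 : ℝ)]
      have hs : (-1 : ℝ) ^ m = (-1) ^ i * (-1) ^ (m - i) := by
        rw [← pow_add, Nat.add_sub_cancel' hi']
      rw [hs]
      have f1 := (Nat.cast_pos (α := ℝ)).2 m.factorial_pos
      field_simp
    · rw [if_neg h, if_neg (by omega)]
      simp
  rw [Finset.sum_congr rfl h1, ← Finset.mul_sum, Finset.sum_range_diag_flip,
    Finset.sum_comm' (t' := Finset.range (n + 1)) (s' := fun j => Finset.range (n - j + 1))
    (by intro x y; simp only [Finset.mem_range]; omega), mul_div_right_comm, mul_assoc]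
  congr 1
  rw [Finset.mul_sum]
  refine Finset.sum_congr rfl fun j hj => ?_
  have hj' : j ≤ n := Nat.lt_succ_iff.1 (Finset.mem_range.1 hj)
  simp only [U]
  rw [← Finset.sum_mul, sum_factorial_mul_pochhammer k n j hj']
  ring

/-! ### Symmetric `4 × 4` matrices in coordinates -/

/-- Coordinates of a symmetric `4 × 4` matrix: the two symmetric diagonal blocks, and the
off-diagonal block `[[t 0, t 2], [t 1, t 3]]`. -/
abbrev BlockCoord : Type := ((Fin 3 → ℝ) × (Fin 3 → ℝ)) × (Fin 4 → ℝ)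

/-- The symmetric matrix `[[v 0, v 1], [v 1, v 2]]`. -/
def symMat (v : Fin 3 → ℝ) : Matrix (Fin 2) (Fin 2) ℝ := !![v 0, v 1; v 1, v 2]

/-- The matrix `[[t 0, t 2], [t 1, t 3]]`. -/
def offMat (t : Fin 4 → ℝ) : Matrix (Fin 2) (Fin 2) ℝ := !![t 0, t 2; t 1, t 3]

/-- The symmetric matrix with given coordinates. -/
def blockMatrix (e : BlockCoord) : RebitMatrix :=
  Matrix.of fun i j =>
    if i.1 = 0 then (if j.1 = 0 then symMat e.1.1 i.2 j.2 else offMat e.2 i.2 j.2)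
    else (if j.1 = 0 then offMat e.2 j.2 i.2 else symMat e.1.2 i.2 j.2)

lemma det_rebitMatrix (ρ : RebitMatrix) : ρ.det = Matrix.det
    !![ρ (0, 0) (0, 0), ρ (0, 0) (0, 1), ρ (0, 0) (1, 0), ρ (0, 0) (1, 1);
      ρ (0, 1) (0, 0), ρ (0, 1) (0, 1), ρ (0, 1) (1, 0), ρ (0, 1) (1, 1);
      ρ (1, 0) (0, 0), ρ (1, 0) (0, 1), ρ (1, 0) (1, 0), ρ (1, 0) (1, 1);
      ρ (1, 1) (0, 0), ρ (1, 1) (0, 1), ρ (1, 1) (1, 0), ρ (1, 1) (1, 1)] := by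
  rw [← Matrix.det_submatrix_equiv_self (finProdFinEquiv (m := 2) (n := 2)).symm ρ]
  congr 1
  ext i j
  fin_cases i <;> fin_cases j <;> rfl

/-- The determinant of a symmetric matrix in block coordinates. -/
def blockDet (v w : Fin 3 → ℝ) (t : Fin 4 → ℝ) : ℝ :=
  symDet v * symDet w + (t 0 * t 3 - t 1 * t 2) ^ 2 -
    (v 2 * (w 2 * t 0 ^ 2 - 2 * w 1 * t 0 * t 2 + w 0 * t 2 ^ 2) -
      2 * v 1 * (w 2 * t 0 * t 1 - w 1 * (t 0 * t 3 + t 1 * t 2) + w 0 * t 2 * t 3) +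
      v 0 * (w 2 * t 1 ^ 2 - 2 * w 1 * t 1 * t 3 + w 0 * t 3 ^ 2))

lemma det_blockMatrix (e : BlockCoord) : (blockMatrix e).det = blockDet e.1.1 e.1.2 e.2 := by
  rw [det_rebitMatrix]
  simp [blockMatrix, symMat, offMat, Matrix.det_succ_row_zero, Fin.sum_univ_succ, Fin.succAbove,
    blockDet, symDet]
  ring

/-- The diagonal blocks are symmetric, so partial transposition only exchanges the two off-diagonal
entries of the upper right block. -/
lemma det_partialTranspose_blockMatrix (e : BlockCoord) :
    (partialTranspose (blockMatrix e)).det =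
      blockDet e.1.1 e.1.2 ![e.2 0, e.2 2, e.2 1, e.2 3] := by
  rw [← det_blockMatrix ((e.1.1, e.1.2), ![e.2 0, e.2 2, e.2 1, e.2 3])]
  congr 1
  ext ⟨i, i'⟩ ⟨j, j'⟩
  fin_cases i <;> fin_cases i' <;> fin_cases j <;> fin_cases j' <;>
    simp [partialTranspose, blockMatrix, symMat, offMat]

/-- The quadratic form of a symmetric matrix in block coordinates. -/
def blockForm (e : BlockCoord) (a b c d : ℝ) : ℝ :=
  (e.1.1 0 * a ^ 2 + 2 * e.1.1 1 * a * b + e.1.1 2 * b ^ 2) +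
    2 * (e.2 0 * a * c + e.2 2 * a * d + e.2 1 * b * c + e.2 3 * b * d) +
    (e.1.2 0 * c ^ 2 + 2 * e.1.2 1 * c * d + e.1.2 2 * d ^ 2)

lemma isHermitian_blockMatrix (e : BlockCoord) : (blockMatrix e).IsHermitian := by
  ext ⟨i, i'⟩ ⟨j, j'⟩
  fin_cases i <;> fin_cases i' <;> fin_cases j <;> fin_cases j' <;>
    simp [blockMatrix, symMat, offMat]

lemma dotProduct_blockMatrix_mulVec (e : BlockCoord) (x : RebitIndex → ℝ) :
    star x ⬝ᵥ (blockMatrix e).mulVec x =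
      blockForm e (x (0, 0)) (x (0, 1)) (x (1, 0)) (x (1, 1)) := by
  simp [dotProduct, Matrix.mulVec, Fintype.sum_prod_type, blockMatrix, symMat, offMat, blockForm]
  ring

lemma posDef_blockMatrix_iff (e : BlockCoord) : (blockMatrix e).PosDef ↔
    ∀ a b c d : ℝ, (a, b, c, d) ≠ (0, 0, 0, 0) → 0 < blockForm e a b c d := by
  rw [Matrix.posDef_iff_dotProduct_mulVec]
  constructor
  · rintro ⟨-, h⟩ a b c d hne
    have := h (x := fun i => ![![a, b], ![c, d]] i.1 i.2) (by
      intro h0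
      apply hne
      have h1 := congrFun h0 (0, 0)
      have h2 := congrFun h0 (0, 1)
      have h3 := congrFun h0 (1, 0)
      have h4 := congrFun h0 (1, 1)
      simp at h1 h2 h3 h4
      simp [h1, h2, h3, h4])
    rw [dotProduct_blockMatrix_mulVec] at this
    simpa using this
  · refine fun h => ⟨isHermitian_blockMatrix e, fun x hx => ?_⟩
    rw [dotProduct_blockMatrix_mulVec]
    refine h _ _ _ _ fun h0 => hx ?_
    simp only [Prod.mk.injEq] at h0
    ext ⟨i, i'⟩
    fin_cases i <;> fin_cases i' <;> simp [h0]

lemma symPos_of_form_pos {v : Fin 3 → ℝ}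
    (h : ∀ a b : ℝ, (a, b) ≠ (0, 0) → 0 < v 0 * a ^ 2 + 2 * v 1 * a * b + v 2 * b ^ 2) :
    SymPos v := by
  have h0 : 0 < v 0 := by simpa using h 1 0 (by simp)
  refine ⟨h0, ?_⟩
  -- The form takes the value v₀ |v| at this vector.
  have h1 := h (-v 1) (v 0) (by simp [h0.ne'])
  have h2 : v 0 * (-v 1) ^ 2 + 2 * v 1 * -v 1 * v 0 + v 2 * v 0 ^ 2 = v 0 * symDet v := by
    unfold symDet
    ring
  rw [h2] at h1
  exact (mul_pos_iff_of_pos_left h0).1 h1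

lemma symPos_of_posDef_blockMatrix {e : BlockCoord} (h : (blockMatrix e).PosDef) :
    SymPos e.1.1 ∧ SymPos e.1.2 := by
  rw [posDef_blockMatrix_iff] at h
  constructor
  · refine symPos_of_form_pos fun a b hab => ?_
    have := h a b 0 0 (by simpa using hab)
    simpa [blockForm] using this
  · refine symPos_of_form_pos fun c d hcd => ?_
    have := h 0 0 c d (by simpa using hcd)
    simpa [blockForm] using this

/-! ### Simultaneous diagonalization -/

/-- Conjugation by a rotation of angle θ multiplies z = (w₀ - w₂)/2 + i w₁ by exp(2iθ). Half the
argument of z therefore diagonalizes, with eigenvalues (w₀ + w₂)/2 ± |z|. -/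
lemma exists_rotation_diagonal (w : Fin 3 → ℝ) : ∃ c s a b : ℝ, c ^ 2 + s ^ 2 = 1 ∧
    w = ![a * c ^ 2 + b * s ^ 2, (a - b) * c * s, a * s ^ 2 + b * c ^ 2] := by
  let z : ℂ := ⟨(w 0 - w 2) / 2, w 1⟩
  set θ := z.arg / 2 with hθ
  have harg : z.arg = 2 * θ := by rw [hθ]; ring
  have h1 : ‖z‖ * Real.cos (2 * θ) = (w 0 - w 2) / 2 := by
    rw [← harg]
    exact Complex.norm_mul_cos_arg z
  have h2 : ‖z‖ * Real.sin (2 * θ) = w 1 := by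
    rw [← harg]
    exact Complex.norm_mul_sin_arg z
  have h3 := Real.cos_sq_add_sin_sq θ
  rw [Real.cos_two_mul] at h1
  rw [Real.sin_two_mul] at h2
  refine ⟨Real.cos θ, Real.sin θ, (w 0 + w 2) / 2 + ‖z‖, (w 0 + w 2) / 2 - ‖z‖, h3, ?_⟩
  ext i
  fin_cases i
  · simp
    linear_combination -h1 - ((w 0 + w 2) / 2 - ‖z‖) * h3
  · simp
    linear_combination -h2
  · simp
    linear_combination h1 - ((w 0 + w 2) / 2 + ‖z‖) * h3

lemma exists_simultaneous_diagonalization {v w : Fin 3 → ℝ} (hv : SymPos v) (hw : SymPos w) :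
    ∃ p q r s α β : ℝ, 0 < α ∧ 0 < β ∧ p * s - q * r ≠ 0 ∧
      v = ![p ^ 2 + q ^ 2, p * r + q * s, r ^ 2 + s ^ 2] ∧
      w = ![α ^ 2 * p ^ 2 + β ^ 2 * q ^ 2, α ^ 2 * p * r + β ^ 2 * q * s,
        α ^ 2 * r ^ 2 + β ^ 2 * s ^ 2] := by
  obtain ⟨a, b, c, rfl, hτ⟩ := exists_symm_sqrt hv
  have hdet : (symConj a b c).det ≠ 0 := by
    rw [det_symConj]
    positivity
  obtain ⟨u, hu⟩ : ∃ u, (symConj a b c).mulVec u = w :=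
    ⟨(symConj a b c)⁻¹.mulVec w, by
      rw [Matrix.mulVec_mulVec, Matrix.mul_nonsing_inv _ (isUnit_iff_ne_zero.2 hdet),
        Matrix.one_mulVec]⟩
  have hupos : SymPos u := by
    rw [← symPos_symConj_mulVec hτ, hu]
    exact hw
  obtain ⟨x, y, d₁, d₂, hxy, rfl⟩ := exists_rotation_diagonal u
  have hdd : 0 < d₁ * d₂ := by
    have h := hupos.2
    have e : symDet ![d₁ * x ^ 2 + d₂ * y ^ 2, (d₁ - d₂) * x * y, d₁ * y ^ 2 + d₂ * x ^ 2] =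
        d₁ * d₂ := by
      simp [symDet]
      linear_combination d₁ * d₂ * (x ^ 2 + y ^ 2 + 1) * hxy
    rwa [e] at h
  have hs : 0 < d₁ + d₂ := by
    have h := ((symPos_iff_add_pos _).1 hupos).1
    simp at h
    nlinarith
  have hd₁ : 0 < d₁ := by
    by_contra h
    have : 0 < d₂ := by linarith
    nlinarith
  have hd₂ : 0 < d₂ := by
    by_contra h
    nlinarith
  -- C = TR, where T = √v and the rotation R diagonalizes T⁻¹wT⁻¹.
  refine ⟨a * x + b * y, -a * y + b * x, b * x + c * y, -b * y + c * x, √d₁, √d₂,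
    Real.sqrt_pos.2 hd₁, Real.sqrt_pos.2 hd₂, ?_, ?_, ?_⟩
  · have : (a * x + b * y) * (-b * y + c * x) - (-a * y + b * x) * (b * x + c * y) =
        a * c - b ^ 2 := by
      linear_combination (a * c - b ^ 2) * hxy
    rw [this]
    exact hτ.ne'
  · ext i
    fin_cases i
    · simp
      linear_combination -(a ^ 2 + b ^ 2) * hxy
    · simp
      linear_combination -(a * b + b * c) * hxy
    · simp
      linear_combination -(b ^ 2 + c ^ 2) * hxy
  · rw [← hu, symConj_mulVec, Real.sq_sqrt hd₁.le, Real.sq_sqrt hd₂.le]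
    ext i
    fin_cases i <;> simp <;> ring

/-- The matrix of `Θ ↦ C Θ diag (α, β) Cᵀ` for `C = [[p, q], [r, s]]`. -/
def offSubst (p q r s α β : ℝ) : Matrix (Fin 4) (Fin 4) ℝ :=
  !![p * (α * p), q * (α * p), p * (β * q), q * (β * q);
    r * (α * p), s * (α * p), r * (β * q), s * (β * q);
    p * (α * r), q * (α * r), p * (β * s), q * (β * s);
    r * (α * r), s * (α * r), r * (β * s), s * (β * s)]

lemma det_offSubst (p q r s α β : ℝ) :
    (offSubst p q r s α β).det = (p * s - q * r) ^ 4 * (α * β) ^ 2 := by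
  simp [offSubst, Matrix.det_succ_row_zero, Fin.sum_univ_succ, Fin.succAbove]
  ring

lemma offSubst_mulVec (p q r s α β : ℝ) (t : Fin 4 → ℝ) : (offSubst p q r s α β).mulVec t =
    ![p * (α * p) * t 0 + q * (α * p) * t 1 + p * (β * q) * t 2 + q * (β * q) * t 3,
      r * (α * p) * t 0 + s * (α * p) * t 1 + r * (β * q) * t 2 + s * (β * q) * t 3,
      p * (α * r) * t 0 + q * (α * r) * t 1 + p * (β * s) * t 2 + q * (β * s) * t 3,
      r * (α * r) * t 0 + s * (α * r) * t 1 + r * (β * s) * t 2 + s * (β * s) * t 3] := by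
  ext i
  fin_cases i <;> simp [offSubst, Matrix.mulVec, dotProduct, Fin.sum_univ_four]

/-- The block matrix is the congruence of [[1, Θ], [Θᵀ, 1]] by diag(C, CD), with D = diag(α, β). -/
lemma blockDet_offSubst_mulVec (p q r s α β : ℝ) (t : Fin 4 → ℝ) :
    blockDet ![p ^ 2 + q ^ 2, p * r + q * s, r ^ 2 + s ^ 2]
      ![α ^ 2 * p ^ 2 + β ^ 2 * q ^ 2, α ^ 2 * p * r + β ^ 2 * q * s,
        α ^ 2 * r ^ 2 + β ^ 2 * s ^ 2] ((offSubst p q r s α β).mulVec t) =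
      (p * s - q * r) ^ 4 * (α ^ 2 * β ^ 2 * defectDet t) := by
  rw [offSubst_mulVec]
  simp [blockDet, symDet, defectDet]
  ring

/-- The transposed block is CDΘᵀCᵀ, so diag(C, C) factors out and leaves [[1, DΘᵀ], [ΘD, D²]], whose
Schur complement is D² - ΘD²Θᵀ. -/
lemma blockDet_offSubst_mulVec_transpose (p q r s α β : ℝ) (t u : Fin 4 → ℝ)
    (hu : u = (offSubst p q r s α β).mulVec t) :
    blockDet ![p ^ 2 + q ^ 2, p * r + q * s, r ^ 2 + s ^ 2]
      ![α ^ 2 * p ^ 2 + β ^ 2 * q ^ 2, α ^ 2 * p * r + β ^ 2 * q * s,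
        α ^ 2 * r ^ 2 + β ^ 2 * s ^ 2] ![u 0, u 2, u 1, u 3] =
      (p * s - q * r) ^ 4 * twistedDet (α ^ 2) (β ^ 2) t := by
  rw [hu, offSubst_mulVec]
  simp [blockDet, symDet, defectDet, twistedDet]
  ring

/-- With y = DCᵀ(c, d), this is the completed square |Cᵀ(a, b) + Θy|² + yᵀ(1 - ΘᵀΘ)y. -/
lemma blockForm_offSubst_mulVec (p q r s α β : ℝ) (t : Fin 4 → ℝ) (a b c d : ℝ) :
    blockForm ((![p ^ 2 + q ^ 2, p * r + q * s, r ^ 2 + s ^ 2],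
      ![α ^ 2 * p ^ 2 + β ^ 2 * q ^ 2, α ^ 2 * p * r + β ^ 2 * q * s,
        α ^ 2 * r ^ 2 + β ^ 2 * s ^ 2]), (offSubst p q r s α β).mulVec t) a b c d =
      (p * a + r * b + (t 0 * (α * (p * c + r * d)) + t 2 * (β * (q * c + s * d)))) ^ 2 +
      (q * a + s * b + (t 1 * (α * (p * c + r * d)) + t 3 * (β * (q * c + s * d)))) ^ 2 +
      ((1 - t 0 ^ 2 - t 1 ^ 2) * (α * (p * c + r * d)) ^ 2 +
        2 * -(t 0 * t 2 + t 1 * t 3) * (α * (p * c + r * d)) * (β * (q * c + s * d)) +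
        (1 - t 2 ^ 2 - t 3 ^ 2) * (β * (q * c + s * d)) ^ 2) := by
  rw [offSubst_mulVec]
  simp [blockForm]
  ring

lemma exists_linear_solution {p q r s : ℝ} (hδ : p * s - q * r ≠ 0) (x y : ℝ) :
    ∃ a b : ℝ, p * a + r * b = x ∧ q * a + s * b = y := by
  refine ⟨(s * x - r * y) / (p * s - q * r), (p * y - q * x) / (p * s - q * r), ?_, ?_⟩
  · rw [mul_div_assoc', mul_div_assoc', ← add_div, div_eq_iff hδ]
    ring
  · rw [mul_div_assoc', mul_div_assoc', ← add_div, div_eq_iff hδ]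
    ring

lemma eq_zero_of_linear_solution {p q r s : ℝ} (hδ : p * s - q * r ≠ 0) {a b : ℝ}
    (h1 : p * a + r * b = 0) (h2 : q * a + s * b = 0) : a = 0 ∧ b = 0 := by
  constructor
  · have : (p * s - q * r) * a = 0 := by linear_combination s * h1 - r * h2
    simpa [hδ] using this
  · have : (p * s - q * r) * b = 0 := by linear_combination p * h2 - q * h1
    simpa [hδ] using this

lemma SymPos.form_pos {v : Fin 3 → ℝ} (hv : SymPos v) {a b : ℝ} (hab : (a, b) ≠ (0, 0)) :
    0 < v 0 * a ^ 2 + 2 * v 1 * a * b + v 2 * b ^ 2 := by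
  refine (mul_pos_iff_of_pos_left hv.1).1 ?_
  have h1 : v 0 * (v 0 * a ^ 2 + 2 * v 1 * a * b + v 2 * b ^ 2) =
      (v 0 * a + v 1 * b) ^ 2 + symDet v * b ^ 2 := by
    unfold symDet
    ring
  have h0 := hv.1
  have hd := hv.2
  rw [h1]
  by_cases hb : b = 0
  · have ha : a ≠ 0 := fun ha => hab (by rw [ha, hb])
    rw [hb]
    have : v 0 * a + v 1 * 0 ≠ 0 := by simpa using ⟨h0.ne', ha⟩
    positivity
  · positivity

lemma posDef_blockMatrix_offSubst_iff {p q r s α β : ℝ} (hα : 0 < α) (hβ : 0 < β)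
    (hδ : p * s - q * r ≠ 0) (t : Fin 4 → ℝ) :
    (blockMatrix ((![p ^ 2 + q ^ 2, p * r + q * s, r ^ 2 + s ^ 2],
      ![α ^ 2 * p ^ 2 + β ^ 2 * q ^ 2, α ^ 2 * p * r + β ^ 2 * q * s,
        α ^ 2 * r ^ 2 + β ^ 2 * s ^ 2]), (offSubst p q r s α β).mulVec t)).PosDef ↔
      t ∈ contractions := by
  have hmem : t ∈ contractions ↔
      SymPos ![1 - t 0 ^ 2 - t 1 ^ 2, -(t 0 * t 2 + t 1 * t 3), 1 - t 2 ^ 2 - t 3 ^ 2] := by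
    simp only [contractions, SymPos, symDet, defectDet, Set.mem_ofPred_eq, Matrix.cons_val_zero,
      Matrix.cons_val_one, Matrix.cons_val, neg_sq]
  rw [posDef_blockMatrix_iff, hmem]
  simp_rw [blockForm_offSubst_mulVec]
  constructor
  · intro H
    refine symPos_of_form_pos fun x y hxy => ?_
    obtain ⟨c, d, h1, h2⟩ := exists_linear_solution hδ (x / α) (y / β)
    -- This choice makes both squares vanish, leaving the form of 1 - ΘᵀΘ at (x, y).
    obtain ⟨a, b, h3, h4⟩ := exists_linear_solution hδ (-(t 0 * x + t 2 * y)) (-(t 1 * x + t 3 * y))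
    have hx : α * (p * c + r * d) = x := by rw [h1, mul_div_cancel₀ _ hα.ne']
    have hy : β * (q * c + s * d) = y := by rw [h2, mul_div_cancel₀ _ hβ.ne']
    have h := H a b c d (by
      intro h0
      simp only [Prod.mk.injEq] at h0
      apply hxy
      rw [← hx, ← hy, h0.2.2.1, h0.2.2.2]
      simp)
    rw [hx, hy, h3, h4] at h
    simpa using h
  · intro ht a b c d hne
    by_cases hQ : (α * (p * c + r * d), β * (q * c + s * d)) = (0, 0)
    · simp only [Prod.mk.injEq] at hQ
      rw [hQ.1, hQ.2]
      obtain ⟨hc, hd⟩ := eq_zero_of_linear_solution hδ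
        ((mul_eq_zero_iff_left hα.ne').1 hQ.1) ((mul_eq_zero_iff_left hβ.ne').1 hQ.2)
      have hab : ¬ (p * a + r * b = 0 ∧ q * a + s * b = 0) := by
        rintro ⟨h1, h2⟩
        obtain ⟨ha, hb⟩ := eq_zero_of_linear_solution hδ h1 h2
        exact hne (by simp [ha, hb, hc, hd])
      have h : 0 < (p * a + r * b) ^ 2 + (q * a + s * b) ^ 2 := by
        rcases not_and_or.1 hab with h | h <;> positivity
      simpa using h
    · have h := ht.form_pos hQ
      simp only [Matrix.cons_val_zero, Matrix.cons_val_one, Matrix.cons_val] at h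
      positivity

lemma integral_comp_mulVec {ι : Type*} [Fintype ι] [DecidableEq ι] {M : Matrix ι ι ℝ}
    (hM : M.det ≠ 0) (f : (ι → ℝ) → ℝ) :
    ∫ v, f v = |M.det| * ∫ v, f (M.mulVec v) := by
  have h := Real.map_matrix_volume_pi_eq_smul_volume_pi hM
  have hemb : MeasurableEmbedding (Matrix.toLin' M) := by
    have := (LinearEquiv.ofIsUnitDet (f := Matrix.toLin' M) (v := Pi.basisFun ℝ ι)
      (v' := Pi.basisFun ℝ ι) (by
        rw [LinearMap.toMatrix_eq_toMatrix', LinearMap.toMatrix'_toLin']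
        exact isUnit_iff_ne_zero.2 hM)).toContinuousLinearEquiv.toHomeomorph.measurableEmbedding
    exact this
  have h2 : ∫ v, f (M.mulVec v) = |(M.det)⁻¹| * ∫ v, f v := by
    have h3 := hemb.integral_map (μ := volume) f
    rw [h, integral_smul_measure, ENNReal.toReal_ofReal (abs_nonneg _)] at h3
    exact h3.symm
  rw [h2, ← mul_assoc, ← abs_mul, mul_inv_cancel₀ hM]
  simp

/-- The coefficients of the conditional moment of the determinants given the diagonal blocks. -/
noncomputable def blockCoeff (k n j : ℕ) : ℝ :=
  Real.pi ^ 2 * k.factorial / Real.Gamma (k + n + 5 / 2) *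
    (n.choose j * pochhammer (1 / 2) j * (-1) ^ j * pochhammer (k - j + 1) (n - j) *
      (Real.Gamma (k + (n - j : ℕ) + 3 / 2) / Real.Gamma (k + (n - j : ℕ) + 2)))

-- Here |v| = δ², |w| = δ²α²β² and disc(v, w) = δ⁴(α² - β²)² with δ = det C, so the diagonalizing
-- data disappear from the answer. The Jacobian δ⁴(αβ)² is |v||w|, which accounts for the extra 1 in
-- the exponents.
open Classical in
lemma integral_offDiagonal (k n : ℕ) {v w : Fin 3 → ℝ} (hv : SymPos v) (hw : SymPos w) :
    ∫ t : Fin 4 → ℝ, (if (blockMatrix ((v, w), t)).PosDef then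
        blockDet v w t ^ k * blockDet v w ![t 0, t 2, t 1, t 3] ^ n else 0) =
      ∑ j ∈ Finset.range (n + 1), blockCoeff k n j *
        (symDet v ^ (k + (n - j) + 1) * symDet w ^ (k + (n - j) + 1) * symDisc v w ^ j) := by
  obtain ⟨p, q, r, s, α, β, hα, hβ, hδ, rfl, rfl⟩ := exists_simultaneous_diagonalization hv hw
  have hdet : (offSubst p q r s α β).det = (p * s - q * r) ^ 4 * (α * β) ^ 2 := det_offSubst ..
  have hpos : 0 < (p * s - q * r) ^ 4 * (α * β) ^ 2 := by positivity
  rw [integral_comp_mulVec (M := offSubst p q r s α β) (by rw [hdet]; exact hpos.ne'), hdet,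
    abs_of_pos hpos]
  have h1 : ∀ t : Fin 4 → ℝ, (if (blockMatrix ((![p ^ 2 + q ^ 2, p * r + q * s, r ^ 2 + s ^ 2],
      ![α ^ 2 * p ^ 2 + β ^ 2 * q ^ 2, α ^ 2 * p * r + β ^ 2 * q * s,
        α ^ 2 * r ^ 2 + β ^ 2 * s ^ 2]), (offSubst p q r s α β).mulVec t)).PosDef then
      blockDet ![p ^ 2 + q ^ 2, p * r + q * s, r ^ 2 + s ^ 2]
      ![α ^ 2 * p ^ 2 + β ^ 2 * q ^ 2, α ^ 2 * p * r + β ^ 2 * q * s,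
        α ^ 2 * r ^ 2 + β ^ 2 * s ^ 2] ((offSubst p q r s α β).mulVec t) ^ k *
      blockDet ![p ^ 2 + q ^ 2, p * r + q * s, r ^ 2 + s ^ 2]
      ![α ^ 2 * p ^ 2 + β ^ 2 * q ^ 2, α ^ 2 * p * r + β ^ 2 * q * s,
        α ^ 2 * r ^ 2 + β ^ 2 * s ^ 2] ![(offSubst p q r s α β).mulVec t 0,
        (offSubst p q r s α β).mulVec t 2, (offSubst p q r s α β).mulVec t 1,
        (offSubst p q r s α β).mulVec t 3] ^ n else 0) =
      ((p * s - q * r) ^ 4) ^ (k + n) * (α ^ 2 * β ^ 2) ^ k *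
      contractions.indicator
        (fun t => defectDet t ^ k * twistedDet (α ^ 2) (β ^ 2) t ^ n) t := by
    intro t
    rw [posDef_blockMatrix_offSubst_iff hα hβ hδ, blockDet_offSubst_mulVec,
      blockDet_offSubst_mulVec_transpose p q r s α β t _ rfl]
    by_cases ht : t ∈ contractions
    · rw [if_pos ht, Set.indicator_of_mem ht, mul_pow, mul_pow, mul_pow, pow_add]
      generalize (p * s - q * r) ^ 4 = E
      ring
    · rw [if_neg ht, Set.indicator_of_notMem ht, mul_zero]
  simp_rw [h1]
  rw [integral_const_mul, integral_indicator measurableSet_contractions,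
    setIntegral_defectDet_mul_twistedDet_eq, Finset.mul_sum, Finset.mul_sum, Finset.mul_sum]
  refine Finset.sum_congr rfl fun j hj => ?_
  have hj' : j ≤ n := Nat.lt_succ_iff.1 (Finset.mem_range.1 hj)
  have e1 : symDet ![p ^ 2 + q ^ 2, p * r + q * s, r ^ 2 + s ^ 2] = (p * s - q * r) ^ 2 := by
    simp [symDet]
    ring
  have e2 : symDet ![α ^ 2 * p ^ 2 + β ^ 2 * q ^ 2, α ^ 2 * p * r + β ^ 2 * q * s,
      α ^ 2 * r ^ 2 + β ^ 2 * s ^ 2] = (p * s - q * r) ^ 2 * (α ^ 2 * β ^ 2) := by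
    simp [symDet]
    ring
  have e3 : symDisc ![p ^ 2 + q ^ 2, p * r + q * s, r ^ 2 + s ^ 2]
      ![α ^ 2 * p ^ 2 + β ^ 2 * q ^ 2, α ^ 2 * p * r + β ^ 2 * q * s,
      α ^ 2 * r ^ 2 + β ^ 2 * s ^ 2] = (p * s - q * r) ^ 4 * (α ^ 2 - β ^ 2) ^ 2 := by
    rw [symDisc, e1, e2]
    simp
    ring
  rw [e1, e2, e3, blockCoeff, mul_pow _ (α ^ 2 * β ^ 2), mul_pow _ ((α ^ 2 - β ^ 2) ^ 2),
    ← pow_mul (α ^ 2 - β ^ 2)]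
  obtain ⟨d, rfl⟩ := Nat.exists_eq_add_of_le hj'
  simp only [Nat.add_sub_cancel_left]
  set δ := p * s - q * r with hδ'
  have e4 : δ ^ 4 * (δ ^ 4) ^ (k + (j + d)) =
      (δ ^ 2) ^ (k + d + 1) * (δ ^ 2) ^ (k + d + 1) * (δ ^ 4) ^ j := by
    rw [← pow_add, ← pow_mul, ← pow_mul, ← pow_add, ← pow_mul, ← pow_add]
    congr 1
    ring
  have e5 : (α * β) ^ 2 * (α ^ 2 * β ^ 2) ^ k * (α ^ 2 * β ^ 2) ^ d =
      (α ^ 2 * β ^ 2) ^ (k + d + 1) := by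
    rw [mul_pow α β]
    ring
  linear_combination (Real.pi ^ 2 * k.factorial / Real.Gamma (k + (j + d : ℕ) + 5 / 2) *
    ((j + d).choose j * pochhammer (1 / 2) j * (-1) ^ j * pochhammer (k - j + 1) d *
      (Real.Gamma (k + d + 3 / 2) / Real.Gamma (k + d + 2))) * (α ^ 2 - β ^ 2) ^ (2 * j)) *
    ((α * β) ^ 2 * (α ^ 2 * β ^ 2) ^ k * (α ^ 2 * β ^ 2) ^ d * e4 +
      (δ ^ 2) ^ (k + d + 1) * (δ ^ 2) ^ (k + d + 1) * (δ ^ 4) ^ j * e5)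

/-! ### The cone of positive definite matrices and its unit trace section -/

/-- The direct sum of the scalar matrices and the traceless symmetric matrices, in coordinates. -/
noncomputable def coneEquiv : (ℝ × tracelessSymmetric) ≃ₗ[ℝ] BlockCoord where
  toFun p :=
    ((![p.1 / 4 + p.2.1 ((0, 0), (0, 0)), p.2.1 ((0, 0), (0, 1)),
        p.1 / 4 + p.2.1 ((0, 1), (0, 1))],
      ![p.1 / 4 + p.2.1 ((1, 0), (1, 0)), p.2.1 ((1, 0), (1, 1)),
        p.1 / 4 + p.2.1 ((1, 1), (1, 1))]),
      ![p.2.1 ((0, 0), (1, 0)), p.2.1 ((0, 1), (1, 0)), p.2.1 ((0, 0), (1, 1)),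
        p.2.1 ((0, 1), (1, 1))])
  map_add' p q := by
    ext i <;> fin_cases i <;> simp <;> ring
  map_smul' c p := by
    ext i <;> fin_cases i <;> simp <;> ring
  invFun e :=
    (e.1.1 0 + e.1.1 2 + e.1.2 0 + e.1.2 2,
      ⟨WithLp.toLp 2 fun q => blockMatrix e q.1 q.2 -
        if q.1 = q.2 then (e.1.1 0 + e.1.1 2 + e.1.2 0 + e.1.2 2) / 4 else 0, by
        constructor
        · rintro ⟨i, i'⟩ ⟨j, j'⟩
          fin_cases i <;> fin_cases i' <;> fin_cases j <;> fin_cases j' <;>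
            simp [blockMatrix, symMat, offMat]
        · simp [Fintype.sum_prod_type, blockMatrix, symMat, offMat]
          ring⟩)
  left_inv p := by
    obtain ⟨τ, x, hx, hx'⟩ := p
    simp only [Fintype.sum_prod_type, Fin.sum_univ_two] at hx'
    ext q
    · simp
      linear_combination hx'
    · obtain ⟨⟨i, i'⟩, ⟨j, j'⟩⟩ := q
      fin_cases i <;> fin_cases i' <;> fin_cases j <;> fin_cases j' <;>
        simp [blockMatrix, symMat, offMat] <;> first | (apply hx) | (linear_combination -hx' / 4)
  right_inv e := by
    ext i <;> fin_cases i <;> simp [blockMatrix, symMat, offMat]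

lemma finrank_tracelessSymmetric : Module.finrank ℝ tracelessSymmetric = 9 := by
  have h := coneEquiv.finrank_eq
  simp at h
  omega

lemma trace_blockMatrix (e : BlockCoord) :
    (blockMatrix e).trace = e.1.1 0 + e.1.1 2 + (e.1.2 0 + e.1.2 2) := by
  simp [Matrix.trace, Fintype.sum_prod_type, blockMatrix, symMat]

lemma trace_unitTraceMatrix (x : tracelessSymmetric) : (unitTraceMatrix x).trace = 1 := by
  have h := x.2.2
  simp only [Matrix.trace, Matrix.diag, unitTraceMatrix, Matrix.of_apply, if_true,
    Finset.sum_add_distrib, h]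
  simp

lemma blockMatrix_coneEquiv {τ : ℝ} (hτ : τ ≠ 0) (y : tracelessSymmetric) :
    blockMatrix (coneEquiv (τ, y)) = τ • unitTraceMatrix (τ⁻¹ • y) := by
  have hy := y.2.1
  ext ⟨i, i'⟩ ⟨j, j'⟩
  fin_cases i <;> fin_cases i' <;> fin_cases j <;> fin_cases j' <;>
    simp [blockMatrix, symMat, offMat, coneEquiv, unitTraceMatrix, mul_add, hτ] <;>
    first | (apply hy) | ring

lemma trace_blockMatrix_coneEquiv (τ : ℝ) (y : tracelessSymmetric) :
    (blockMatrix (coneEquiv (τ, y))).trace = τ := by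
  rw [trace_blockMatrix]
  have h := y.2.2
  simp only [Fintype.sum_prod_type, Fin.sum_univ_two] at h
  simp [coneEquiv]
  linear_combination h

/-! ### Integration over a cone -/

lemma integral_pow_mul_exp_neg (N : ℕ) :
    IntegrableOn (fun τ : ℝ => τ ^ N * Real.exp (-τ)) (Set.Ioi 0) ∧
      ∫ τ in Set.Ioi (0 : ℝ), τ ^ N * Real.exp (-τ) = N.factorial := by
  have hN : (0 : ℝ) < N + 1 := by positivity
  have e : ∀ τ ∈ Set.Ioi (0 : ℝ), Real.exp (-τ) * τ ^ ((N + 1 : ℝ) - 1) =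
      τ ^ N * Real.exp (-τ) := by
    intro τ _
    rw [add_sub_cancel_right, Real.rpow_natCast, mul_comm]
  constructor
  · exact (Real.GammaIntegral_convergent hN).congr_fun e measurableSet_Ioi
  · rw [← setIntegral_congr_fun measurableSet_Ioi e, ← Real.Gamma_eq_integral hN,
      Real.Gamma_nat_eq_factorial]

/-- At height τ the section is scaled by τ and contributes τ^(dim V) times the integral of g;
integrating over τ gives a factorial. -/
lemma integrable_and_integral_cone {V : Type*} [NormedAddCommGroup V] [NormedSpace ℝ V]
    [FiniteDimensional ℝ V] [MeasurableSpace V] [BorelSpace V] (μ : Measure V)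
    [μ.IsAddHaarMeasure] {g : V → ℝ} (hgm : Measurable g) (hg : Integrable g μ) (N : ℕ) :
    Integrable (fun p : ℝ × V => if 0 < p.1 then
        p.1 ^ N * Real.exp (-p.1) * g (p.1⁻¹ • p.2) else 0) (volume.prod μ) ∧
      ∫ p : ℝ × V, (if 0 < p.1 then p.1 ^ N * Real.exp (-p.1) * g (p.1⁻¹ • p.2) else 0)
        ∂(volume.prod μ) = (N + Module.finrank ℝ V).factorial * ∫ x, g x ∂μ := by
  have hm : Measurable (fun p : ℝ × V => if 0 < p.1 then
      p.1 ^ N * Real.exp (-p.1) * g (p.1⁻¹ • p.2) else 0) := by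
    refine Measurable.ite (measurableSet_lt measurable_const measurable_fst) ?_ measurable_const
    have : Measurable fun p : ℝ × V => p.1⁻¹ • p.2 := by fun_prop
    have := hgm.comp this
    fun_prop
  have key : ∀ (f : V → ℝ) (τ : ℝ), ∫ y, (if 0 < τ then
        τ ^ N * Real.exp (-τ) * f (τ⁻¹ • y) else 0) ∂μ =
      (Set.Ioi (0 : ℝ)).indicator (fun τ => τ ^ (N + Module.finrank ℝ V) * Real.exp (-τ)) τ *
        ∫ x, f x ∂μ := by
    intro f τ
    by_cases hτ : 0 < τ
    · simp only [if_pos hτ]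
      rw [Set.indicator_of_mem (Set.mem_Ioi.2 hτ), integral_const_mul,
        Measure.integral_comp_smul, inv_pow, inv_inv, abs_of_pos (by positivity), smul_eq_mul,
        pow_add]
      ring
    · simp [hτ]
  have hint : ∀ c : ℝ, Integrable (fun τ => (Set.Ioi (0 : ℝ)).indicator
      (fun τ => τ ^ (N + Module.finrank ℝ V) * Real.exp (-τ)) τ * c) := fun c =>
    ((integrable_indicator_iff measurableSet_Ioi).2 (integral_pow_mul_exp_neg _).1).mul_const c
  have hI : Integrable (fun p : ℝ × V => if 0 < p.1 then
      p.1 ^ N * Real.exp (-p.1) * g (p.1⁻¹ • p.2) else 0) (volume.prod μ) := by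
    rw [integrable_prod_iff hm.aestronglyMeasurable]
    refine ⟨Filter.Eventually.of_forall fun τ => ?_, ?_⟩
    · by_cases hτ : 0 < τ
      · simp only [if_pos hτ]
        exact (hg.comp_smul (inv_ne_zero hτ.ne')).const_mul _
      · simp [hτ]
    · refine (hint (∫ x, ‖g x‖ ∂μ)).congr (Filter.Eventually.of_forall fun τ => ?_)
      simp only
      rw [← key]
      congr 1 with y
      by_cases hτ : 0 < τ
      · simp only [if_pos hτ, norm_mul, Real.norm_eq_abs, abs_of_pos (pow_pos hτ N),
          Real.abs_exp]
      · simp [hτ]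
  refine ⟨hI, ?_⟩
  rw [integral_prod _ hI]
  simp_rw [key g]
  rw [integral_mul_const, integral_indicator measurableSet_Ioi, (integral_pow_mul_exp_neg _).2]

/-! ### Density matrices -/

lemma isClosed_setOf_posSemidef : IsClosed {ρ : RebitMatrix | ρ.PosSemidef} := by
  simp only [Matrix.posSemidef_iff_dotProduct_mulVec, Set.ofPred_and, Set.ofPred_forall]
  refine IsClosed.inter ?_ (isClosed_iInter fun x => ?_)
  · exact isClosed_eq (by fun_prop) (by fun_prop)
  · exact isClosed_le (by fun_prop) (by fun_prop)

lemma continuous_unitTraceMatrix : Continuous unitTraceMatrix := by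
  refine continuous_matrix fun i j => ?_
  simp only [unitTraceMatrix, Matrix.of_apply]
  fun_prop

@[fun_prop]
lemma continuous_partialTranspose : Continuous partialTranspose := by
  refine continuous_matrix fun i j => ?_
  simp only [partialTranspose, Matrix.of_apply]
  fun_prop

/-- The traceless parts of the density matrices. -/
def densityParts : Set tracelessSymmetric := {x | (unitTraceMatrix x).PosSemidef}

lemma isClosed_densityParts : IsClosed densityParts :=
  isClosed_setOf_posSemidef.preimage continuous_unitTraceMatrix

lemma unitTraceMatrix_convexCombo (x y : tracelessSymmetric) {a b : ℝ} (hab : a + b = 1) :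
    unitTraceMatrix (a • x + b • y) = a • unitTraceMatrix x + b • unitTraceMatrix y := by
  ext i j
  simp only [unitTraceMatrix, Matrix.of_apply, Matrix.add_apply, Matrix.smul_apply, smul_eq_mul,
    Submodule.coe_add, Submodule.coe_smul, PiLp.add_apply, PiLp.smul_apply]
  linear_combination -(if i = j then 1 / 4 else 0) * hab

lemma convex_densityParts : Convex ℝ densityParts := by
  intro x hx y hy a b ha hb hab
  change (unitTraceMatrix _).PosSemidef
  rw [unitTraceMatrix_convexCombo x y hab]
  exact (hx.smul ha).add (hy.smul hb)

lemma unitTraceMatrix_zero : unitTraceMatrix 0 = (1 / 4 : ℝ) • (1 : RebitMatrix) := by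
  ext i j
  simp [unitTraceMatrix, Matrix.one_apply]

lemma Matrix.PosSemidef.two_mul_abs_apply_le {n : Type*} [Fintype n] [DecidableEq n]
    {M : Matrix n n ℝ} (hM : M.PosSemidef) (i j : n) : 2 * |M i j| ≤ M i i + M j j := by
  have hs : M j i = M i j := by simpa using hM.isHermitian.apply i j
  -- Positivity at eᵢ ± eⱼ bounds the off-diagonal entry by the diagonal ones.
  have h1 := (Matrix.posSemidef_iff_dotProduct_mulVec.1 hM).2 (Pi.single i 1 + Pi.single j 1)
  have h2 := (Matrix.posSemidef_iff_dotProduct_mulVec.1 hM).2 (Pi.single i 1 - Pi.single j 1)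
  simp [Matrix.mulVec_add, Matrix.mulVec_sub, add_dotProduct, sub_dotProduct, hs] at h1 h2
  rcases abs_cases (M i j) with h | h <;> linarith

lemma isCompact_densityParts : IsCompact densityParts := by
  refine Metric.isCompact_of_isClosed_isBounded isClosed_densityParts ?_
  rw [isBounded_iff_forall_norm_le]
  refine ⟨√(∑ _p : RebitIndex × RebitIndex, (2 : ℝ) ^ 2), fun x hx => ?_⟩
  change ‖(x : EuclideanSpace ℝ (RebitIndex × RebitIndex))‖ ≤ _
  rw [EuclideanSpace.norm_eq]
  refine Real.sqrt_le_sqrt (Finset.sum_le_sum fun p _ => ?_)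
  refine pow_le_pow_left₀ (norm_nonneg _) ?_ 2
  have hle : ∀ i, unitTraceMatrix x i i ≤ 1 := by
    intro i
    rw [← trace_unitTraceMatrix x]
    exact Finset.single_le_sum (f := fun i => unitTraceMatrix x i i)
      (fun i _ => Matrix.PosSemidef.diag_nonneg hx) (Finset.mem_univ i)
  have h1 := Matrix.PosSemidef.two_mul_abs_apply_le hx p.1 p.2
  have h2 : unitTraceMatrix x p.1 p.2 = (if p.1 = p.2 then 1 / 4 else 0) +
      (x : EuclideanSpace ℝ _) p := rfl
  have h3 := hle p.1
  have h4 := hle p.2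
  have h5 : |unitTraceMatrix x p.1 p.2| ≤ 1 := by linarith
  rw [h2, abs_le] at h5
  rw [Real.norm_eq_abs, abs_le]
  constructor <;> split_ifs at h5 <;> linarith

/-- An interior point x can be pushed slightly away from 0 to (1+ε)x inside the set. Then x is a
convex combination of (1+ε)x, which is positive semidefinite, and 0, which represents the positive
definite matrix I/4. -/
lemma posDef_of_mem_interior {x : tracelessSymmetric} (hx : x ∈ interior densityParts) :
    (unitTraceMatrix x).PosDef := by
  have hc : Filter.Tendsto (fun ε : ℝ => (1 + ε) • x) (nhds 0) (nhds x) := by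
    have : Continuous fun ε : ℝ => (1 + ε) • x := by fun_prop
    simpa using this.tendsto 0
  have h1 := (hc.eventually (mem_interior_iff_mem_nhds.1 hx)).filter_mono
    (nhdsWithin_le_nhds (s := Set.Ioi 0))
  obtain ⟨ε, hε, hε0⟩ := (h1.and self_mem_nhdsWithin).exists
  change 0 < ε at hε0
  have hp : 0 < 1 + ε := by linarith
  have h2 : unitTraceMatrix x = (1 + ε)⁻¹ • unitTraceMatrix ((1 + ε) • x) +
      (ε * (1 + ε)⁻¹) • unitTraceMatrix 0 := by
    rw [← unitTraceMatrix_convexCombo]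
    · simp [smul_smul, hp.ne']
    · field_simp
  rw [h2, unitTraceMatrix_zero]
  refine Matrix.PosDef.posSemidef_add (Matrix.PosSemidef.smul hε (by positivity)) ?_
  exact (Matrix.PosDef.one.smul (by norm_num)).smul (by positivity)

/-- The frontier of a convex set is null, so semidefinite density matrices may be replaced by
definite ones. -/
lemma ae_mem_densityParts_iff (μ : Measure tracelessSymmetric) [μ.IsAddHaarMeasure] :
    ∀ᵐ x ∂μ, x ∈ densityParts ↔ (unitTraceMatrix x).PosDef := by
  filter_upwards [measure_eq_zero_iff_ae_notMem.1 (convex_densityParts.addHaar_frontier μ)] with x hx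
  refine ⟨fun h => posDef_of_mem_interior ?_, fun h => h.posSemidef⟩
  rw [isClosed_densityParts.frontier_eq] at hx
  by_contra h'
  exact hx ⟨h, h'⟩

lemma measurableSet_posDef_unitTraceMatrix :
    MeasurableSet {x | (unitTraceMatrix x).PosDef} := by
  have : {x | (unitTraceMatrix x).PosDef} =
      densityParts ∩ {x | (unitTraceMatrix x).det ≠ 0} := by
    ext x
    exact ⟨fun h => ⟨h.posSemidef, h.det_pos.ne'⟩, fun h => h.1.posDef_iff_det_ne_zero.2 h.2⟩
  rw [this]
  refine isClosed_densityParts.measurableSet.inter (IsOpen.measurableSet ?_)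
  exact isOpen_ne_fun (continuous_unitTraceMatrix.matrix_det) continuous_const

lemma continuous_det_pow_mul_det_partialTranspose_pow (k n : ℕ) :
    Continuous fun ρ : RebitMatrix => ρ.det ^ k * (partialTranspose ρ).det ^ n := by
  fun_prop

/-! ### Moments over the cone and over its section -/

/-- The moments of the determinants over the density matrices. -/
noncomputable def sectionMoment (μ : Measure tracelessSymmetric) (k n : ℕ) : ℝ :=
  ∫ x in densityParts, (unitTraceMatrix x).det ^ k * (partialTranspose (unitTraceMatrix x)).det ^ n ∂μ

open Classical in
/-- The weight of the moments of the determinants over the cone of positive definite matrices. -/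
noncomputable def coneWeight (k n : ℕ) (e : BlockCoord) : ℝ :=
  if (blockMatrix e).PosDef then
    (blockMatrix e).det ^ k * (partialTranspose (blockMatrix e)).det ^ n *
      Real.exp (-(blockMatrix e).trace)
  else 0

lemma posDef_smul_iff {ρ : RebitMatrix} {τ : ℝ} (hτ : 0 < τ) : (τ • ρ).PosDef ↔ ρ.PosDef := by
  refine ⟨fun h => ?_, fun h => h.smul hτ⟩
  have := h.smul (inv_pos.2 hτ)
  rwa [smul_smul, inv_mul_cancel₀ hτ.ne', one_smul] at this

-- Each determinant scales by τ⁴, and a positive definite matrix has positive trace, so nothing is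
-- contributed for τ ≤ 0.
open Classical in
lemma coneWeight_coneEquiv (k n : ℕ) (τ : ℝ) (y : tracelessSymmetric) :
    coneWeight k n (coneEquiv (τ, y)) = if 0 < τ then τ ^ (4 * k + 4 * n) * Real.exp (-τ) *
      (if (unitTraceMatrix (τ⁻¹ • y)).PosDef then (unitTraceMatrix (τ⁻¹ • y)).det ^ k *
        (partialTranspose (unitTraceMatrix (τ⁻¹ • y))).det ^ n else 0) else 0 := by
  unfold coneWeight
  rw [trace_blockMatrix_coneEquiv]
  by_cases hτ : 0 < τ
  · rw [if_pos hτ, blockMatrix_coneEquiv hτ.ne', posDef_smul_iff hτ]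
    have h : ∀ ρ : RebitMatrix, partialTranspose (τ • ρ) = τ • partialTranspose ρ := fun _ => rfl
    rw [h]
    simp only [Matrix.det_smul, Fintype.card_prod, Fintype.card_fin]
    split_ifs
    · ring
    · simp
  · rw [if_neg hτ, if_neg]
    intro h
    have := h.trace_pos
    rw [trace_blockMatrix_coneEquiv] at this
    exact hτ this

instance isAddHaarMeasure_volume_blockCoord : (volume : Measure BlockCoord).IsAddHaarMeasure :=
  have : (volume : Measure ((Fin 3 → ℝ) × (Fin 3 → ℝ))).IsAddHaarMeasure :=
    Measure.prod.instIsAddHaarMeasure volume volume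
  Measure.prod.instIsAddHaarMeasure volume volume

/-- The constant c compares two Haar measures on the ten-dimensional space of symmetric matrices. It
does not depend on k and n, so its value never matters. -/
lemma integrable_and_integral_coneWeight (μ : Measure tracelessSymmetric) [μ.IsAddHaarMeasure] :
    ∃ c : ℝ, ∀ k n : ℕ, Integrable (coneWeight k n) ∧
      ∫ e, coneWeight k n e = c * (4 * k + 4 * n + 9).factorial * sectionMoment μ k n := by
  classical
  let L := coneEquiv.toContinuousLinearEquiv
  let ν : Measure BlockCoord := Measure.map L (volume.prod μ)
  have hν : ν.IsAddHaarMeasure := L.isAddHaarMeasure_map _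
  obtain ⟨c, hvol⟩ : ∃ c : NNReal, (volume : Measure BlockCoord) = c • ν :=
    ⟨_, Measure.isAddLeftInvariant_eq_smul volume ν⟩
  refine ⟨c, fun k n => ?_⟩
  set g : tracelessSymmetric → ℝ := fun x => if (unitTraceMatrix x).PosDef then
    (unitTraceMatrix x).det ^ k * (partialTranspose (unitTraceMatrix x)).det ^ n else 0 with hg
  have hcont := (continuous_det_pow_mul_det_partialTranspose_pow k n).comp
    continuous_unitTraceMatrix
  have hgm : Measurable g :=
    Measurable.ite measurableSet_posDef_unitTraceMatrix hcont.measurable measurable_const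
  have hae : densityParts.indicator (fun x => (unitTraceMatrix x).det ^ k *
      (partialTranspose (unitTraceMatrix x)).det ^ n) =ᵐ[μ] g := by
    filter_upwards [ae_mem_densityParts_iff μ] with x hx
    rw [Set.indicator_apply, hg]
    simp only [hx]
  have hint : Integrable g μ := by
    refine Integrable.congr ?_ hae
    rw [integrable_indicator_iff isClosed_densityParts.measurableSet]
    exact hcont.continuousOn.integrableOn_compact isCompact_densityParts
  have hgint : ∫ x, g x ∂μ = sectionMoment μ k n := by
    rw [← integral_congr_ae hae, integral_indicator isClosed_densityParts.measurableSet]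
    rfl
  obtain ⟨h1, h2⟩ := integrable_and_integral_cone μ hgm hint (4 * k + 4 * n)
  have hw : ∀ p : ℝ × tracelessSymmetric, coneWeight k n (L p) = if 0 < p.1 then
      p.1 ^ (4 * k + 4 * n) * Real.exp (-p.1) * g (p.1⁻¹ • p.2) else 0 := fun p =>
    coneWeight_coneEquiv k n p.1 p.2
  have hemb : MeasurableEmbedding L := L.toHomeomorph.measurableEmbedding
  constructor
  · rw [hvol]
    refine Integrable.smul_measure_nnreal ?_
    rw [hemb.integrable_map_iff]
    exact h1.congr (Filter.Eventually.of_forall fun p => (hw p).symm)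
  · rw [hvol, integral_smul_nnreal_measure, hemb.integral_map]
    simp_rw [hw]
    rw [h2, hgint, finrank_tracelessSymmetric]
    simp [NNReal.smul_def, mul_assoc]

/-! ### The probability distribution -/

/-- The Hilbert–Schmidt volume on the traceless symmetric matrices. -/
noncomputable def tracelessVolume : Measure tracelessSymmetric :=
  (stdOrthonormalBasis ℝ tracelessSymmetric).toBasis.addHaar

instance isAddHaarMeasure_tracelessVolume : tracelessVolume.IsAddHaarMeasure := by
  unfold tracelessVolume
  infer_instance

lemma measurableSet_setOf_isTwoRebitDensity :
    MeasurableSet {ρ : RebitMatrix | IsTwoRebitDensity ρ} :=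
  (isClosed_setOf_posSemidef.inter (isClosed_eq (by fun_prop) (by fun_prop))).measurableSet

lemma preimage_setOf_isTwoRebitDensity :
    unitTraceMatrix ⁻¹' {ρ | IsTwoRebitDensity ρ} = densityParts := by
  ext x
  simp [IsTwoRebitDensity, densityParts, trace_unitTraceMatrix]

lemma hilbertSchmidtVolume_setOf_isTwoRebitDensity :
    hilbertSchmidtVolume {ρ | IsTwoRebitDensity ρ} = tracelessVolume densityParts := by
  rw [hilbertSchmidtVolume, Measure.map_apply continuous_unitTraceMatrix.measurable
    measurableSet_setOf_isTwoRebitDensity, preimage_setOf_isTwoRebitDensity]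
  rfl

lemma hilbertSchmidtVolume_restrict :
    hilbertSchmidtVolume.restrict {ρ | IsTwoRebitDensity ρ} =
      Measure.map unitTraceMatrix (tracelessVolume.restrict densityParts) := by
  rw [hilbertSchmidtVolume, Measure.restrict_map continuous_unitTraceMatrix.measurable
    measurableSet_setOf_isTwoRebitDensity, preimage_setOf_isTwoRebitDensity]
  rfl

lemma rebitMoment_eq (k n : ℕ) : rebitMoment k n =
    (tracelessVolume.real densityParts)⁻¹ * sectionMoment tracelessVolume k n := by
  rw [rebitMoment, twoRebitHS, ProbabilityTheory.cond, integral_smul_measure,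
    hilbertSchmidtVolume_restrict, hilbertSchmidtVolume_setOf_isTwoRebitDensity,
    integral_map continuous_unitTraceMatrix.measurable.aemeasurable
      (continuous_det_pow_mul_det_partialTranspose_pow k n).aestronglyMeasurable,
    ENNReal.toReal_inv]
  rfl

lemma sectionMoment_zero_zero (μ : Measure tracelessSymmetric) :
    sectionMoment μ 0 0 = μ.real densityParts := by
  simp [sectionMoment]

lemma isProbabilityMeasure_twoRebitHS (h : tracelessVolume.real densityParts ≠ 0) :
    IsProbabilityMeasure twoRebitHS := by
  refine cond_isProbabilityMeasure_of_finite ?_ ?_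
  · rw [hilbertSchmidtVolume_setOf_isTwoRebitDensity]
    intro h0
    exact h (by simp [Measure.real, h0])
  · rw [hilbertSchmidtVolume_setOf_isTwoRebitDensity]
    exact isCompact_densityParts.measure_lt_top.ne

lemma integrable_twoRebitHS (h : tracelessVolume.real densityParts ≠ 0) (k n : ℕ) :
    Integrable (fun ρ : RebitMatrix => ρ.det ^ k * (partialTranspose ρ).det ^ n) twoRebitHS := by
  rw [twoRebitHS, ProbabilityTheory.cond, hilbertSchmidtVolume_restrict,
    hilbertSchmidtVolume_setOf_isTwoRebitDensity]
  refine Integrable.smul_measure ?_ ?_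
  · have hc := continuous_det_pow_mul_det_partialTranspose_pow k n
    rw [integrable_map_measure hc.aestronglyMeasurable
      continuous_unitTraceMatrix.measurable.aemeasurable]
    exact (hc.comp continuous_unitTraceMatrix).continuousOn.integrableOn_compact
      isCompact_densityParts
  · rw [Ne, ENNReal.inv_eq_top]
    intro h0
    exact h (by simp [Measure.real, h0])

/-! ### The moments over the cone -/

/-- The pencil of a definite and a symmetric form has real roots; multiplying the discriminant by
v₀² exhibits it as a sum of squares with nonnegative coefficients. -/
lemma SymPos.symDisc_nonneg {v : Fin 3 → ℝ} (hv : SymPos v) (w : Fin 3 → ℝ) :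
    0 ≤ symDisc v w := by
  have h1 : v 0 ^ 2 * symDisc v w =
      (v 0 * (v 0 * w 2 - v 2 * w 0) - 2 * v 1 * (v 0 * w 1 - v 1 * w 0)) ^ 2 +
        4 * symDet v * (v 0 * w 1 - v 1 * w 0) ^ 2 := by
    unfold symDisc symDet
    ring
  have h0 := hv.1
  have hd := hv.2
  refine (mul_nonneg_iff_of_pos_left (pow_pos h0 2)).1 ?_
  rw [h1]
  positivity

open Classical in
lemma integrable_and_integral_symDisc (a j : ℕ) :
    Integrable (fun p : (Fin 3 → ℝ) × (Fin 3 → ℝ) => if SymPos p.1 ∧ SymPos p.2 then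
        symDet p.1 ^ a * symDet p.2 ^ a * symDisc p.1 p.2 ^ j *
          Real.exp (-(p.1 0 + p.1 2 + (p.2 0 + p.2 2))) else 0) ∧
      ∫ p : (Fin 3 → ℝ) × (Fin 3 → ℝ), (if SymPos p.1 ∧ SymPos p.2 then
        symDet p.1 ^ a * symDet p.2 ^ a * symDisc p.1 p.2 ^ j *
          Real.exp (-(p.1 0 + p.1 2 + (p.2 0 + p.2 2))) else 0) = discMoment a j := by
  have ha : (0 : ℝ) ≤ a := a.cast_nonneg
  have hpos : ∀ p : (Fin 3 → ℝ) × (Fin 3 → ℝ), 0 ≤ (if SymPos p.1 ∧ SymPos p.2 then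
        symDet p.1 ^ a * symDet p.2 ^ a * symDisc p.1 p.2 ^ j *
          Real.exp (-(p.1 0 + p.1 2 + (p.2 0 + p.2 2))) else 0) := by
    intro p
    split_ifs with h
    · have h1 := h.1.2
      have h2 := h.2.2
      have h3 := h.1.symDisc_nonneg p.2
      positivity
    · exact le_rfl
  have hms : MeasurableSet {v : Fin 3 → ℝ | SymPos v} :=
    (measurableSet_lt measurable_const (measurable_pi_apply 0)).inter
      (measurableSet_lt measurable_const measurable_symDet)
  have hm : Measurable (fun p : (Fin 3 → ℝ) × (Fin 3 → ℝ) => if SymPos p.1 ∧ SymPos p.2 then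
        symDet p.1 ^ a * symDet p.2 ^ a * symDisc p.1 p.2 ^ j *
          Real.exp (-(p.1 0 + p.1 2 + (p.2 0 + p.2 2))) else 0) := by
    refine Measurable.ite (hms.prod hms) ?_ measurable_const
    have := measurable_symDisc
    have := measurable_symDet
    fun_prop
  refine integrable_and_integral_eq_of_lintegral hm.aestronglyMeasurable
    (Filter.Eventually.of_forall hpos) ?_ ?_
  · unfold discMoment
    have h1 := beta_pos (show (0 : ℝ) < j + 1 / 2 by positivity)
      (show (0 : ℝ) < 2 * a + j + 5 / 2 by positivity)
    have h2 := beta_pos (show (0 : ℝ) < (a : ℝ) + 1 by positivity)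
      (show (0 : ℝ) < a + j + 3 / 2 by positivity)
    have h3 := beta_pos (show (0 : ℝ) < a + j + 3 / 2 by positivity)
      (show (0 : ℝ) < (a : ℝ) + 1 by positivity)
    positivity
  · rw [← lintegral_lintegral_symRpow_mul_symDisc (by linarith) j, Measure.volume_eq_prod,
      lintegral_prod _ hm.ennreal_ofReal.aemeasurable]
    refine lintegral_congr fun v => lintegral_congr fun w => ?_
    by_cases hv : SymPos v
    · by_cases hw : SymPos w
      · have h3 := hv.symDisc_nonneg w
        rw [if_pos ⟨hv, hw⟩, symRpow_of_symPos _ hv, symRpow_of_symPos _ hw,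
          posRpow_of_pos _ hv.2, posRpow_of_pos _ hw.2, Real.rpow_natCast, Real.rpow_natCast, ← ENNReal.ofReal_mul (pow_nonneg hv.2.le a),
          ← ENNReal.ofReal_mul (mul_nonneg (pow_nonneg hv.2.le a) (pow_nonneg hw.2.le a)),
          ← ENNReal.ofReal_mul (mul_nonneg (mul_nonneg (pow_nonneg hv.2.le a)
            (pow_nonneg hw.2.le a)) (pow_nonneg h3 j))]
      · rw [if_neg fun h => hw h.2, symRpow_of_not_symPos _ hw]
        simp
    · rw [if_neg fun h => hv h.1, symRpow_of_not_symPos _ hv]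
      simp

open Classical in
lemma integral_coneWeight_section (k n : ℕ) (v w : Fin 3 → ℝ) :
    ∫ t : Fin 4 → ℝ, coneWeight k n ((v, w), t) =
      ∑ j ∈ Finset.range (n + 1), blockCoeff k n j * (if SymPos v ∧ SymPos w then
        symDet v ^ (k + (n - j) + 1) * symDet w ^ (k + (n - j) + 1) * symDisc v w ^ j *
          Real.exp (-(v 0 + v 2 + (w 0 + w 2))) else 0) := by
  by_cases h : SymPos v ∧ SymPos w
  · have e : ∀ t : Fin 4 → ℝ, coneWeight k n ((v, w), t) =
        (if (blockMatrix ((v, w), t)).PosDef then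
          blockDet v w t ^ k * blockDet v w ![t 0, t 2, t 1, t 3] ^ n else 0) *
        Real.exp (-(v 0 + v 2 + (w 0 + w 2))) := by
      intro t
      rw [coneWeight, det_blockMatrix, det_partialTranspose_blockMatrix, trace_blockMatrix]
      split_ifs <;> simp
    simp_rw [e, if_pos h]
    rw [integral_mul_const, integral_offDiagonal k n h.1 h.2, Finset.sum_mul]
    exact Finset.sum_congr rfl fun j _ => by ring
  · simp_rw [if_neg h]
    have e : ∀ t : Fin 4 → ℝ, coneWeight k n ((v, w), t) = 0 := fun t =>
      if_neg fun hp => h (symPos_of_posDef_blockMatrix hp)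
    simp [e]

lemma integral_coneWeight_eq_sum (k n : ℕ) (hI : Integrable (coneWeight k n)) :
    ∫ e, coneWeight k n e = ∑ j ∈ Finset.range (n + 1),
      blockCoeff k n j * discMoment ((k + (n - j) + 1 : ℕ) : ℝ) j := by
  classical
  rw [Measure.volume_eq_prod, integral_prod _ hI]
  simp_rw [integral_coneWeight_section]
  rw [integral_finsetSum _ fun j _ => (integrable_and_integral_symDisc _ j).1.const_mul _]
  refine Finset.sum_congr rfl fun j _ => ?_
  rw [integral_const_mul, (integrable_and_integral_symDisc _ j).2]

/-! ### Gamma factors, numerators and denominators -/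

lemma prod_odd_div_even (j : ℕ) :
    ∏ i ∈ Finset.range j, ((2 * i + 1) / (2 * i + 2) : ℝ) =
      pochhammer (1 / 2) j / j.factorial := by
  induction j with
  | zero => simp [pochhammer_zero]
  | succ j ih =>
    rw [Finset.prod_range_succ, ih, pochhammer_succ, Nat.factorial_succ]
    push_cast
    have : (j.factorial : ℝ) ≠ 0 := by positivity
    field_simp
    ring

lemma discMoment_eq {s : ℝ} (hs : -1 < s) (j : ℕ) : discMoment s j =
    Real.pi * j.factorial * 4 ^ j * pochhammer (2 * s + j + 5 / 2) j *
      (Real.Gamma (s + 1) * Real.Gamma (s + j + 3 / 2)) ^ 2 := by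
  have hj : (0 : ℝ) ≤ j := j.cast_nonneg
  have h1 : Real.Gamma (j + 1 / 2) = √Real.pi * pochhammer (1 / 2) j := by
    rw [add_comm, Gamma_add_natCast (by norm_num), Real.Gamma_one_half_eq]
  have h2 : Real.Gamma (2 * s + 2 * j + 5 / 2) =
      Real.Gamma (2 * s + j + 5 / 2) * pochhammer (2 * s + j + 5 / 2) j := by
    rw [← Gamma_add_natCast (by linarith)]
    congr 1
    ring
  have g1 : Real.Gamma (2 * s + j + 5 / 2) ≠ 0 := (Real.Gamma_pos_of_pos (by linarith)).ne'
  have g2 : Real.Gamma (2 * s + 2 * j + 3) ≠ 0 := (Real.Gamma_pos_of_pos (by linarith)).ne'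
  have g3 : pochhammer (1 / 2) j ≠ 0 := (pochhammer_pos (by norm_num) j).ne'
  have g4 : √Real.pi ^ 2 = Real.pi := Real.sq_sqrt Real.pi_pos.le
  unfold discMoment beta
  rw [prod_odd_div_even, h1, h2]
  have e1 : (j + 1 / 2 + (2 * s + j + 5 / 2) : ℝ) = 2 * s + 2 * j + 3 := by ring
  have e2 : s + 1 + (s + j + 3 / 2) = 2 * s + j + 5 / 2 := by ring
  have e3 : s + j + 3 / 2 + (s + 1) = 2 * s + j + 5 / 2 := by ring
  rw [e1, e2, e3]
  generalize Real.Gamma (2 * s + j + 5 / 2) = a at *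
  generalize Real.Gamma (2 * s + 2 * j + 3) = b at *
  generalize pochhammer (1 / 2) j = d at *
  field_simp
  rw [g4]
  ring

lemma pochhammer_neg (x : ℝ) (m : ℕ) :
    pochhammer (-x) m = (-1) ^ m * pochhammer (x - m + 1) m := by
  induction m with
  | zero => simp [pochhammer_zero]
  | succ m ih =>
    have e : x - (m + 1 : ℕ) + 1 = x - m := by push_cast; ring
    rw [pochhammer_succ, ih, e, pochhammer_succ_left]
    ring

/-- For s = k + (n-j) + 1 the squared Gamma factors of `discMoment` each lose one power to the
denominators of `blockCoeff`. The sign (-1)^j in `blockCoeff` is absorbed by reversing the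
Pochhammer symbol of negative argument. -/
lemma integral_coneWeight (k n : ℕ) (hI : Integrable (coneWeight k n)) :
    ∫ e, coneWeight k n e = Real.pi ^ 3 * k.factorial * Real.Gamma (k + 3 / 2) *
      Real.Gamma (k + 2) * Real.Gamma (k + n + 5 / 2) * (rebitNumerator n k / 2 ^ n) := by
  have hk : (0 : ℝ) ≤ k := k.cast_nonneg
  have hn : (0 : ℝ) ≤ n := n.cast_nonneg
  rw [integral_coneWeight_eq_sum k n hI, rebitNumerator, mul_div_cancel_left₀ _ (by positivity),
    Finset.mul_sum]
  refine Finset.sum_congr rfl fun j hj => ?_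
  obtain ⟨d, rfl⟩ := Nat.exists_eq_add_of_le (Nat.lt_succ_iff.1 (Finset.mem_range.1 hj))
  have hd : (0 : ℝ) ≤ d := d.cast_nonneg
  have hjr : (0 : ℝ) ≤ j := j.cast_nonneg
  rw [blockCoeff, discMoment_eq (by push_cast; linarith)]
  simp only [Nat.add_sub_cancel_left]
  have g0 : Real.Gamma (k + (j + d : ℕ) + 5 / 2) ≠ 0 :=
    (Real.Gamma_pos_of_pos (by linarith)).ne'
  have g1 : Real.Gamma (k + 2 + d) ≠ 0 := (Real.Gamma_pos_of_pos (by linarith)).ne'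
  have e1 : ((k + d + 1 : ℕ) : ℝ) + 1 = k + 2 + d := by push_cast; ring
  have e2 : ((k + d + 1 : ℕ) : ℝ) + j + 3 / 2 = k + (j + d : ℕ) + 5 / 2 := by push_cast; ring
  have e3 : 2 * ((k + d + 1 : ℕ) : ℝ) + j + 5 / 2 = 2 * k + 2 * (j + d : ℕ) + 7 / 2 - j + 1 := by
    push_cast; ring
  have e4 : (k + d + 3 / 2 : ℝ) = k + 3 / 2 + d := by ring
  have e5 : (k + d + 2 : ℝ) = k + 2 + d := by ring
  have e6 : (-2 * k - 2 * (j + d : ℕ) - 7 / 2 : ℝ) = -(2 * k + 2 * (j + d : ℕ) + 7 / 2) := by ring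
  have e7 : ((j + d).choose j : ℝ) = (j + d).factorial / (j.factorial * d.factorial) :=
    Nat.cast_add_choose ℝ
  rw [e1, e2, e3, e4, e5, e6, e7, pochhammer_neg]
  have e8 : Real.Gamma (k + 3 / 2) * pochhammer (k + 3 / 2) d = Real.Gamma (k + 3 / 2 + d) :=
    (Gamma_add_natCast (by linarith) d).symm
  have e9 : Real.Gamma (k + 2) * pochhammer (k + 2) d = Real.Gamma (k + 2 + d) :=
    (Gamma_add_natCast (by linarith) d).symm
  have hjf : (j.factorial : ℝ) ≠ 0 := by positivity
  have hdf : (d.factorial : ℝ) ≠ 0 := by positivity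
  rw [← e9] at g1 ⊢
  rw [← e8]
  generalize Real.Gamma (k + (j + d : ℕ) + 5 / 2) = a at *
  generalize Real.Gamma (k + 2) = b at *
  generalize pochhammer (k + 2 : ℝ) d = f at *
  field_simp

/-- Increasing n by one multiplies the factorial by four consecutive factors: the two even ones are
4(k+n+5/2) and 4(k+n+3), the two odd ones are 2(2k+2n+11/2) and 2(2k+2n+13/2). With the additional 2
the constant is 128. -/
lemma two_pow_mul_factorial_eq (k n : ℕ) : 2 ^ n * ((4 * k + 4 * n + 9).factorial : ℝ) =
    (4 * k + 9).factorial * pochhammer (k + 5 / 2) n * rebitDenominator n k := by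
  induction n with
  | zero => simp [pochhammer_zero, rebitDenominator]
  | succ n ih =>
    have e : 4 * k + 4 * (n + 1) + 9 = (4 * k + 4 * n + 9) + 1 + 1 + 1 + 1 := by ring
    rw [e, Nat.factorial_succ, Nat.factorial_succ, Nat.factorial_succ, Nat.factorial_succ]
    rw [rebitDenominator] at ih ⊢
    rw [mul_add_one 2 n, pochhammer_succ, pochhammer_succ (k + 3 : ℝ), ← add_assoc _ 1 1,
      pochhammer_succ (2 * k + 11 / 2 : ℝ), pochhammer_succ (2 * k + 11 / 2 : ℝ)]
    push_cast
    linear_combination (2 * (4 * k + 4 * n + 9 + 1) * (4 * k + 4 * n + 9 + 1 + 1) *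
      (4 * k + 4 * n + 9 + 1 + 1 + 1) * (4 * k + 4 * n + 9 + 1 + 1 + 1 + 1) : ℝ) * ih

lemma rebitNumerator_zero (k : ℝ) : rebitNumerator 0 k = 1 := by
  simp [rebitNumerator, pochhammer_zero]

lemma rebitDenominator_pos (n k : ℕ) : 0 < rebitDenominator n k := by
  have h1 := pochhammer_pos (show (0 : ℝ) < k + 3 by positivity) n
  have h2 := pochhammer_pos (show (0 : ℝ) < 2 * k + 11 / 2 by positivity) (2 * n)
  unfold rebitDenominator
  positivity

/-- Both the nonvanishing of the comparison constant and that of the volume follow from the positive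
value of the cone integral at k = n = 0. The ratio to n = 0 then eliminates the constant, and the
factors (k+5/2)_n from the Gamma quotient and from the factorials cancel. -/
lemma sectionMoment_eq (μ : Measure tracelessSymmetric) [μ.IsAddHaarMeasure] :
    μ.real densityParts ≠ 0 ∧ ∀ k n : ℕ, sectionMoment μ k n =
      rebitNumerator n k / rebitDenominator n k * sectionMoment μ k 0 := by
  obtain ⟨c, hc⟩ := integrable_and_integral_coneWeight μ
  have key : ∀ k n : ℕ, c * (4 * k + 4 * n + 9).factorial * sectionMoment μ k n =
      Real.pi ^ 3 * k.factorial * Real.Gamma (k + 3 / 2) *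
      Real.Gamma (k + 2) * Real.Gamma (k + n + 5 / 2) * (rebitNumerator n k / 2 ^ n) := fun k n => by
    rw [← (hc k n).2, integral_coneWeight k n (hc k n).1]
  have hG : ∀ x : ℝ, 0 < x → 0 < Real.Gamma x := fun x hx => Real.Gamma_pos_of_pos hx
  have h00 := key 0 0
  have hne : c ≠ 0 ∧ sectionMoment μ 0 0 ≠ 0 := by
    have : 0 < Real.pi ^ 3 * (Nat.factorial 0) * Real.Gamma ((0 : ℕ) + 3 / 2) *
      Real.Gamma ((0 : ℕ) + 2) * Real.Gamma ((0 : ℕ) + (0 : ℕ) + 5 / 2) *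
        (rebitNumerator 0 (0 : ℕ) / 2 ^ 0) := by
      have h1 := hG ((0 : ℕ) + 3 / 2) (by norm_num)
      have h2 := hG ((0 : ℕ) + 2) (by norm_num)
      have h3 := hG ((0 : ℕ) + (0 : ℕ) + 5 / 2) (by norm_num)
      rw [rebitNumerator_zero]
      positivity
    rw [← h00] at this
    constructor <;> rintro h <;> simp [h] at this
  refine ⟨by rw [← sectionMoment_zero_zero]; exact hne.2, fun k n => ?_⟩
  have h1 := key k n
  have h2 := key k 0
  rw [rebitNumerator_zero] at h2
  have h3 := two_pow_mul_factorial_eq k n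
  have h4 : Real.Gamma (k + n + 5 / 2) = Real.Gamma (k + 5 / 2) * pochhammer (k + 5 / 2) n := by
    rw [← Gamma_add_natCast (by positivity)]
    congr 1
    ring
  rw [h4] at h1
  have hB := (rebitDenominator_pos n k).ne'
  have hp := (pochhammer_pos (show (0 : ℝ) < k + 5 / 2 by positivity) n).ne'
  simp only [mul_zero, add_zero, Nat.cast_zero, pow_zero, div_one, mul_one] at h2
  have hf : ((4 * k + 9).factorial : ℝ) ≠ 0 := by positivity
  have hc0 := hne.1
  have h5 : c * (4 * k + 4 * n + 9).factorial * sectionMoment μ k n =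
      c * (4 * k + 9).factorial * sectionMoment μ k 0 * pochhammer (k + 5 / 2) n *
        (rebitNumerator n k / 2 ^ n) := by
    rw [h1, h2]
    ring
  have h6 : c * (4 * k + 9).factorial * pochhammer (k + 5 / 2) n ≠ 0 :=
    mul_ne_zero (mul_ne_zero hc0 hf) hp
  rw [div_mul_eq_mul_div, eq_div_iff hB]
  apply mul_left_cancel₀ h6
  have h7 : rebitNumerator n k / 2 ^ n * 2 ^ n = rebitNumerator n k :=
    div_mul_cancel₀ _ (by positivity)
  linear_combination c * sectionMoment μ k n * (-h3) + 2 ^ n * h5 +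
    c * (4 * k + 9).factorial * sectionMoment μ k 0 * pochhammer (k + 5 / 2) n * h7

lemma rebitMoment_eq_mul (k n : ℕ) : rebitMoment k n =
    rebitNumerator n k / rebitDenominator n k * rebitMoment k 0 := by
  rw [rebitMoment_eq, rebitMoment_eq, (sectionMoment_eq tracelessVolume).2 k n]
  ring

/-! ### The numerators as polynomials -/

lemma rebitArrayNumerator_eq {n : ℕ} (h1 : 1 ≤ n) (h6 : n ≤ 6) (k : ℝ) :
    rebitNumerator n k = rebitArrayNumerator n k := by
  interval_cases n <;>
  · simp only [rebitNumerator, rebitArrayNumerator, rebitCoefficients, Finset.sum_range_succ,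
      Finset.sum_range_zero, pochhammer_succ, pochhammer_zero, Nat.factorial, List.getD_cons_zero,
      List.getD_cons_succ, Nat.reduceMul, Nat.reduceAdd, Nat.reduceSub]
    push_cast
    ring


theorem mainTheorem1 :
    -- the expectations are taken over a probability distribution and exist
    IsProbabilityMeasure twoRebitHS ∧
    (∀ k n : ℕ, Integrable
      (fun ρ : RebitMatrix => ρ.det ^ k * (partialTranspose ρ).det ^ n) twoRebitHS) ∧
    -- the case n = 1
    (∀ k : ℕ, rebitMoment k 1 =
      (((k : ℝ) - 1) * (k * (2 * k + 11) + 16)) /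
        (32 * (k + 3) * (4 * k + 11) * (4 * k + 13)) * rebitMoment k 0) ∧
    -- the case n = 2
    (∀ k : ℕ, rebitMoment k 2 =
      ((k : ℝ) * (k * (k * (k * (4 * k * (k + 12) + 203) + 368) + 709) + 2940) + 4860) /
        (1024 * (k + 3) * (k + 4) * (4 * k + 11) * (4 * k + 13) * (4 * k + 15) * (4 * k + 17))
        * rebitMoment k 0) ∧
    -- the case n = 3
    (∀ k : ℕ, rebitMoment k 3 =
      (8 * (k : ℝ) ^ 9 + 180 * k ^ 8 + 1674 * k ^ 7 + 8559 * k ^ 6 + 29493 * k ^ 5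
          + 84291 * k ^ 4 + 136801 * k ^ 3 - 401334 * k ^ 2 - 2516616 * k - 3612816) /
        (32768 * (k + 3) * (k + 4) * (k + 5) * (4 * k + 11) * (4 * k + 13) * (4 * k + 15)
          * (4 * k + 17) * (4 * k + 19) * (4 * k + 21)) * rebitMoment k 0) ∧
    -- the case n = 4
    (∀ k : ℕ, rebitMoment k 4 =
      (16 * (k : ℝ) ^ 12 + 576 * k ^ 11 + 9112 * k ^ 10 + 84496 * k ^ 9 + 525681 * k ^ 8
          + 2389416 * k ^ 7 + 7805462 * k ^ 6 + 13904508 * k ^ 5 + 6212189 * k ^ 4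
          + 166748972 * k ^ 3 + 1636873812 * k ^ 2 + 5496485760 * k + 6610161600) /
        rebitDenominator 4 k * rebitMoment k 0) ∧
    -- the coefficient array, n = 1, …, 6
    (∀ n : ℕ, 1 ≤ n → n ≤ 6 → ∀ k : ℕ, rebitMoment k n =
      rebitArrayNumerator n k / rebitDenominator n k * rebitMoment k 0) ∧
    -- all the cases n = 1, …, 13
    (∀ n : ℕ, 1 ≤ n → n ≤ 13 → ∀ k : ℕ, rebitMoment k n =
      rebitNumerator n k / rebitDenominator n k * rebitMoment k 0) ∧
    -- the vanishing moment
    rebitMoment 1 1 = 0 := by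
  have hvol := (sectionMoment_eq tracelessVolume).1
  have harr : ∀ n : ℕ, 1 ≤ n → n ≤ 6 → ∀ k : ℕ, rebitMoment k n =
      rebitArrayNumerator n k / rebitDenominator n k * rebitMoment k 0 := by
    intro n h1 h6 k
    rw [← rebitArrayNumerator_eq h1 h6]
    exact rebitMoment_eq_mul k n
  have hone : ∀ k : ℕ, rebitMoment k 1 =
      (((k : ℝ) - 1) * (k * (2 * k + 11) + 16)) /
        (32 * (k + 3) * (4 * k + 11) * (4 * k + 13)) * rebitMoment k 0 := by
    intro k
    rw [harr 1 le_rfl (by norm_num)]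
    congr 2
    · simp [rebitArrayNumerator, rebitCoefficients, Finset.sum_range_succ]
      ring
    · simp [rebitDenominator, pochhammer_succ, pochhammer_zero]
      ring
  refine ⟨isProbabilityMeasure_twoRebitHS hvol, integrable_twoRebitHS hvol, hone, fun k => ?_,
    fun k => ?_, fun k => ?_, harr, fun n _ _ k => rebitMoment_eq_mul k n, ?_⟩
  · rw [harr 2 (by norm_num) (by norm_num)]
    congr 2
    · simp [rebitArrayNumerator, rebitCoefficients, Finset.sum_range_succ]
      ring
    · simp [rebitDenominator, pochhammer_succ, pochhammer_zero]
      ring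
  · rw [harr 3 (by norm_num) (by norm_num)]
    congr 2
    · simp [rebitArrayNumerator, rebitCoefficients, Finset.sum_range_succ]
      ring
    · simp [rebitDenominator, pochhammer_succ, pochhammer_zero]
      ring
  · rw [harr 4 (by norm_num) (by norm_num)]
    congr 2
    simp [rebitArrayNumerator, rebitCoefficients, Finset.sum_range_succ]
    ring
  · rw [hone]
    simp
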